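/- **Theorem 2.** Let $F=(F_\lambda)_\lambda$, $F_\lambda:\{0,1\}^\lambda\times\{0,1\}^*\to\{0,1\}^\lambda$, be a pseudorandom function (PRF), i.e. a polynomial-time computable family such that no probabilistic polynomial-time (PPT) oracle machine distinguishes $F_\lambda(k,\cdot)$, for uniformly random $k$, from a uniformly random function $\{0,1\}^*\to\{0,1\}^\lambda$ with more than negligible advantage in $\lambda$. Let $E$ be the ideal cipher, i.e. for each key $K\in\{0,1\}^\lambda$ an independent uniformly random permutation $E_K$ of $\{0,1\}^\lambda$; all parties can query $E_K$ and $E_K^{-1}$. Then the scheme SHVE+ built from $F$ and $E$ is attribute-hiding (selectively simulation-secure) in the ideal cipher model. *The scheme.* An attribute vector is $\mathbf x=(x_1,\dots,x_n)$ and a predicate vector is $\mathbf v=(v_1,\dots,v_n)$, where the $x_l$ are bit strings and each $v_l$ is a bit string or the wildcard $*$. Put $P_{\mathbf v}(\mathbf x)=1$ if $v_l\in\{x_l,*\}$ for all $l$, and $P_{\mathbf v}(\mathbf x)=0$ otherwise. Messages are $m\in\{0,1\}^\lambda$, and $a\|l$ denotes an injective encoding of a string $a$ and a position $l$. - Setup: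 $msk$ is uniform in $\{0,1\}^\lambda$. - $\mathrm{Enc}(msk,\mathbf x)=(c_l)_{l\in[n]}$ with $c_l=F(msk,x_l\|l)$. - $\mathrm{KeyGen}(msk,\mathbf v,m)$: let $S=\{l: v_l\neq *\}$, choose $K$ uniform in $\{0,1\}^\lambda$, and output $(d_0,d_1,S)$ with $d_0=\bigoplus_{l\in S}F(msk,v_l\|l)\oplus K$ and $d_1=E_K(m)$. - $\mathrm{Query}((d_0,d_1,S),\mathbf c)=E_{K'}^{-1}(d_1)$ with $K'=\bigoplus_{l\in S}c_l\oplus d_0$. *Leakage.* $\alpha(\mathbf v)=\{l: v_l=*\}$; and $\beta'(\mathbf v,\mathbf x)=m$ if $P_{\mathbf v}(\mathbf x)=1$, while otherwise $\beta'(\mathbf v,\mathbf x)$ is a uniformly random element of $\{0,1\}^\lambda$, drawn afresh for each trapdoor query. *Security.* There is a PPT simulator $\mathcal S$ with access to $E$ such that for every PPT adversary $\mathcal A$ with access to $E$ $$\bigl|\Pr[\mathbf{Real}_{\mathcal A}(\lambda)=1]-\Pr[\mathbf{Ideal}_{\mathcal A,\mathcal S}(\lambda)=1]\bigr|$$ is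 negligible in $\lambda$. In both experiments $\mathcal A$, on input $1^\lambda$, chooses an attribute vector $\mathbf x$ (of any length $n$), receives a ciphertext, then adaptively makes trapdoor queries $(\mathbf v,m)$ with $\mathbf v$ of length $n$, and finally outputs a bit. In $\mathbf{Real}$ it receives $\mathrm{Enc}(msk,\mathbf x)$ and $\mathrm{KeyGen}(msk,\mathbf v,m)$ for one random $msk$. In $\mathbf{Ideal}$ it receives the outputs of $\mathcal S$, which is given only $1^\lambda,1^n$ for the ciphertext, and in addition only $\alpha(\mathbf v)$ and $\beta'(\mathbf v,\mathbf x)$ (besides its own state) for each trapdoor; $\mathcal S$ runs in time polynomial in $\lambda+n$ per invocation. -/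

import Mathlib

noncomputable section

/-! ## A machine model with a step count

Programs are WHILE-programs over binary trees (assignments with `nil`, `cons`, `hd`, `tl`, tests
against `nil`, sequencing, branching, loops), extended by coin flips and oracle calls.
One elementary step costs one time unit. With trees stored as shared pointer structures this model
and probabilistic oracle Turing machines simulate each other with polynomial overhead. -/

/-- The data of the machine model: binary trees. -/
inductive Val : Type
  | nil : Val
  | cons : Val → Val → Val
  deriving DecidableEq

namespace Val

def hd : Val → Val
  | nil => nil
  | cons a _ => a

def tl : Val → Val
  | nil => nil
  | cons _ b => b

/-- The two bits as trees: `nil` is false, anything else is read as true. -/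
def ofBool : Bool → Val
  | false => nil
  | true => cons nil nil

def toBool : Val → Bool
  | nil => false
  | cons _ _ => true

/-- Lists are right-nested pairs that end in `nil`. -/
def ofList : List Val → Val
  | [] => nil
  | a :: t => cons a (ofList t)

def toList : Val → List Val
  | nil => []
  | cons a t => a :: toList t

/-- Bit strings as trees, and the bit string that a tree is read as. -/
def ofBits (s : List Bool) : Val := ofList (s.map ofBool)

def toBits (t : Val) : List Bool := t.toList.map toBool

/-- The number `n` in unary. -/
def unary (n : ℕ) : Val := ofBits (List.replicate n true)

end Val

/-- Expressions over variables that are numbered by `ℕ`. -/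
inductive Expr : Type
  | var : ℕ → Expr
  | nil : Expr
  | cons : Expr → Expr → Expr
  | hd : Expr → Expr
  | tl : Expr → Expr

/-- The memory of a machine: the contents of its variables. -/
abbrev Store : Type := ℕ → Val

def Expr.eval (s : Store) : Expr → Val
  | .var i => s i
  | .nil => Val.nil
  | .cons a b => Val.cons (a.eval s) (b.eval s)
  | .hd a => (a.eval s).hd
  | .tl a => (a.eval s).tl

/-- Programs. -/
inductive Prog : Type
  /-- `x_i := e` -/
  | assign : ℕ → Expr → Prog
  /-- `x_i :=` a uniformly random bit -/
  | flip : ℕ → Prog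
  /-- `x_i :=` the answer of the oracle to the value of `e` -/
  | call : ℕ → Expr → Prog
  /-- first one program, then the other -/
  | seq : Prog → Prog → Prog
  /-- `if e ≠ nil then c else d` -/
  | cond : Expr → Prog → Prog → Prog
  /-- `while e ≠ nil do c` -/
  | loop : Expr → Prog → Prog

/-- A (randomised, stateful) oracle with internal states in `σ`. -/
abbrev Oracle (σ : Type) : Type := σ → Val → PMF (Val × σ)

/-- A configuration: the commands that are still to be executed, and the memory. -/
abbrev Config : Type := List Prog × Store

/-- One step of a machine with an oracle. A machine without remaining commands has halted. -/
def step {σ : Type} (O : Oracle σ) : Config × σ → PMF (Config × σ)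
  | (([], s), o) => PMF.pure (([], s), o)
  | ((.assign i e :: k, s), o) => PMF.pure ((k, Function.update s i (e.eval s)), o)
  | ((.flip i :: k, s), o) =>
      (PMF.uniformOfFintype Bool).map fun b => ((k, Function.update s i (Val.ofBool b)), o)
  | ((.call i e :: k, s), o) =>
      (O o (e.eval s)).map fun r => ((k, Function.update s i r.1), r.2)
  | ((.seq c d :: k, s), o) => PMF.pure ((c :: d :: k, s), o)
  | ((.cond e c d :: k, s), o) =>
      PMF.pure (((if e.eval s ≠ Val.nil then c else d) :: k, s), o)
  | ((.loop e c :: k, s), o) =>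
      PMF.pure ((if e.eval s ≠ Val.nil then c :: .loop e c :: k else k, s), o)

/-- `T` consecutive steps. -/
def steps {σ : Type} (O : Oracle σ) : ℕ → Config × σ → PMF (Config × σ)
  | 0, z => PMF.pure z
  | T + 1, z => (step O z).bind (steps O T)

/-- The output of the program `P` on `input` when it is stopped after `T` steps: the contents of
variable `0`, where also the input is placed at the beginning (all other variables start as
`nil`). -/
def Prog.output {σ : Type} (P : Prog) (O : Oracle σ) (o : σ) (T : ℕ) (input : Val) : PMF Val :=
  (steps O T (([P], Function.update (fun _ => Val.nil) 0 input), o)).map fun z => z.1.2 0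

/-- A probabilistic polynomial-time oracle machine: a program together with a polynomial that
bounds its number of steps (the machine is stopped when the bound is reached). -/
structure PPT where
  prog : Prog
  time : Polynomial ℕ

/-- The output of a probabilistic polynomial-time machine for the size parameter `N`. -/
def PPT.output {σ : Type} (M : PPT) (O : Oracle σ) (o : σ) (N : ℕ) (input : Val) : PMF Val :=
  M.prog.output O o (M.time.eval N) input

/-- The oracle that always answers `nil`; a machine that is run with it has no oracle. -/
def noOracle : Oracle Unit := fun _ _ => PMF.pure (Val.nil, ())

/-- The probability that the output bit is `1`. -/
def prOne (p : PMF Val) : ℝ := ((p.map Val.toBool) true).toReal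

/-- Negligible functions of the security parameter. -/
def Negligible (f : ℕ → ℝ) : Prop :=
  Asymptotics.SuperpolynomialDecay Filter.atTop (fun κ : ℕ => (κ : ℝ)) f

/-! ## Bit strings of length `κ` -/

/-- `{0,1}^κ`. -/
abbrev Block (κ : ℕ) : Type := Fin κ → Bool

namespace Block

/-- Bitwise exclusive or. -/
def xor {κ : ℕ} (a b : Block κ) : Block κ := fun i => Bool.xor (a i) (b i)

def toVal {κ : ℕ} (a : Block κ) : Val := Val.ofBits (List.ofFn a)

/-- Reads a tree as a string of `κ` bits (cut off, or filled up with zeros, if necessary). -/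
def ofVal (κ : ℕ) (t : Val) : Block κ := fun i => t.toBits.getD i false

/-- The exclusive or of the strings `g l`, `l ∈ S`. -/
def xorOver {κ n : ℕ} (S : Finset (Fin n)) (g : Fin n → Block κ) : Block κ :=
  ((List.finRange n).filter fun l => l ∈ S).foldr (fun l acc => (g l).xor acc) fun _ => false

end Block

/-- The uniform distribution on `{0,1}^κ`. -/
def uniformBlock (κ : ℕ) : PMF (Block κ) := PMF.uniformOfFintype (Block κ)

/-! ## Pseudorandom functions -/

/-- A keyed function family `{0,1}^κ × {0,1}^* → {0,1}^κ`. -/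
abbrev KeyedFamily : Type := (κ : ℕ) → Block κ → List Bool → Block κ

/-- Oracle access to a fixed function on bit strings. -/
def funOracle {κ : ℕ} (f : List Bool → Block κ) : Oracle Unit :=
  fun _ q => PMF.pure ((f q.toBits).toVal, ())

/-- Oracle access to a uniformly random function `{0,1}^* → {0,1}^κ`; its values are drawn when
they are asked for the first time, and the state is the table of the values drawn so far. -/
def randomFunOracle (κ : ℕ) : Oracle (List Bool → Option (Block κ)) :=
  fun T q =>
    match T q.toBits with
    | some y => PMF.pure (y.toVal, T)
    | none => (uniformBlock κ).map fun y => (y.toVal, Function.update T q.toBits (some y))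

/-- The probability that `B` outputs `1` with oracle access to `F(k, ·)`, `k` uniformly random. -/
def prfReal (F : KeyedFamily) (B : PPT) (κ : ℕ) : ℝ :=
  prOne ((uniformBlock κ).bind fun k => B.output (funOracle (F κ k)) () κ (Val.unary κ))

/-- The probability that `B` outputs `1` with oracle access to a random function. -/
def prfRandom (B : PPT) (κ : ℕ) : ℝ :=
  prOne (B.output (randomFunOracle κ) (fun _ => none) κ (Val.unary κ))

/-- A pseudorandom function: a polynomial-time computable family which no probabilistic
polynomial-time oracle machine distinguishes from random functions. -/
structure IsPRF (F : KeyedFamily) : Prop where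
  computable : ∃ M : PPT, ∀ (κ : ℕ) (k : Block κ) (s : List Bool),
    M.output noOracle () (κ + s.length)
      (Val.cons (Val.unary κ) (Val.cons k.toVal (Val.ofBits s))) = PMF.pure (F κ k s).toVal
  pseudorandom : ∀ B : PPT, Negligible fun κ => |prfReal F B κ - prfRandom B κ|

/-! ## The ideal cipher -/

/-- Block ciphers with keys and blocks in `{0,1}^κ`: a permutation of the blocks for each key. -/
abbrev Cipher (κ : ℕ) : Type := Block κ → Equiv.Perm (Block κ)

/-- The ideal cipher: a uniformly random block cipher. -/
def idealCipher (κ : ℕ) : PMF (Cipher κ) := PMF.uniformOfFintype (Cipher κ)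

/-- The answer to a cipher query `(direction, (key, block))`: the encryption of the block if the
direction is `nil`, and its decryption otherwise. -/
def cipherAnswer {κ : ℕ} (E : Cipher κ) (q : Val) : Val :=
  let K := Block.ofVal κ q.tl.hd
  let b := Block.ofVal κ q.tl.tl
  if q.hd = Val.nil then (E K b).toVal else ((E K).symm b).toVal

def cipherOracle {κ : ℕ} (E : Cipher κ) : Oracle Unit :=
  fun _ q => PMF.pure (cipherAnswer E q, ())

/-! ## The scheme SHVE+ in the ideal cipher model

Attributes are bit strings. The symmetric scheme `Sym` is the cipher `E`, so messages are blocks. -/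

/-- The attributes. -/
abbrev Attr : Type := List Bool

/-- Attribute vectors. -/
abbrev AttrVec (n : ℕ) : Type := Fin n → Attr

/-- Predicate vectors; `none` is the wildcard. -/
abbrev PredVec (n : ℕ) : Type := Fin n → Option Attr

/-- `P_v(x) = 1`. -/
def Matches {n : ℕ} (v : PredVec n) (x : AttrVec n) : Prop :=
  ∀ l, v l = some (x l) ∨ v l = none

instance {n : ℕ} (v : PredVec n) (x : AttrVec n) : Decidable (Matches v x) := by
  unfold Matches; infer_instance

/-- The non-wildcard positions of a predicate vector. -/
def nonWild {n : ℕ} (v : PredVec n) : Finset (Fin n) := {l | v l ≠ none}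

/-- The bit string `a || l`: the attribute, a separator, and the position (counted from `1`) in
unary. It determines `a` and `l`. -/
def tagged {n : ℕ} (a : Attr) (l : Fin n) : List Bool :=
  a ++ false :: List.replicate (l + 1) true

/-- Trapdoors `(d₀, d₁, S)`. -/
structure Trapdoor (κ n : ℕ) where
  d₀ : Block κ
  d₁ : Block κ
  S : Finset (Fin n)

namespace SHVEPlus

/-- The master secret key is a uniformly random string in `{0,1}^κ`. -/
def setup (κ : ℕ) : PMF (Block κ) := uniformBlock κ

/-- The trapdoor for the predicate vector `v` and the message `m`. -/
def keyGen (F : KeyedFamily) {κ n : ℕ} (E : Cipher κ) (msk : Block κ) (v : PredVec n)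
    (m : Block κ) : PMF (Trapdoor κ n) :=
  (uniformBlock κ).map fun K =>
    { d₀ := (Block.xorOver (nonWild v) fun l => F κ msk (tagged ((v l).getD []) l)).xor K
      d₁ := E K m
      S := nonWild v }

/-- The ciphertext of the attribute vector `x`. -/
def enc (F : KeyedFamily) {κ n : ℕ} (msk : Block κ) (x : AttrVec n) : Fin n → Block κ :=
  fun l => F κ msk (tagged (x l) l)

/-- The result of a trapdoor on a ciphertext. -/
def query {κ n : ℕ} (E : Cipher κ) (s : Trapdoor κ n) (c : Fin n → Block κ) : Block κ :=
  (E ((Block.xorOver s.S c).xor s.d₀)).symm s.d₁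

end SHVEPlus

/-! ## Leakage -/

/-- `α(v)`: the wildcard positions of `v`. -/
def leakWild {n : ℕ} (v : PredVec n) : Finset (Fin n) := {l | v l = none}

/-- `β'(v, x)`: the message if `P_v(x) = 1`, and a fresh uniformly random string otherwise. -/
def leakQuery {κ n : ℕ} (v : PredVec n) (x : AttrVec n) (m : Block κ) : PMF (Block κ) :=
  if Matches v x then PMF.pure m else uniformBlock κ

/-! ## The security experiments -/

/-- A set of positions as the list of its `n` indicator bits. -/
def positionsToVal {n : ℕ} (S : Finset (Fin n)) : Val :=
  Val.ofBits (List.ofFn fun l => decide (l ∈ S))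

def ciphertextToVal {κ n : ℕ} (c : Fin n → Block κ) : Val :=
  Val.ofList (List.ofFn fun l => (c l).toVal)

def Trapdoor.toVal {κ n : ℕ} (s : Trapdoor κ n) : Val :=
  Val.cons s.d₀.toVal (Val.cons s.d₁.toVal (positionsToVal s.S))

/-- The length of the attribute vector that a tree encodes: a list of attributes. -/
def vecLength (t : Val) : ℕ := t.toList.length

def attrVecOfVal (t : Val) : AttrVec (vecLength t) := fun l => (t.toList.get l).toBits

/-- The entry of a predicate vector that a tree encodes: `nil` is the wildcard, and `cons _ a` is
the attribute `a`. -/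
def predEntryOfVal : Val → Option Attr
  | .nil => none
  | .cons _ a => some a.toBits

/-- The predicate vector of length `n` that a tree encodes; missing entries are wildcards. -/
def predVecOfVal (n : ℕ) (t : Val) : PredVec n := fun l => predEntryOfVal (t.toList.getD l .nil)

/-- A party that answers the adversary: it produces the challenge ciphertext and the trapdoors, and
keeps an internal state in `Val`. -/
structure Challenger (κ : ℕ) where
  ciphertext : {n : ℕ} → AttrVec n → PMF (Val × Val)
  trapdoor : {n : ℕ} → AttrVec n → Val → PredVec n → Block κ → PMF (Val × Val)

/-- The state of an experiment: nothing before the challenge; afterwards the challenge attribute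
vector and the internal state of the challenger. -/
abbrev GameState : Type := Option ((n : ℕ) × AttrVec n × Val)

/-- The oracle of the adversary. It answers
* cipher queries `cons nil q`,
* the challenge `cons (cons nil _) x`, by a ciphertext of the attribute vector `x`; only one
  challenge is answered,
* trapdoor queries `cons (cons (cons _ _) _) (cons v m)` for a predicate vector `v` of the length of
  `x` and a message `m`; they are answered only after the challenge. -/
def gameOracle {κ : ℕ} (E : Cipher κ) (C : Challenger κ) : Oracle GameState
  | st, .cons .nil q => PMF.pure (cipherAnswer E q, st)
  | none, .cons (.cons .nil _) x =>
      (C.ciphertext (attrVecOfVal x)).map fun r => (r.1, some ⟨_, attrVecOfVal x, r.2⟩)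
  | some ⟨n, x, z⟩, .cons (.cons (.cons _ _) _) (.cons v m) =>
      (C.trapdoor x z (predVecOfVal n v) (Block.ofVal κ m)).map fun r => (r.1, some ⟨n, x, r.2⟩)
  | st, _ => PMF.pure (Val.nil, st)

/-- The challenger of the real experiment runs SHVE+ (and needs no state). -/
def realChallenger (F : KeyedFamily) {κ : ℕ} (E : Cipher κ) (msk : Block κ) : Challenger κ where
  ciphertext x := PMF.pure (ciphertextToVal (SHVEPlus.enc F msk x), Val.nil)
  trapdoor _ _ v m := (SHVEPlus.keyGen F E msk v m).map fun s => (s.toVal, Val.nil)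

/-- A simulator: two probabilistic polynomial-time machines with access to the ideal cipher, one
for the challenge ciphertext and one for the trapdoors. Each outputs a pair of its answer and its
new internal state. Time is measured in `κ + n`. -/
structure Simulator where
  ciphertext : PPT
  trapdoor : PPT

/-- The challenger of the ideal experiment runs the simulator. For the ciphertext the simulator is
given only `κ` and the length `n`, and for a trapdoor only `κ`, `n`, its own state, `α(v)` and
`β'(v, x)`. -/
def idealChallenger (S : Simulator) {κ : ℕ} (E : Cipher κ) : Challenger κ where
  ciphertext {n} _ :=
    (S.ciphertext.output (cipherOracle E) () (κ + n) (Val.cons (Val.unary κ) (Val.unary n))).map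
      fun t => (t.hd, t.tl)
  trapdoor {n} x z v m :=
    (leakQuery v x m).bind fun b =>
      (S.trapdoor.output (cipherOracle E) () (κ + n)
        (Val.cons (Val.unary κ) (Val.cons (Val.unary n)
          (Val.cons z (Val.cons (positionsToVal (leakWild v)) b.toVal))))).map
        fun t => (t.hd, t.tl)

/-- The probability that the adversary outputs `1` in the real experiment. -/
def realExp (F : KeyedFamily) (A : PPT) (κ : ℕ) : ℝ :=
  prOne ((idealCipher κ).bind fun E => (SHVEPlus.setup κ).bind fun msk =>
    A.output (gameOracle E (realChallenger F E msk)) none κ (Val.unary κ))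

/-- The probability that the adversary outputs `1` in the ideal experiment. -/
def idealExp (S : Simulator) (A : PPT) (κ : ℕ) : ℝ :=
  prOne ((idealCipher κ).bind fun E =>
    A.output (gameOracle E (idealChallenger S E)) none κ (Val.unary κ))

/-- SHVE+ is attribute-hiding in the ideal cipher model: one simulator, which gets only the leakage,
works against all probabilistic polynomial-time adversaries. -/
def AttributeHiding (F : KeyedFamily) : Prop :=
  ∃ S : Simulator, ∀ A : PPT, Negligible fun κ => |realExp F A κ - idealExp S A κ|

end

/-! The proof is a chain of games between the real and the ideal experiment, all run against the
same adversary with `T` steps.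

The simulator draws a uniformly random ciphertext `c` and keeps it as its state. For a trapdoor it
draws a uniform `d`, forms the key `X ⊕ d`, where `X` is the exclusive or of the `c_l` over the
positions without wildcard, and outputs `d` together with the encryption of the leaked block under
that key. On a match this is the real computation with `K = X ⊕ d`. Otherwise the leaked block is
fresh and uniform, and since each `E_K` is a permutation, `d₁` is uniform. So for every fixed cipher
the ideal experiment is exactly the game `simClient` (`gameOracle_sim`).

In the real experiment the ideal cipher is first replaced by a table that is filled on demand with
independent uniform blocks (`ev_idealCipher_steps_le`). An answer is then off only where a
permutation excludes some values, which costs at most `T² / 2^κ`. This step also makes the game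
executable by a machine without a cipher: `exists_distinguisher` gives a program that runs the
adversary inside the game, with only a function oracle, so the pseudorandom function may be replaced
by a random one.

The information-theoretic core is `ev_real_steps_le_sim`. Over a random function, a trapdoor that
does not match is masked by at least one value that the ciphertext does not reveal. Its `d₀` is
uniform because `K` is fresh, and its `d₁` is uniform unless `K` is a key already in the table. Its
cipher key, given `d₀`, is determined by function values that can be regarded as still undrawn. The
same undrawn value may mask several trapdoors, so hidden keys need not be independent. Each of them
is nevertheless uniform, and a union bound over the hidden keys suffices: as long as no cipher query
is made under a hidden key, the hidden entries do not influence any answer. The loss is again at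
most `T² / 2^κ`.

A last passage from the table back to the ideal cipher, in the simulated game, costs the same
amount. In all, the advantage is at most that of the distinguisher plus `3 T² / 2^κ`. Each
comparison is proved as a one-sided inequality for arbitrary tests with values in `[0,1]`; applying
it to a test and to its complement gives the absolute value. -/

noncomputable section

open scoped ENNReal

/-! ## Expectations -/

namespace PMF

/-- The expectation of a nonnegative function. -/
def ev {α : Type} (p : PMF α) (f : α → ℝ≥0∞) : ℝ≥0∞ := ∑' a, p a * f a

variable {α β γ : Type}

@[simp] theorem ev_pure (a : α) (f : α → ℝ≥0∞) : (PMF.pure a).ev f = f a := by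
  classical
  unfold ev
  rw [tsum_eq_single a]
  · simp
  · intro b hb; simp [PMF.pure_apply, hb]

@[simp] theorem ev_bind (p : PMF α) (g : α → PMF β) (f : β → ℝ≥0∞) :
    (p.bind g).ev f = p.ev fun a => (g a).ev f := by
  unfold ev
  simp only [PMF.bind_apply, ← ENNReal.tsum_mul_left, ← ENNReal.tsum_mul_right]
  rw [ENNReal.tsum_comm]
  simp only [mul_assoc]

@[simp] theorem ev_map (p : PMF α) (g : α → β) (f : β → ℝ≥0∞) :
    (p.map g).ev f = p.ev fun a => f (g a) := by
  rw [← PMF.bind_pure_comp, ev_bind]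
  simp

theorem ev_mono_support (p : PMF α) {f g : α → ℝ≥0∞} (h : ∀ a ∈ p.support, f a ≤ g a) :
    p.ev f ≤ p.ev g := by
  refine ENNReal.tsum_le_tsum fun a => ?_
  by_cases ha : p a = 0
  · simp [ha]
  · gcongr; exact h a ((PMF.mem_support_iff _ _).2 ha)

theorem ev_mono (p : PMF α) {f g : α → ℝ≥0∞} (h : ∀ a, f a ≤ g a) : p.ev f ≤ p.ev g :=
  p.ev_mono_support fun a _ => h a

theorem ev_congr_support (p : PMF α) {f g : α → ℝ≥0∞} (h : ∀ a ∈ p.support, f a = g a) :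
    p.ev f = p.ev g :=
  le_antisymm (p.ev_mono_support fun a ha => (h a ha).le)
    (p.ev_mono_support fun a ha => (h a ha).ge)

@[simp] theorem ev_const (p : PMF α) (c : ℝ≥0∞) : (p.ev fun _ => c) = c := by
  unfold ev
  rw [ENNReal.tsum_mul_right, p.tsum_coe, one_mul]

theorem ev_add (p : PMF α) (f g : α → ℝ≥0∞) : (p.ev fun a => f a + g a) = p.ev f + p.ev g := by
  unfold ev
  simp only [mul_add]
  exact ENNReal.tsum_add

theorem ev_add_const (p : PMF α) (f : α → ℝ≥0∞) (c : ℝ≥0∞) :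
    (p.ev fun a => f a + c) = p.ev f + c := by
  rw [ev_add, ev_const]

theorem ev_le_of_le (p : PMF α) {f : α → ℝ≥0∞} {c : ℝ≥0∞} (h : ∀ a, f a ≤ c) : p.ev f ≤ c :=
  (p.ev_mono h).trans_eq (p.ev_const c)

theorem ev_comm (p : PMF α) (q : PMF β) (f : α → β → ℝ≥0∞) :
    (p.ev fun a => q.ev (f a)) = q.ev fun b => p.ev fun a => f a b := by
  unfold ev
  simp only [← ENNReal.tsum_mul_left]
  rw [ENNReal.tsum_comm]
  refine tsum_congr fun b => tsum_congr fun a => ?_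
  rw [mul_left_comm]

theorem ev_finset_sum {ι : Type} (p : PMF α) (s : Finset ι) (f : ι → α → ℝ≥0∞) :
    (p.ev fun a => ∑ i ∈ s, f i a) = ∑ i ∈ s, p.ev (f i) := by
  classical
  induction s using Finset.induction_on with
  | empty => simp
  | insert i s hi ih => simp only [Finset.sum_insert hi, ev_add, ih]

theorem ev_one_sub (p : PMF α) {f : α → ℝ≥0∞} (hf : ∀ a, f a ≤ 1) :
    (p.ev fun a => 1 - f a) = 1 - p.ev f := by
  refine ENNReal.eq_sub_of_add_eq (ne_top_of_le_ne_top ENNReal.one_ne_top (p.ev_le_of_le hf)) ?_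
  rw [← ev_add]
  simp only [tsub_add_cancel_of_le (hf _), ev_const]

theorem ev_single [DecidableEq α] (p : PMF α) (a : α) : (p.ev fun b => if b = a then 1 else 0) = p a := by
  unfold ev
  rw [tsum_eq_single a]
  · simp
  · intro b hb; simp [hb]

/-- Both sides have total mass one, so a strict inequality at one point could not be compensated.
For this reason the program logic below needs only lower bounds on expectations. -/
theorem eq_of_ev_le {p q : PMF α} (h : ∀ f : α → ℝ≥0∞, p.ev f ≤ q.ev f) : p = q := by
  classical
  have hle : ∀ a, p a ≤ q a := fun a => by
    rw [← ev_single p, ← ev_single q]; exact h _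
  ext a
  refine le_antisymm (hle a) ?_
  by_contra hlt
  rw [not_le] at hlt
  have := ENNReal.tsum_lt_tsum (by rw [p.tsum_coe]; exact ENNReal.one_ne_top) hle hlt
  rw [p.tsum_coe, q.tsum_coe] at this
  exact lt_irrefl _ this

theorem ext_ev {p q : PMF α} (h : ∀ f : α → ℝ≥0∞, p.ev f = q.ev f) : p = q :=
  eq_of_ev_le fun f => (h f).le

theorem ev_uniformOfFintype [Fintype α] [Nonempty α] (f : α → ℝ≥0∞) :
    (PMF.uniformOfFintype α).ev f = (Fintype.card α : ℝ≥0∞)⁻¹ * ∑ a, f a := by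
  unfold ev
  rw [tsum_fintype, Finset.mul_sum]
  simp

theorem ev_uniform_equiv [Fintype α] [Nonempty α] (e : α ≃ α) (f : α → ℝ≥0∞) :
    ((PMF.uniformOfFintype α).ev fun a => f (e a)) = (PMF.uniformOfFintype α).ev f := by
  rw [ev_uniformOfFintype, ev_uniformOfFintype, e.sum_comp]

theorem ev_uniform_fin_succ [Fintype α] [Nonempty α] (n : ℕ) (f : (Fin (n + 1) → α) → ℝ≥0∞) :
    (PMF.uniformOfFintype (Fin (n + 1) → α)).ev f =
      (PMF.uniformOfFintype α).ev fun a =>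
        (PMF.uniformOfFintype (Fin n → α)).ev fun c => f (Fin.cons a c) := by
  simp only [ev_uniformOfFintype]
  rw [← Finset.mul_sum, ← mul_assoc, ← (Fin.consEquiv fun _ => α).sum_comp, Fintype.sum_prod_type]
  congr 1
  simp only [Fintype.card_fun, Fintype.card_fin, Nat.cast_pow, pow_succ]
  rw [Nat.cast_mul, Nat.cast_pow, ENNReal.mul_inv (by simp) (by simp), mul_comm]

end PMF

/-- One-sided closeness for all tests with values in `[0,1]` gives two-sided closeness. -/
theorem PMF.abs_sub_ev_toReal_le {α β : Type} {p : PMF α} {q : PMF β} {f : α → ℝ≥0∞}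
    {g : β → ℝ≥0∞} (hf : ∀ a, f a ≤ 1) (hg : ∀ b, g b ≤ 1) {δ : ℝ≥0∞} (hδ : δ ≠ ⊤)
    (h : p.ev f ≤ q.ev g + δ) (h' : (p.ev fun a => 1 - f a) ≤ (q.ev fun b => 1 - g b) + δ) :
    |(p.ev f).toReal - (q.ev g).toReal| ≤ δ.toReal := by
  have hp := p.ev_le_of_le hf
  have hq := q.ev_le_of_le hg
  have hp' := ne_top_of_le_ne_top ENNReal.one_ne_top hp
  have hq' := ne_top_of_le_ne_top ENNReal.one_ne_top hq
  rw [PMF.ev_one_sub _ hf, PMF.ev_one_sub _ hg] at h'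
  have h1 := ENNReal.toReal_mono (by simp [hq', hδ]) h
  have h2 := ENNReal.toReal_mono (by simp [hδ]) h'
  rw [ENNReal.toReal_add hq' hδ] at h1
  rw [ENNReal.toReal_add (by simp) hδ, ENNReal.toReal_sub_of_le hp (by simp),
    ENNReal.toReal_sub_of_le hq (by simp)] at h2
  rw [abs_le]
  constructor <;> linarith

theorem prOne_eq (p : PMF Val) :
    prOne p = (p.ev fun v => if v.toBool then 1 else 0).toReal := by
  unfold prOne
  rw [← PMF.ev_single, PMF.ev_map]

/-! ## Steps of a machine -/

/-- What a machine does next: an internal step, or a query to its oracle. -/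
inductive Act : Type
  | internal : PMF Config → Act
  | query : Val → (Val → Config) → Act

/-- The next action of a machine. -/
def act : Config → Act
  | ([], s) => .internal (PMF.pure ([], s))
  | (.assign i e :: k, s) => .internal (PMF.pure (k, Function.update s i (e.eval s)))
  | (.flip i :: k, s) => .internal
      ((PMF.uniformOfFintype Bool).map fun b => (k, Function.update s i (Val.ofBool b)))
  | (.call i e :: k, s) => .query (e.eval s) fun r => (k, Function.update s i r)
  | (.seq c d :: k, s) => .internal (PMF.pure (c :: d :: k, s))
  | (.cond e c d :: k, s) =>
      .internal (PMF.pure ((if e.eval s ≠ Val.nil then c else d) :: k, s))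
  | (.loop e c :: k, s) =>
      .internal (PMF.pure (if e.eval s ≠ Val.nil then c :: .loop e c :: k else k, s))

/-- One step of a machine, given its next action. -/
def Act.step {σ : Type} (O : Oracle σ) (o : σ) : Act → PMF (Config × σ)
  | .internal p => p.map fun c => (c, o)
  | .query q k => (O o q).map fun r => (k r.1, r.2)

/-- The choice of the machine is separated from the reply of the oracle. Two games played by the
same machine can then be compared by one case distinction on `act`, in which only the query case
depends on the game. -/
theorem step_eq_act {σ : Type} (O : Oracle σ) (c : Config) (o : σ) :
    step O (c, o) = (act c).step O o := by
  rcases c with ⟨_ | ⟨c, k⟩, s⟩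
  · simp [step, act, Act.step, PMF.pure_map]
  · cases c <;> simp [step, act, Act.step, PMF.pure_map, PMF.map_comp]; rfl

theorem ev_steps_zero {σ : Type} (O : Oracle σ) (z : Config × σ) (f : Config × σ → ℝ≥0∞) :
    (steps O 0 z).ev f = f z := by
  simp [steps]

theorem ev_steps_succ {σ : Type} (O : Oracle σ) (T : ℕ) (c : Config) (o : σ)
    (f : Config × σ → ℝ≥0∞) :
    (steps O (T + 1) (c, o)).ev f = ((act c).step O o).ev fun z => (steps O T z).ev f := by
  rw [steps, PMF.ev_bind, step_eq_act]

/-- Oracles whose states correspond under a map have the same behaviour. -/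
theorem steps_map_state {σ τ : Type} (O : Oracle σ) (O' : Oracle τ) (φ : σ → τ)
    (h : ∀ o q, O' (φ o) q = (O o q).map fun r => (r.1, φ r.2)) (T : ℕ) (c : Config) (o : σ) :
    steps O' T (c, φ o) = (steps O T (c, o)).map fun z => (z.1, φ z.2) := by
  refine PMF.ext_ev fun f => ?_
  rw [PMF.ev_map]
  induction T generalizing c o with
  | zero => simp [ev_steps_zero]
  | succ T ih =>
    rw [ev_steps_succ, ev_steps_succ]
    cases act c with
    | internal p => simp [Act.step, ih]
    | query q k => simp [Act.step, h, ih]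

end

noncomputable section

open scoped ENNReal

/-! ## Oracles that use a cipher -/

/-- Cipher queries: the direction (`true` for decryption), the key and the block. -/
abbrev CipherQuery (κ : ℕ) : Type := Bool × Block κ × Block κ

/-- The answer to a cipher query. -/
def Cipher.answer {κ : ℕ} (E : Cipher κ) : CipherQuery κ → Block κ
  | (false, K, b) => E K b
  | (true, K, b) => (E K).symm b

/-- A reply of an oracle that may ask one cipher query before it answers. -/
inductive Reply (κ : ℕ) (σ : Type) : Type
  | done : Val × σ → Reply κ σ
  | ask : CipherQuery κ → (Block κ → Val × σ) → Reply κ σ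

/-- An oracle that needs access to a cipher. -/
abbrev Client (κ : ℕ) (σ : Type) : Type := σ → Val → PMF (Reply κ σ)

/-- Known values of a cipher: triples of a key, a block and its encryption. -/
abbrev Table (κ : ℕ) : Type := List (Block κ × Block κ × Block κ)

/-! ### Tables of known cipher values and the ciphers consistent with them -/

namespace Table

variable {κ : ℕ}

def lookup : Table κ → CipherQuery κ → Option (Block κ)
  | [], _ => none
  | e :: τ, c =>
    if e.1 = c.2.1 ∧ (if c.1 then e.2.2 else e.2.1) = c.2.2 then
      some (if c.1 then e.2.1 else e.2.2)
    else lookup τ c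

/-- The triple that records the answer `y` to a query. -/
def entry : CipherQuery κ → Block κ → Block κ × Block κ × Block κ
  | (false, K, b), y => (K, b, y)
  | (true, K, b), y => (K, y, b)

/-- A cipher that is sampled lazily, without care for collisions. -/
def sample (τ : Table κ) (c : CipherQuery κ) : PMF (Block κ × Table κ) :=
  match τ.lookup c with
  | some y => PMF.pure (y, τ)
  | none => (uniformBlock κ).map fun y => (y, entry c y :: τ)

def Consistent (τ : Table κ) (E : Cipher κ) : Prop := ∀ e ∈ τ, E e.1 e.2.1 = e.2.2

instance (τ : Table κ) : DecidablePred τ.Consistent := fun E => by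
  unfold Consistent; infer_instance

theorem Consistent.answer_eq {τ : Table κ} {E : Cipher κ} (h : τ.Consistent E)
    {c : CipherQuery κ} {y : Block κ} (hy : τ.lookup c = some y) : E.answer c = y := by
  induction τ with
  | nil => simp [lookup] at hy
  | cons e τ ih =>
    have he := h e (by simp)
    have ih := ih fun e he => h e (by simp [he])
    obtain ⟨_ | _, K, b⟩ := c
    · simp only [lookup, Bool.false_eq_true, if_false] at hy
      split_ifs at hy with h1
      · obtain ⟨rfl, rfl⟩ := h1
        simpa [Cipher.answer, he] using hy
      · exact ih hy
    · simp only [lookup, if_true] at hy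
      split_ifs at hy with h1
      · obtain ⟨rfl, rfl⟩ := h1
        simpa [Cipher.answer, ← he] using hy
      · exact ih hy

theorem consistent_entry_cons {τ : Table κ} {E : Cipher κ} {c : CipherQuery κ} {y : Block κ} :
    Consistent (entry c y :: τ) E ↔ E.answer c = y ∧ τ.Consistent E := by
  obtain ⟨_ | _, K, b⟩ := c
  · simp [Consistent, entry, Cipher.answer]
  · simp only [Consistent, entry, Cipher.answer, List.forall_mem_cons, Equiv.symm_apply_eq]
    rw [eq_comm]

/-- The blocks that are excluded as answers to a fresh query. -/
def used (τ : Table κ) (c : CipherQuery κ) : Finset (Block κ) :=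
  ((τ.filter fun e => e.1 = c.2.1).map fun e => if c.1 then e.2.1 else e.2.2).toFinset

theorem card_used_le (τ : Table κ) (c : CipherQuery κ) : (τ.used c).card ≤ τ.length := by
  refine (List.toFinset_card_le _).trans ?_
  rw [List.length_map]
  exact List.length_filter_le _ _

/-- Injectivity of the permutation for the queried key: an answer that occurs in a recorded entry
for this key belongs to the query of that entry, which the lookup would have found. -/
theorem Consistent.answer_notMem_used {τ : Table κ} {E : Cipher κ} (h : τ.Consistent E)
    {c : CipherQuery κ} (hc : τ.lookup c = none) : E.answer c ∉ τ.used c := by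
  induction τ with
  | nil => simp [used]
  | cons e τ ih =>
    have ih := ih (fun e he => h e (by simp [he]))
    have he := h e (by simp)
    obtain ⟨d, K, b⟩ := c
    obtain ⟨K', a, b'⟩ := e
    cases d
    · simp only [lookup, used, Cipher.answer] at *
      by_cases hK : K' = K
      · subst hK
        simp only [List.filter_cons, decide_true, if_true, List.map_cons, List.toFinset_cons,
          Finset.mem_insert, not_or]
        by_cases hab : a = b
        · simp [hab] at hc
        · simp only [true_and, Bool.false_eq_true, if_false, hab] at hc
          refine ⟨fun hE => hab ?_, ih hc⟩
          simp only [Bool.false_eq_true, if_false] at hE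
          exact (E K').injective (he.trans hE.symm)
      · simp only [hK, false_and, if_false] at hc
        simpa [List.filter_cons, hK] using ih hc
    · simp only [lookup, used, Cipher.answer] at *
      by_cases hK : K' = K
      · subst hK
        simp only [List.filter_cons, decide_true, if_true, List.map_cons, List.toFinset_cons,
          Finset.mem_insert, not_or]
        by_cases hab : b' = b
        · simp [hab] at hc
        · simp only [true_and, if_true, hab, if_false] at hc
          refine ⟨fun hE => hab ?_, ih hc⟩
          rw [← he, ← hE, Equiv.apply_symm_apply]
      · simp only [hK, false_and, if_false] at hc
        simpa [List.filter_cons, hK] using ih hc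

/-- The consistent ciphers with a prescribed answer. -/
def fiber (τ : Table κ) (c : CipherQuery κ) (y : Block κ) : Finset (Cipher κ) :=
  {E | τ.Consistent E ∧ E.answer c = y}

theorem mem_fiber {τ : Table κ} {c : CipherQuery κ} {y : Block κ} {E : Cipher κ} :
    E ∈ τ.fiber c y ↔ τ.Consistent E ∧ E.answer c = y := by
  simp [fiber]

theorem mem_used {τ : Table κ} {c : CipherQuery κ} {y : Block κ} :
    y ∈ τ.used c ↔ ∃ e ∈ τ, e.1 = c.2.1 ∧ (if c.1 then e.2.1 else e.2.2) = y := by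
  simp [used, and_assoc]

/-- Composing the permutation for the queried key with the transposition of `y` and `y'` maps one
fiber injectively into the other. For encryption the transposition acts on the outputs, for
decryption on the inputs. Recorded entries survive because neither block is used on that side under
this key. -/
theorem card_fiber_le {τ : Table κ} {c : CipherQuery κ} {y y' : Block κ} (hy : y ∉ τ.used c)
    (hy' : y' ∉ τ.used c) : (τ.fiber c y).card ≤ (τ.fiber c y').card := by
  obtain ⟨d, K, b⟩ := c
  simp only [mem_used, not_exists, not_and] at hy hy'
  cases d
  · refine Finset.card_le_card_of_injOn
      (fun E => Function.update E K ((E K).trans (Equiv.swap y y'))) ?_ ?_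
    · intro E hE
      simp only [Finset.mem_coe, mem_fiber, Cipher.answer] at hE ⊢
      refine ⟨fun e he => ?_, ?_⟩
      · by_cases hK : e.1 = K
        · have h1 := hy e he hK
          have h2 := hy' e he hK
          simp only [Bool.false_eq_true, if_false] at h1 h2
          have h3 := hE.1 e he
          rw [hK] at h3 ⊢
          rw [Function.update_self, Equiv.trans_apply, h3, Equiv.swap_apply_of_ne_of_ne h1 h2]
        · rw [Function.update_of_ne hK]; exact hE.1 e he
      · rw [Function.update_self, Equiv.trans_apply, hE.2, Equiv.swap_apply_left]
    · intro E _ E' _ h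
      have hi : Function.Injective fun p : Equiv.Perm (Block κ) => p.trans (Equiv.swap y y') :=
        fun p q hpq => by
          ext1 z
          exact (Equiv.swap y y').injective (by simpa using congrArg (fun p => p z) hpq)
      funext K'
      have := congrFun h K'
      by_cases hK : K' = K
      · subst hK; simp only [Function.update_self] at this; exact hi this
      · simpa [Function.update_of_ne hK] using this
  · refine Finset.card_le_card_of_injOn
      (fun E => Function.update E K ((Equiv.swap y y').trans (E K))) ?_ ?_
    · intro E hE
      simp only [Finset.mem_coe, mem_fiber, Cipher.answer] at hE ⊢
      refine ⟨fun e he => ?_, ?_⟩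
      · by_cases hK : e.1 = K
        · have h1 := hy e he hK
          have h2 := hy' e he hK
          simp only [if_true] at h1 h2
          have h3 := hE.1 e he
          rw [hK] at h3 ⊢
          rw [Function.update_self, Equiv.trans_apply, Equiv.swap_apply_of_ne_of_ne h1 h2, h3]
        · rw [Function.update_of_ne hK]; exact hE.1 e he
      · rw [Function.update_self, Equiv.symm_trans_apply, hE.2]
        simp
    · intro E _ E' _ h
      have hi : Function.Injective fun p : Equiv.Perm (Block κ) => (Equiv.swap y y').trans p :=
        fun p q hpq => by
          ext1 z
          simpa using congrArg (fun p => p ((Equiv.swap y y') z)) hpq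
      funext K'
      have := congrFun h K'
      by_cases hK : K' = K
      · subst hK; simp only [Function.update_self] at this; exact hi this
      · simpa [Function.update_of_ne hK] using this

end Table

/-- A count that vanishes on at most `t` of `N` points and is constant elsewhere is almost
uniform. -/
theorem sum_mul_le_of_const_off {ι : Type} [Fintype ι] [DecidableEq ι] [Nonempty ι]
    (cnt : ι → ℕ) (U : Finset ι) (t : ℕ) (hU : U.card ≤ t) (h0 : ∀ y ∈ U, cnt y = 0)
    (hc : ∀ y ∉ U, ∀ y' ∉ U, cnt y = cnt y') (h : ι → ℝ≥0∞) (h1 : ∀ y, h y ≤ 1) :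
    ∑ y, (cnt y : ℝ≥0∞) * h y ≤
      (∑ y, (cnt y : ℝ≥0∞)) * ((PMF.uniformOfFintype ι).ev h + t / Fintype.card ι) := by
  by_cases hne : ∃ y, y ∉ U
  swap
  · push Not at hne
    simp [h0 _ (hne _)]
  obtain ⟨y₀, hy₀⟩ := hne
  set M := cnt y₀
  have key : ∀ g : ι → ℝ≥0∞, ∑ y, (cnt y : ℝ≥0∞) * g y = M * ∑ y ∈ Uᶜ, g y := by
    intro g
    rw [← Finset.sum_add_sum_compl U, Finset.mul_sum, Finset.sum_eq_zero, zero_add]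
    · exact Finset.sum_congr rfl fun y hy => by
        rw [hc y (by simpa using hy) y₀ hy₀]
    · intro y hy; simp [h0 y hy]
  have htot := key fun _ => 1
  simp only [mul_one, Finset.sum_const, nsmul_eq_mul] at htot
  rw [key, htot, PMF.ev_uniformOfFintype, mul_assoc]
  gcongr _ * ?_
  set N : ℝ≥0∞ := ((Fintype.card ι : ℕ) : ℝ≥0∞)
  have hN0 : N ≠ 0 := by simp [N]
  have hNt : N ≠ ⊤ := by simp [N]
  set u : ℝ≥0∞ := ((Uᶜ.card : ℕ) : ℝ≥0∞)
  have hNu : N ≤ u + t := by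
    have : Fintype.card ι ≤ Uᶜ.card + t := by rw [Finset.card_compl]; omega
    simp only [N, u]; exact_mod_cast this
  have hle : ∑ y ∈ Uᶜ, h y ≤ u := by
    calc ∑ y ∈ Uᶜ, h y ≤ ∑ y ∈ Uᶜ, 1 := Finset.sum_le_sum fun y _ => h1 y
      _ = u := by simp [u]
  have hsub : ∑ y ∈ Uᶜ, h y ≤ ∑ y, h y := Finset.sum_le_sum_of_subset (Finset.subset_univ _)
  -- With `N ≤ u + t`, the sum over the complement is multiplied by `N`: the part with `u` is
  -- enlarged to a sum over all points, and in the part with `t` the sum is bounded by the number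
  -- `u` of its terms.
  calc ∑ y ∈ Uᶜ, h y = N⁻¹ * (N * ∑ y ∈ Uᶜ, h y) := by
        rw [← mul_assoc, ENNReal.inv_mul_cancel hN0 hNt, one_mul]
    _ ≤ N⁻¹ * ((u + t) * ∑ y ∈ Uᶜ, h y) := by gcongr
    _ ≤ N⁻¹ * (u * ∑ y, h y + t * u) := by rw [add_mul]; gcongr
    _ = u * (N⁻¹ * ∑ y, h y + t / N) := by rw [div_eq_mul_inv]; ring

/-- The number of blocks. -/
def blockCount (κ : ℕ) : ℝ≥0∞ := 2 ^ κ

theorem card_block (κ : ℕ) : ((Fintype.card (Block κ) : ℕ) : ℝ≥0∞) = blockCount κ := by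
  simp [blockCount]

/-! ### Replacing the ideal cipher by a lazily sampled one -/

variable {κ : ℕ} {σ : Type}

/-- The answer to a reply, by a cipher. -/
def Reply.withCipher (E : Cipher κ) : Reply κ σ → Val × σ
  | .done r => r
  | .ask c k => k (E.answer c)

/-- The answer to a reply, by a lazily sampled cipher. -/
def Reply.withTable (τ : Table κ) : Reply κ σ → PMF (Val × (σ × Table κ))
  | .done r => PMF.pure (r.1, (r.2, τ))
  | .ask c k => (τ.sample c).map fun y => ((k y.1).1, ((k y.1).2, y.2))

def Client.withCipher (G : Client κ σ) (E : Cipher κ) : Oracle σ :=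
  fun s q => (G s q).map (Reply.withCipher E)

def Client.withTable (G : Client κ σ) : Oracle (σ × Table κ) :=
  fun s q => (G s.1 q).bind (Reply.withTable s.2)

/-- The loss when a cipher is sampled lazily for `T` queries, from a table of length `t` on. -/
def lazyLoss (κ t T : ℕ) : ℝ≥0∞ := (T * (t + T) : ℕ) / blockCount κ

/-- The recursion behind the total loss: a query on a table of length `t` costs at most `t / 2^κ`
and leaves a table with one more entry for the remaining `T` steps. -/
theorem lazyLoss_succ_le (κ t T : ℕ) :
    t / blockCount κ + lazyLoss κ (t + 1) T ≤ lazyLoss κ t (T + 1) := by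
  unfold lazyLoss
  rw [← ENNReal.add_div, ← Nat.cast_add]
  gcongr
  nlinarith

theorem lazyLoss_mono (κ : ℕ) {t t' T T' : ℕ} (ht : t ≤ t') (hT : T ≤ T') :
    lazyLoss κ t T ≤ lazyLoss κ t' T' := by
  unfold lazyLoss
  gcongr

/-- The sum over all ciphers consistent with the table replaces conditioning on the answers seen so
far, so no conditional distribution is needed. A fresh query splits the consistent ciphers by their
answers. The classes of used answers are empty and all others have equal size, so the answer is
uniform up to an error proportional to the length of the table. -/
theorem sum_cipher_steps_le (G : Client κ σ) (f : Config × σ → ℝ≥0∞) (hf : ∀ z, f z ≤ 1) (T : ℕ)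
    (c : Config) (s : σ) (τ : Table κ) :
    ∑ E : Cipher κ with τ.Consistent E, (steps (G.withCipher E) T (c, s)).ev f ≤
      (Finset.card {E : Cipher κ | τ.Consistent E} : ℝ≥0∞) *
        ((steps G.withTable T (c, (s, τ))).ev (fun z => f (z.1, z.2.1)) +
          lazyLoss κ τ.length T) := by
  induction T generalizing c s τ with
  | zero => simp only [ev_steps_zero, Finset.sum_const, nsmul_eq_mul]; gcongr; exact le_self_add
  | succ T ih =>
    simp only [ev_steps_succ]
    have hmono : lazyLoss κ τ.length T ≤ lazyLoss κ τ.length (T + 1) :=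
      lazyLoss_mono κ le_rfl (Nat.le_succ T)
    cases act c with
    | internal p =>
      simp only [Act.step, PMF.ev_map]
      rw [← PMF.ev_finset_sum, ← PMF.ev_add_const]
      refine (p.ev_mono fun a => ih a s τ).trans ?_
      unfold PMF.ev
      simp only [mul_left_comm _ (Finset.card _ : ℝ≥0∞)]
      rw [ENNReal.tsum_mul_left]
      gcongr
    | query q k =>
      simp only [Act.step, PMF.ev_map, Client.withCipher, Client.withTable, PMF.ev_bind]
      rw [← PMF.ev_finset_sum, ← PMF.ev_add_const]
      -- The number of consistent ciphers is moved inside the expectation over replies, so that the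
      -- inequality can be shown for each reply separately.
      have : ∀ g : Reply κ σ → ℝ≥0∞, (Finset.card {E : Cipher κ | τ.Consistent E} : ℝ≥0∞) *
          (G s q).ev g = (G s q).ev fun r =>
            (Finset.card {E : Cipher κ | τ.Consistent E} : ℝ≥0∞) * g r := by
        intro g
        unfold PMF.ev
        simp only [mul_left_comm _ (Finset.card _ : ℝ≥0∞)]
        rw [ENNReal.tsum_mul_left]
      rw [this]
      refine PMF.ev_mono _ fun r => ?_
      cases r with
      | done r =>
        simp only [Reply.withCipher, Reply.withTable, PMF.ev_pure]
        refine (ih _ _ _).trans ?_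
        gcongr
      | ask c' k' =>
        simp only [Reply.withCipher, Reply.withTable, PMF.ev_map]
        unfold Table.sample
        cases hl : τ.lookup c' with
        | some y =>
          -- All consistent ciphers give the recorded answer, hence no loss arises here.
          rw [Finset.sum_congr rfl fun E hE =>
            by rw [(Finset.mem_filter.1 hE).2.answer_eq hl]]
          simp only [PMF.ev_pure]
          refine (ih _ _ _).trans ?_
          gcongr
        | none =>
          simp only [PMF.ev_map]
          set h : Block κ → ℝ≥0∞ := fun y =>
            (steps G.withTable T (k (k' y).1, (k' y).2, Table.entry c' y :: τ)).ev
              fun z => f (z.1, z.2.1)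
          have hfib : ∀ y, Finset.univ.filter (Table.Consistent (Table.entry c' y :: τ)) =
              τ.fiber c' y := by
            intro y; ext E
            simp [Table.mem_fiber, Table.consistent_entry_cons, and_comm]
          have hcard : ∑ y, ((τ.fiber c' y).card : ℝ≥0∞) =
              (Finset.card {E : Cipher κ | τ.Consistent E} : ℝ≥0∞) := by
            rw [← Nat.cast_sum, Finset.card_eq_sum_card_fiberwise (f := fun E => E.answer c')
              (t := Finset.univ) (by simp)]
            simp only [Table.fiber, Finset.filter_filter]
          -- Each class is the set of ciphers consistent with the table extended by the new entry,
          -- so the induction hypothesis applies to it. The sizes of the classes then serve as the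
          -- almost constant weights of `sum_mul_le_of_const_off`.
          calc _ = ∑ y, ∑ E ∈ τ.fiber c' y,
                (steps (G.withCipher E) T (k (k' y).1, (k' y).2)).ev f := by
                rw [← Finset.sum_fiberwise (g := fun E : Cipher κ => E.answer c')]
                refine Finset.sum_congr rfl fun y _ => ?_
                simp only [Table.fiber, Finset.filter_filter]
                refine Finset.sum_congr rfl fun E hE => ?_
                rw [(Finset.mem_filter.1 hE).2.2]
            _ ≤ ∑ y, ((τ.fiber c' y).card : ℝ≥0∞) * (h y + lazyLoss κ (τ.length + 1) T) := by
                refine Finset.sum_le_sum fun y _ => ?_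
                have := ih (k (k' y).1) (k' y).2 (Table.entry c' y :: τ)
                rw [hfib] at this
                exact this
            _ = ∑ y, ((τ.fiber c' y).card : ℝ≥0∞) * h y +
                (Finset.card {E : Cipher κ | τ.Consistent E} : ℝ≥0∞) *
                  lazyLoss κ (τ.length + 1) T := by
                simp only [mul_add, Finset.sum_add_distrib]
                rw [← Finset.sum_mul, hcard]
            _ ≤ (Finset.card {E : Cipher κ | τ.Consistent E} : ℝ≥0∞) *
                  ((uniformBlock κ).ev h + τ.length / blockCount κ) +
                (Finset.card {E : Cipher κ | τ.Consistent E} : ℝ≥0∞) *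
                  lazyLoss κ (τ.length + 1) T := by
                gcongr
                rw [← hcard, ← card_block]
                refine sum_mul_le_of_const_off _ (τ.used c') _ (τ.card_used_le c') ?_ ?_ _ ?_
                · intro y hy
                  rw [Finset.card_eq_zero, Finset.eq_empty_iff_forall_notMem]
                  intro E hE
                  rw [Table.mem_fiber] at hE
                  exact hE.1.answer_notMem_used hl (hE.2 ▸ hy)
                · intro y hy y' hy'
                  exact le_antisymm (Table.card_fiber_le hy hy') (Table.card_fiber_le hy' hy)
                · intro y
                  exact PMF.ev_le_of_le _ fun z => hf _
            _ ≤ _ := by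
                rw [← mul_add, add_assoc]
                gcongr
                exact lazyLoss_succ_le _ _ _

/-- The ideal cipher may be replaced by a lazily sampled one. -/
theorem ev_idealCipher_steps_le (G : Client κ σ) (f : Config × σ → ℝ≥0∞) (hf : ∀ z, f z ≤ 1)
    (T : ℕ) (c : Config) (s : σ) :
    ((idealCipher κ).ev fun E => (steps (G.withCipher E) T (c, s)).ev f) ≤
      (steps G.withTable T (c, (s, []))).ev (fun z => f (z.1, z.2.1)) + lazyLoss κ 0 T := by
  have h := sum_cipher_steps_le G f hf T c s []
  have hu : Finset.univ.filter (Table.Consistent (κ := κ) []) = Finset.univ :=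
    Finset.filter_true_of_mem fun E _ => by simp [Table.Consistent]
  rw [hu, Finset.card_univ] at h
  rw [idealCipher, PMF.ev_uniformOfFintype]
  calc _ ≤ (Fintype.card (Cipher κ) : ℝ≥0∞)⁻¹ * ((Fintype.card (Cipher κ) : ℝ≥0∞) * _) := by
        gcongr
    _ = _ := by
        rw [← mul_assoc, ENNReal.inv_mul_cancel (by simp) (by simp), one_mul]
        rfl

end

noncomputable section

open scoped ENNReal

/-! ## Exclusive or of blocks -/

namespace Block

variable {κ : ℕ}

def zero (κ : ℕ) : Block κ := fun _ => false

theorem xor_comm (a b : Block κ) : a.xor b = b.xor a := by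
  funext i; exact Bool.xor_comm _ _

theorem xor_assoc (a b c : Block κ) : (a.xor b).xor c = a.xor (b.xor c) := by
  funext i; exact Bool.xor_assoc _ _ _

@[simp] theorem xor_xor_cancel (a b : Block κ) : a.xor (a.xor b) = b := by
  funext i; simp [xor]

@[simp] theorem zero_xor (a : Block κ) : (zero κ).xor a = a := by
  funext i; simp [xor, zero]

theorem xor_left_comm (a b c : Block κ) : a.xor (b.xor c) = b.xor (a.xor c) := by
  rw [← xor_assoc, xor_comm a b, xor_assoc]

/-- Exclusive or with a fixed block. -/
def xorEquiv (a : Block κ) : Block κ ≃ Block κ where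
  toFun := a.xor
  invFun := a.xor
  left_inv := xor_xor_cancel a
  right_inv := xor_xor_cancel a

/-- The exclusive or of a list of blocks. -/
def xorList (bs : List (Block κ)) : Block κ := bs.foldr xor (zero κ)

@[simp] theorem xorList_nil : xorList ([] : List (Block κ)) = zero κ := rfl

@[simp] theorem xorList_cons (b : Block κ) (bs : List (Block κ)) :
    xorList (b :: bs) = b.xor (xorList bs) := rfl

end Block

/-! ## Points of the pseudorandom function -/

/-- The encoding of an attribute and a position that is counted from `0`. -/
def tag (a : Attr) (i : ℕ) : List Bool := a ++ false :: List.replicate (i + 1) true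

theorem tagged_eq_tag {n : ℕ} (a : Attr) (l : Fin n) : tagged a l = tag a l := rfl

/-- Read from the end, a tag starts with the position in unary, and the separator `false` terminates
it. Hence the attribute may be an arbitrary bit string, including one that ends in `true`. -/
theorem tag_injective {a b : Attr} {i j : ℕ} (h : tag a i = tag b j) : a = b ∧ i = j := by
  have h' := congrArg List.reverse h
  simp only [tag, List.reverse_append, List.reverse_cons, List.reverse_replicate] at h'
  have key : ∀ (i j : ℕ) (u w : List Bool), List.replicate i true ++ [false] ++ u =
      List.replicate j true ++ [false] ++ w → u = w ∧ i = j := by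
    intro i
    induction i with
    | zero => intro j u w h; cases j <;> simp_all [List.replicate_succ]
    | succ i ih =>
      intro j u w h
      cases j with
      | zero => simp [List.replicate_succ] at h
      | succ j =>
        simp only [List.replicate_succ, List.cons_append, List.cons.injEq, true_and] at h
        obtain ⟨h1, h2⟩ := ih j u w h
        exact ⟨h1, by rw [h2]⟩
  obtain ⟨h1, h2⟩ := key _ _ _ _ h'
  exact ⟨List.reverse_injective h1, by omega⟩

theorem tagged_injective {n : ℕ} {a b : Attr} {l l' : Fin n} (h : tagged a l = tagged b l') :
    a = b ∧ l = l' := by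
  obtain ⟨h1, h2⟩ := tag_injective h
  exact ⟨h1, Fin.ext h2⟩

/-- The points that belong to a ciphertext. -/
def ctPoints {n : ℕ} (x : AttrVec n) : List (List Bool) := List.ofFn fun l => tagged (x l) l

/-- The points that belong to a trapdoor. -/
def tdPoints {n : ℕ} (v : PredVec n) : List (List Bool) :=
  (List.finRange n).filterMap fun l => (v l).map fun a => tagged a l

theorem mem_tdPoints {n : ℕ} {v : PredVec n} {p : List Bool} :
    p ∈ tdPoints v ↔ ∃ l a, v l = some a ∧ tagged a l = p := by
  simp [tdPoints]

theorem nodup_tdPoints {n : ℕ} (v : PredVec n) : (tdPoints v).Nodup := by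
  refine List.Nodup.filterMap ?_ (List.nodup_finRange n)
  intro l l' p h h'
  simp only [Option.mem_def, Option.map_eq_some_iff] at h h'
  obtain ⟨a, _, rfl⟩ := h
  obtain ⟨b, _, h⟩ := h'
  exact (tagged_injective h).2.symm

/-- The mask of a trapdoor becomes an exclusive or over a list of points without repetition. This is
the form in which function values are queried, drawn lazily and shifted. -/
theorem xorList_tdPoints {κ n : ℕ} (v : PredVec n) (f : List Bool → Block κ) :
    Block.xorList ((tdPoints v).map f) =
      Block.xorOver (nonWild v) fun l => f (tagged ((v l).getD []) l) := by
  unfold tdPoints Block.xorOver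
  generalize List.finRange n = ls
  induction ls with
  | nil => rfl
  | cons l ls ih =>
    cases hv : v l with
    | none => simpa [List.filterMap_cons, hv, List.filter_cons, nonWild] using ih
    | some a => simpa [List.filterMap_cons, hv, List.filter_cons, nonWild] using congrArg _ ih

/-- Stateful access to a function on bit strings. -/
abbrev PointOracle (κ : ℕ) (σ : Type) : Type := σ → List Bool → PMF (Block κ × σ)

variable {κ : ℕ} {σ : Type}

/-- Queries at all points of a list. -/
def PointOracle.all (g : PointOracle κ σ) : List (List Bool) → σ → PMF (List (Block κ) × σ)
  | [], o => PMF.pure ([], o)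
  | p :: ps, o => (g o p).bind fun r => (PointOracle.all g ps r.2).map fun r' => (r.1 :: r'.1, r'.2)

/-! ## The games with a lazily sampled cipher -/

/-- The kinds of queries in the experiments. -/
inductive GameQuery : Type
  | cipher : Val → GameQuery
  | challenge : Val → GameQuery
  | trapdoor : Val → Val → GameQuery
  | other : GameQuery

def Val.parse : Val → GameQuery
  | .cons .nil q => .cipher q
  | .cons (.cons .nil _) x => .challenge x
  | .cons (.cons (.cons _ _) _) (.cons v m) => .trapdoor v m
  | _ => .other

/-- The cipher query that a tree encodes. -/
def cipherQueryOfVal (κ : ℕ) (q : Val) : CipherQuery κ :=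
  (decide (q.hd ≠ Val.nil), Block.ofVal κ q.tl.hd, Block.ofVal κ q.tl.tl)

theorem cipherAnswer_eq (E : Cipher κ) (q : Val) :
    cipherAnswer E q = (E.answer (cipherQueryOfVal κ q)).toVal := by
  unfold cipherAnswer cipherQueryOfVal
  by_cases h : q.hd = Val.nil <;> simp [h, Cipher.answer]

/-- The states of the real game. -/
abbrev RealState (σ : Type) : Type := Option ((n : ℕ) × AttrVec n) × σ

/-- The real game, over an arbitrary function oracle. -/
def realReply (g : PointOracle κ σ) : RealState σ → GameQuery → PMF (Reply κ (RealState σ))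
  | st, .cipher q => PMF.pure (.ask (cipherQueryOfVal κ q) fun y => (y.toVal, st))
  | (none, o), .challenge x =>
      (g.all (ctPoints (attrVecOfVal x)) o).map fun r =>
        .done (Val.ofList (r.1.map Block.toVal), (some ⟨_, attrVecOfVal x⟩, r.2))
  | (some ⟨n, x⟩, o), .trapdoor v m =>
      (g.all (tdPoints (predVecOfVal n v)) o).bind fun r =>
        (uniformBlock κ).map fun K =>
          .ask (false, K, Block.ofVal κ m) fun y =>
            (Trapdoor.toVal ⟨(Block.xorList r.1).xor K, y, nonWild (predVecOfVal n v)⟩,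
              (some ⟨n, x⟩, r.2))
  | st, _ => PMF.pure (.done (Val.nil, st))

def realClient (g : PointOracle κ σ) : Client κ (RealState σ) := fun st q => realReply g st q.parse

/-- The states of the simulated game. -/
abbrev SimState (κ : ℕ) : Type := Option ((n : ℕ) × AttrVec n × (Fin n → Block κ))

/-- The simulated game. -/
def simReply : SimState κ → GameQuery → PMF (Reply κ (SimState κ))
  | st, .cipher q => PMF.pure (.ask (cipherQueryOfVal κ q) fun y => (y.toVal, st))
  | none, .challenge x =>
      (PMF.uniformOfFintype (Fin (vecLength x) → Block κ)).map fun c =>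
        .done (ciphertextToVal c, some ⟨_, attrVecOfVal x, c⟩)
  | some ⟨n, x, c⟩, .trapdoor v m =>
      if Matches (predVecOfVal n v) x then
        (uniformBlock κ).map fun d =>
          .ask (false, (Block.xorOver (nonWild (predVecOfVal n v)) c).xor d, Block.ofVal κ m) fun y =>
            (Trapdoor.toVal ⟨d, y, nonWild (predVecOfVal n v)⟩, some ⟨n, x, c⟩)
      else
        (uniformBlock κ).bind fun d => (uniformBlock κ).map fun y =>
          .done (Trapdoor.toVal ⟨d, y, nonWild (predVecOfVal n v)⟩, some ⟨n, x, c⟩)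
  | st, _ => PMF.pure (.done (Val.nil, st))

def simClient : Client κ (SimState κ) := fun st q => simReply st q.parse

/-! ## Lazily sampled random functions -/

/-- Partial functions: the values of a random function that are drawn so far. -/
abbrev FunTable (κ : ℕ) : Type := List Bool → Option (Block κ)

/-- A lazily sampled random function. -/
def lazyFun : PointOracle κ (FunTable κ) := fun ρ p =>
  match ρ p with
  | some y => PMF.pure (y, ρ)
  | none => (uniformBlock κ).map fun y => (y, Function.update ρ p (some y))

namespace FunTable

/-- The values at further points are drawn. -/
def fill (ρ : FunTable κ) (ps : List (List Bool)) : PMF (FunTable κ) :=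
  (lazyFun.all ps ρ).map Prod.snd

@[simp] theorem fill_nil (ρ : FunTable κ) : ρ.fill [] = PMF.pure ρ := by
  simp [fill, PointOracle.all, PMF.pure_map]

theorem fill_cons (ρ : FunTable κ) (p : List Bool) (ps : List (List Bool)) :
    ρ.fill (p :: ps) = (lazyFun ρ p).bind fun r => fill r.2 ps := by
  simp [fill, PointOracle.all, PMF.map_bind, PMF.map_comp, Function.comp_def]

theorem fill_append (ρ : FunTable κ) (ps qs : List (List Bool)) :
    ρ.fill (ps ++ qs) = (ρ.fill ps).bind fun ρ' => ρ'.fill qs := by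
  induction ps generalizing ρ with
  | nil => simp
  | cons p ps ih => simp only [List.cons_append, fill_cons, ih, PMF.bind_bind]

theorem mem_support_all {ρ : FunTable κ} {ps : List (List Bool)} {r : List (Block κ) × FunTable κ}
    (h : r ∈ (lazyFun.all ps ρ).support) :
    (∀ p y, ρ p = some y → r.2 p = some y) ∧ ps.map r.2 = r.1.map some := by
  induction ps generalizing ρ r with
  | nil =>
    simp only [PointOracle.all, PMF.support_pure, Set.mem_singleton_iff] at h
    subst h; simp
  | cons p ps ih =>
    simp only [PointOracle.all, PMF.mem_support_bind_iff, PMF.mem_support_map_iff] at h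
    obtain ⟨r₁, h1, r₂, h2, rfl⟩ := h
    obtain ⟨h3, h4⟩ := ih h2
    have h5 : (∀ q y, ρ q = some y → r₁.2 q = some y) ∧ r₁.2 p = some r₁.1 := by
      unfold lazyFun at h1
      split at h1
      · next y hy =>
        simp only [PMF.support_pure, Set.mem_singleton_iff] at h1
        subst h1; exact ⟨fun _ _ h => h, hy⟩
      · next hy =>
        simp only [PMF.mem_support_map_iff] at h1
        obtain ⟨y, _, rfl⟩ := h1
        refine ⟨fun q z hq => ?_, by simp⟩
        have : q ≠ p := by rintro rfl; simp [hy] at hq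
        simpa [Function.update_of_ne this] using hq
    refine ⟨fun q y hq => h3 _ _ (h5.1 _ _ hq), ?_⟩
    simp [h4, h3 _ _ h5.2]

theorem mem_support_fill {ρ ρ' : FunTable κ} {ps : List (List Bool)}
    (h : ρ' ∈ (ρ.fill ps).support) :
    (∀ p y, ρ p = some y → ρ' p = some y) ∧ ∀ p ∈ ps, (ρ' p).isSome := by
  simp only [fill, PMF.mem_support_map_iff] at h
  obtain ⟨r, hr, rfl⟩ := h
  obtain ⟨h1, h2⟩ := mem_support_all hr
  refine ⟨h1, fun p hp => ?_⟩
  have : r.2 p ∈ r.1.map some := h2 ▸ List.mem_map_of_mem hp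
  obtain ⟨y, _, hy⟩ := List.mem_map.1 this
  simp [← hy]

theorem all_of_known {ρ : FunTable κ} {ps : List (List Bool)} (h : ∀ p ∈ ps, (ρ p).isSome) :
    lazyFun.all ps ρ = PMF.pure (ps.map fun p => (ρ p).getD (Block.zero κ), ρ) := by
  induction ps with
  | nil => rfl
  | cons p ps ih =>
    obtain ⟨y, hy⟩ := Option.isSome_iff_exists.1 (h p (by simp))
    have : lazyFun ρ p = PMF.pure (y, ρ) := by simp [lazyFun, hy]
    simp [PointOracle.all, this, ih fun p hp => h p (by simp [hp]), PMF.pure_map, hy]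

/-- The exclusive or of the values at a list of points. -/
def xorAt (ρ : FunTable κ) (ps : List (List Bool)) : Block κ :=
  Block.xorList (ps.map fun p => (ρ p).getD (Block.zero κ))

theorem xorList_of_mem_support {ρ : FunTable κ} {ps : List (List Bool)}
    {r : List (Block κ) × FunTable κ} (h : r ∈ (lazyFun.all ps ρ).support) :
    Block.xorList r.1 = r.2.xorAt ps := by
  have := (mem_support_all h).2
  have h2 := congrArg (List.map fun o : Option (Block κ) => o.getD (Block.zero κ)) this
  simp only [List.map_map] at h2
  unfold xorAt
  rw [show (fun p => (r.2 p).getD (Block.zero κ)) = (fun o : Option (Block κ) => o.getD (Block.zero κ)) ∘ r.2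
    from rfl, h2]
  congr 1
  simp [Function.comp_def]

theorem xorAt_congr {ρ ρ' : FunTable κ} {ps : List (List Bool)} (h : ∀ p ∈ ps, ρ p = ρ' p) :
    ρ.xorAt ps = ρ'.xorAt ps := by
  unfold xorAt
  congr 1
  exact List.map_congr_left fun p hp => by rw [h p hp]

/-- The value at one point is changed. -/
def shift (p : List Bool) (δ : Block κ) (ρ : FunTable κ) : FunTable κ :=
  Function.update ρ p ((ρ p).map δ.xor)

theorem shift_self (p : List Bool) (δ : Block κ) (ρ : FunTable κ) :
    ρ.shift p δ p = (ρ p).map δ.xor := by simp [shift]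

theorem shift_of_ne {p q : List Bool} (h : q ≠ p) (δ : Block κ) (ρ : FunTable κ) :
    ρ.shift p δ q = ρ q := by simp [shift, h]

/-- The absence of repetitions is essential: a point that occurred twice would contribute `δ` twice,
and the two contributions would cancel. -/
theorem xorAt_shift {ρ : FunTable κ} {p : List Bool} {ps : List (List Bool)} (δ : Block κ)
    (hps : ps.Nodup) (hp : p ∈ ps) (hρ : (ρ p).isSome) :
    (ρ.shift p δ).xorAt ps = δ.xor (ρ.xorAt ps) := by
  induction ps with
  | nil => simp at hp
  | cons q ps ih =>
    rw [List.nodup_cons] at hps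
    by_cases hq : q = p
    · subst hq
      have : (ρ.shift q δ).xorAt ps = ρ.xorAt ps :=
        xorAt_congr fun p hp => shift_of_ne (ne_of_mem_of_not_mem hp hps.1) _ _
      obtain ⟨y, hy⟩ := Option.isSome_iff_exists.1 hρ
      unfold xorAt at this ⊢
      simp [this, shift_self, hy, Block.xor_assoc]
    · have := ih hps.2 (by simpa [Ne.symm hq] using hp)
      unfold xorAt at this ⊢
      simp [this, shift_of_ne hq, Block.xor_left_comm]

/-- Drawing further values never changes a value that is already known, nor does it depend on what
that value is, so shifting before or after makes no difference. -/
theorem fill_shift_of_known {ρ : FunTable κ} {p : List Bool} (δ : Block κ) (hp : (ρ p).isSome)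
    (ps : List (List Bool)) : (ρ.shift p δ).fill ps = (ρ.fill ps).map (shift p δ) := by
  induction ps generalizing ρ with
  | nil => simp [PMF.pure_map]
  | cons q ps ih =>
    rw [fill_cons, fill_cons, PMF.map_bind]
    cases hq : ρ q with
    | some y =>
      have h1 : lazyFun ρ q = PMF.pure (y, ρ) := by simp [lazyFun, hq]
      have h2 : ∃ y', lazyFun (ρ.shift p δ) q = PMF.pure (y', ρ.shift p δ) := by
        by_cases hqp : q = p
        · subst hqp; exact ⟨δ.xor y, by simp [lazyFun, shift_self, hq]⟩
        · exact ⟨y, by simp [lazyFun, shift_of_ne hqp, hq]⟩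
      obtain ⟨y', h2⟩ := h2
      simp [h1, h2, ih hp]
    | none =>
      have hqp : q ≠ p := by rintro rfl; simp [hq] at hp
      have h1 : lazyFun ρ q = (uniformBlock κ).map fun y => (y, Function.update ρ q (some y)) := by
        simp [lazyFun, hq]
      have h2 : lazyFun (ρ.shift p δ) q =
          (uniformBlock κ).map fun y => (y, Function.update (ρ.shift p δ) q (some y)) := by
        simp [lazyFun, shift_of_ne hqp, hq]
      rw [h1, h2, PMF.bind_map, PMF.bind_map]
      congr 1
      funext y
      simp only [Function.comp]
      rw [← ih (ρ := Function.update ρ q (some y)) (by simpa [Function.update_of_ne hqp.symm] using hp)]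
      congr 1
      unfold shift
      rw [Function.update_comm hqp.symm, Function.update_of_ne hqp.symm]

/-- The value at `p` is uniform when it is drawn, and adding `δ` permutes the blocks. Everything
drawn before leaves `p` undetermined, and everything drawn afterwards commutes with the shift by
`fill_shift_of_known`. -/
theorem map_shift_fill {ρ : FunTable κ} {p : List Bool} (δ : Block κ) (hp : ρ p = none)
    {ps : List (List Bool)} (hps : p ∈ ps) : (ρ.fill ps).map (shift p δ) = ρ.fill ps := by
  induction ps generalizing ρ with
  | nil => simp at hps
  | cons q ps ih =>
    rw [fill_cons, PMF.map_bind]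
    by_cases hqp : q = p
    · subst hqp
      have h1 : lazyFun ρ q = (uniformBlock κ).map fun y => (y, Function.update ρ q (some y)) := by
        simp [lazyFun, hp]
      rw [h1, PMF.bind_map, PMF.bind_map]
      refine PMF.ext_ev fun f => ?_
      simp only [PMF.ev_bind, Function.comp]
      rw [uniformBlock, ← PMF.ev_uniform_equiv (Block.xorEquiv δ)]
      congr 1
      funext y
      rw [← fill_shift_of_known δ (by simp)]
      simp [shift, Block.xorEquiv]
    · have hps' : p ∈ ps := by simpa [Ne.symm hqp] using hps
      cases hq : ρ q with
      | some y =>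
        have h1 : lazyFun ρ q = PMF.pure (y, ρ) := by simp [lazyFun, hq]
        simp [h1, ih hp hps']
      | none =>
        have h1 : lazyFun ρ q = (uniformBlock κ).map fun y => (y, Function.update ρ q (some y)) := by
          simp [lazyFun, hq]
        rw [h1, PMF.bind_map, PMF.bind_map]
        congr 1
        funext y
        exact ih (by simpa [Function.update_of_ne (Ne.symm hqp)] using hp) hps'

/-- The exclusive or of values that involve an undetermined one is uniform. -/
theorem ev_fill_xorAt_eq_le {ρ : FunTable κ} {p : List Bool} (hp : ρ p = none)
    {ps qs : List (List Bool)} (hps : p ∈ ps) (hqs : qs.Nodup) (hpq : p ∈ qs) (K : Block κ) :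
    ((ρ.fill ps).ev fun ρ' => if ρ'.xorAt qs = K then 1 else 0) ≤ 1 / blockCount κ := by
  rw [ENNReal.le_div_iff_mul_le (by simp [blockCount]) (by simp [blockCount]), ← card_block]
  -- The probability is averaged over all shifts `δ` of the value at `p`, none of which changes the
  -- distribution of the table. For a given table at most one `δ` produces `K`, so the sum of the
  -- `2^κ` equal probabilities is at most one.
  calc _ = ∑ δ : Block κ, (ρ.fill ps).ev fun ρ' => if ρ'.xorAt qs = K then 1 else 0 := by
        rw [Finset.sum_const, Finset.card_univ, nsmul_eq_mul, mul_comm]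
    _ = ∑ δ : Block κ, (ρ.fill ps).ev fun ρ' => if (ρ'.shift p δ).xorAt qs = K then 1 else 0 := by
        refine Finset.sum_congr rfl fun δ _ => ?_
        conv_lhs => rw [← map_shift_fill δ hp hps]
        rw [PMF.ev_map]
    _ = (ρ.fill ps).ev fun ρ' => ∑ δ : Block κ, if (ρ'.shift p δ).xorAt qs = K then 1 else 0 := by
        rw [PMF.ev_finset_sum]
    _ ≤ (ρ.fill ps).ev fun _ => 1 := by
        refine PMF.ev_mono_support _ fun ρ' hρ' => ?_
        have hsome := (mem_support_fill hρ').2 p hps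
        simp only [xorAt_shift _ hqs hpq hsome]
        rw [Finset.sum_boole]
        norm_cast
        rw [Finset.card_le_one]
        intro a ha b hb
        simp only [Finset.mem_filter, Finset.mem_univ, true_and] at ha hb
        have := ha.trans hb.symm
        rw [Block.xor_comm a, Block.xor_comm b] at this
        exact (Block.xorEquiv (ρ'.xorAt qs)).injective this
    _ = 1 := by simp

/-- Values at new points are independent and uniform. -/
theorem ev_all_ofFn {n : ℕ} (ρ : FunTable κ) (p : Fin n → List Bool) (hp : Function.Injective p)
    (hρ : ∀ l, ρ (p l) = none) :
    ∃ ρ' : (Fin n → Block κ) → FunTable κ,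
      (∀ c l, ρ' c (p l) = some (c l)) ∧ (∀ c q, (∀ l, q ≠ p l) → ρ' c q = ρ q) ∧
      ∀ f : List (Block κ) × FunTable κ → ℝ≥0∞, (lazyFun.all (List.ofFn p) ρ).ev f =
        (PMF.uniformOfFintype (Fin n → Block κ)).ev fun c => f (List.ofFn c, ρ' c) := by
  induction n generalizing ρ with
  | zero =>
    refine ⟨fun _ => ρ, fun c l => l.elim0, fun _ _ _ => rfl, fun f => ?_⟩
    simp [PointOracle.all]
  | succ n ih =>
    have hp' : Function.Injective fun l : Fin n => p l.succ :=
      hp.comp (Fin.succ_injective n)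
    have hρ' : ∀ (y : Block κ) (l : Fin n),
        Function.update ρ (p 0) (some y) (p l.succ) = none := fun y l => by
      rw [Function.update_of_ne (hp.ne (Fin.succ_ne_zero l)), hρ]
    choose ρ' h1 h2 h3 using fun y : Block κ =>
      ih (Function.update ρ (p 0) (some y)) (fun l => p l.succ) hp' (hρ' y)
    refine ⟨fun c => ρ' (c 0) (Fin.tail c), fun c l => ?_, fun c q hq => ?_, fun f => ?_⟩
    · refine Fin.cases ?_ (fun l => ?_) l
      · simp only
        rw [h2 _ _ _ fun l => hp.ne (Fin.succ_ne_zero l).symm, Function.update_self]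
      · exact h1 _ _ l
    · simp only
      rw [h2 _ _ _ fun l => hq l.succ, Function.update_of_ne (hq 0)]
    · rw [PMF.ev_uniform_fin_succ, List.ofFn_succ, PointOracle.all]
      have : lazyFun ρ (p 0) =
          (uniformBlock κ).map fun y => (y, Function.update ρ (p 0) (some y)) := by
        simp [lazyFun, hρ]
      rw [this]
      simp [h3, uniformBlock]

end FunTable

end

noncomputable section

open scoped ENNReal

/-! ## The real game over a random function and the simulated game -/

/-- A trapdoor whose cipher key is hidden: the first component, the points that mask the key, the
message and its encryption. -/
structure HiddenEntry (κ : ℕ) where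
  d₀ : Block κ
  points : List (List Bool)
  m : Block κ
  d₁ : Block κ

/-- The history of the cipher: visible entries and hidden ones. -/
abbrev History (κ : ℕ) : Type := List ((Block κ × Block κ × Block κ) ⊕ HiddenEntry κ)

variable {κ : ℕ}

/-- The cipher key of a hidden entry. -/
def HiddenEntry.key (e : HiddenEntry κ) (ρ : FunTable κ) : Block κ := (ρ.xorAt e.points).xor e.d₀

/-! ### Histories of the cipher with hidden entries -/

namespace History

/-- The whole table of cipher values. -/
def realize (ρ : FunTable κ) (H : History κ) : Table κ :=
  H.map (Sum.elim id fun e => (e.key ρ, e.m, e.d₁))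

/-- The visible part of the table. -/
def visible (H : History κ) : Table κ := H.filterMap (Sum.elim some fun _ => none)

/-- The key `K` is the key of a hidden entry. -/
def hit (H : History κ) (ρ : FunTable κ) (K : Block κ) : Prop :=
  ∃ e, Sum.inr e ∈ H ∧ e.key ρ = K

/-- A hidden entry can answer only a query under its own key. Away from hidden keys the real table
and the table of the simulated game are therefore indistinguishable. -/
theorem lookup_realize {H : History κ} {ρ : FunTable κ} {c : CipherQuery κ}
    (h : ¬ H.hit ρ c.2.1) : (H.realize ρ).lookup c = H.visible.lookup c := by
  induction H with
  | nil => rfl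
  | cons e H ih =>
    have ih := ih fun ⟨e, he, hk⟩ => h ⟨e, by simp [he], hk⟩
    cases e with
    | inl e =>
      have h1 : realize ρ (Sum.inl e :: H) = e :: realize ρ H := rfl
      have h2 : visible (Sum.inl e :: H) = e :: visible H := rfl
      rw [h1, h2, Table.lookup, Table.lookup, ih]
    | inr e =>
      have h1 : realize ρ (Sum.inr e :: H) = (e.key ρ, e.m, e.d₁) :: realize ρ H := rfl
      have h2 : visible (Sum.inr e :: H) = visible H := rfl
      have : e.key ρ ≠ c.2.1 := fun hk => h ⟨e, by simp, hk⟩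
      rw [h1, h2, Table.lookup, if_neg fun h => this h.1, ih]

/-- The hidden entries are masked by undetermined values among those at the points `ps`. -/
def Valid (ρ : FunTable κ) (ps : List (List Bool)) (H : History κ) : Prop :=
  ∀ e, Sum.inr e ∈ H → e.points.Nodup ∧ (∃ p ∈ e.points, ρ p = none) ∧ ∀ p ∈ e.points, p ∈ ps

-- A union bound over the hidden entries. Each key is a known block added to an exclusive or that
-- involves an undetermined value, hence uniform. Dependence between the keys of different entries
-- is irrelevant for this bound.
open Classical in
theorem ev_hit_le {ρ : FunTable κ} {ps : List (List Bool)} {H : History κ} (h : H.Valid ρ ps)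
    (K : Block κ) :
    ((ρ.fill ps).ev fun ρ' => if H.hit ρ' K then 1 else 0) ≤ H.length / blockCount κ := by
  induction H with
  | nil => simp [hit]
  | cons e H ih =>
    have ih := ih fun e he => h e (by simp [he])
    rw [List.length_cons, Nat.cast_succ, ENNReal.add_div]
    cases e with
    | inl e =>
      refine le_trans ?_ (ih.trans le_self_add)
      refine PMF.ev_mono _ fun ρ' => le_of_eq ?_
      congr 1
      simp [hit]
    | inr e =>
      obtain ⟨h1, ⟨p, hp, hρ⟩, h3⟩ := h e (by simp)
      refine le_trans ?_ (add_le_add ih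
        (FunTable.ev_fill_xorAt_eq_le hρ (h3 p hp) h1 hp (e.d₀.xor K)))
      rw [← PMF.ev_add]
      refine PMF.ev_mono _ fun ρ' => ?_
      by_cases hh : hit (Sum.inr e :: H) ρ' K
      · obtain ⟨e', he', hk⟩ := hh
        rcases List.mem_cons.1 he' with he | he
        · obtain rfl := Sum.inr.inj he
          have : ρ'.xorAt e'.points = e'.d₀.xor K := by
            rw [← hk, HiddenEntry.key, Block.xor_comm _ e'.d₀, Block.xor_xor_cancel]
          simp only [this, if_true]
          refine le_trans ?_ le_add_self
          split_ifs <;> simp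
        · have : hit H ρ' K := ⟨e', he, hk⟩
          simp only [this, if_true]
          refine le_trans ?_ le_self_add
          split_ifs <;> simp
      · simp [hh]

/-- Sampling by the visible part of the history. -/
def sample (H : History κ) (c : CipherQuery κ) : PMF (Block κ × History κ) :=
  match H.visible.lookup c with
  | some y => PMF.pure (y, H)
  | none => (uniformBlock κ).map fun y => (y, Sum.inl (Table.entry c y) :: H)

theorem sample_visible (H : History κ) (c : CipherQuery κ) :
    H.visible.sample c = (H.sample c).map fun r => (r.1, r.2.visible) := by
  unfold sample Table.sample
  cases H.visible.lookup c with
  | some y => simp [PMF.pure_map]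
  | none => rw [PMF.map_comp]; rfl

theorem sample_realize {H : History κ} {ρ : FunTable κ} {c : CipherQuery κ}
    (h : ¬ H.hit ρ c.2.1) :
    (H.realize ρ).sample c = (H.sample c).map fun r => (r.1, r.2.realize ρ) := by
  unfold sample Table.sample
  rw [lookup_realize h]
  cases H.visible.lookup c with
  | some y => simp [PMF.pure_map]
  | none => rw [PMF.map_comp]; rfl

theorem mem_support_sample {H : History κ} {c : CipherQuery κ} {r : Block κ × History κ}
    (h : r ∈ (H.sample c).support) : r.2 = H ∨ ∃ e, r.2 = Sum.inl e :: H := by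
  unfold sample at h
  split at h
  · simp only [PMF.support_pure, Set.mem_singleton_iff] at h
    subst h; exact Or.inl rfl
  · simp only [PMF.mem_support_map_iff] at h
    obtain ⟨y, _, rfl⟩ := h
    exact Or.inr ⟨_, rfl⟩

/-- One cipher query in the two games. Unless it hits a hidden key, both games draw the same answer
and record the same visible entry, so the sampling of the answer can be interchanged with the
drawing of the undetermined values. A hit is charged with its probability, as `φ` is at most one;
`δ` is the loss of the continuation. -/
theorem ev_sample_le {ρ : FunTable κ} {ps : List (List Bool)} {H : History κ} (h : H.Valid ρ ps)
    (c : CipherQuery κ) (φ : FunTable κ → Block κ → Table κ → ℝ≥0∞) (ψ : Block κ → Table κ → ℝ≥0∞)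
    (hφ : ∀ ρ y τ, φ ρ y τ ≤ 1) (δ : ℝ≥0∞)
    (hφψ : ∀ y (H' : History κ), H'.Valid ρ ps → H'.length ≤ H.length + 1 →
      ((ρ.fill ps).ev fun ρ' => φ ρ' y (H'.realize ρ')) ≤ ψ y H'.visible + δ) :
    ((ρ.fill ps).ev fun ρ' => ((H.realize ρ').sample c).ev fun r => φ ρ' r.1 r.2) ≤
      (H.visible.sample c).ev (fun r => ψ r.1 r.2) + (H.length / blockCount κ + δ) := by
  classical
  calc _ ≤ (ρ.fill ps).ev fun ρ' => ((H.sample c).ev fun r => φ ρ' r.1 (r.2.realize ρ')) +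
        if H.hit ρ' c.2.1 then 1 else 0 := by
        refine PMF.ev_mono _ fun ρ' => ?_
        by_cases hh : H.hit ρ' c.2.1
        · rw [if_pos hh]
          exact (PMF.ev_le_of_le _ fun r => hφ _ _ _).trans le_add_self
        · rw [if_neg hh, add_zero, sample_realize hh, PMF.ev_map]
    _ ≤ ((H.sample c).ev fun r => ψ r.1 r.2.visible + δ) + H.length / blockCount κ := by
        rw [PMF.ev_add]
        refine add_le_add ?_ (ev_hit_le h _)
        rw [PMF.ev_comm]
        refine PMF.ev_mono_support _ fun r hr => ?_
        rcases mem_support_sample hr with hr | ⟨e, hr⟩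
        · exact hφψ _ _ (hr ▸ h) (by simp [hr])
        · refine hφψ _ _ ?_ (by simp [hr])
          rw [hr]
          exact fun e he => h e (by simpa using he)
    _ = _ := by
        rw [PMF.ev_add_const, sample_visible, PMF.ev_map, add_assoc, add_comm δ]

end History

theorem Table.lookup_eq_none {τ : Table κ} {c : CipherQuery κ} (h : c.2.1 ∉ τ.map Prod.fst) :
    τ.lookup c = none := by
  induction τ with
  | nil => rfl
  | cons e τ ih =>
    simp only [List.map_cons, List.mem_cons, not_or] at h
    rw [Table.lookup, if_neg fun h' => h.1 h'.1.symm, ih h.2]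

theorem ev_uniformBlock_xor (X : Block κ) (f : Block κ → ℝ≥0∞) :
    (uniformBlock κ).ev f = (uniformBlock κ).ev fun d => f (X.xor d) :=
  (PMF.ev_uniform_equiv (Block.xorEquiv X) f).symm

/-- A uniformly random block is in a given list with small probability. -/
theorem ev_uniformBlock_mem_le (l : List (Block κ)) :
    ((uniformBlock κ).ev fun K => if K ∈ l then 1 else 0) ≤ l.length / blockCount κ := by
  rw [uniformBlock, PMF.ev_uniformOfFintype, Finset.sum_boole, card_block, mul_comm,
    ← div_eq_mul_inv]
  gcongr
  refine le_trans (Finset.card_le_card (t := l.toFinset) fun K => by simp) (List.toFinset_card_le _)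

/-- The real and the simulated game after the challenge. -/
theorem ev_real_steps_le_sim {n : ℕ} (x : AttrVec n) (c : Fin n → Block κ) (ρ : FunTable κ)
    (hx : ∀ l, ρ (tagged (x l) l) = some (c l))
    (hnone : ∀ p, (∀ l, p ≠ tagged (x l) l) → ρ p = none)
    (f : Config → ℝ≥0∞) (hf : ∀ z, f z ≤ 1) (T : ℕ) (z : Config) (ps : List (List Bool))
    (H : History κ) (hH : H.Valid ρ ps) :
    ((ρ.fill ps).ev fun ρ' =>
      (steps (realClient lazyFun).withTable T (z, ((some ⟨n, x⟩, ρ'), H.realize ρ'))).ev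
        fun z => f z.1) ≤
      (steps simClient.withTable T (z, (some ⟨n, x, c⟩, H.visible))).ev (fun z => f z.1) +
        lazyLoss κ H.length T := by
  induction T generalizing z ps H with
  | zero => simp [ev_steps_zero]
  | succ T ih =>
    have hmono : lazyLoss κ H.length T ≤ lazyLoss κ H.length (T + 1) :=
      lazyLoss_mono κ le_rfl (Nat.le_succ T)
    simp only [ev_steps_succ]
    cases act z with
    | internal p =>
      simp only [Act.step, PMF.ev_map]
      rw [PMF.ev_comm, ← PMF.ev_add_const]
      exact p.ev_mono fun a => (ih a ps H hH).trans (by gcongr)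
    | query q k =>
      simp only [Act.step, PMF.ev_map, Client.withTable, PMF.ev_bind, realClient, simClient]
      -- This serves twice: for the cipher queries of the adversary, and for the encryption inside a
      -- trapdoor that matches, since both leave a visible entry.
      have hask : ∀ (cq : CipherQuery κ) (r : Block κ → Val),
          ((ρ.fill ps).ev fun ρ' => ((H.realize ρ').sample cq).ev fun y =>
            (steps (realClient lazyFun).withTable T (k (r y.1), ((some ⟨n, x⟩, ρ'), y.2))).ev
              fun z => f z.1) ≤
          ((H.visible.sample cq).ev fun y =>
            (steps simClient.withTable T (k (r y.1), (some ⟨n, x, c⟩, y.2))).ev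
              fun z => f z.1) + lazyLoss κ H.length (T + 1) := by
        intro cq r
        refine (History.ev_sample_le hH cq
          (fun ρ' y τ => (steps (realClient lazyFun).withTable T
            (k (r y), ((some ⟨n, x⟩, ρ'), τ))).ev fun z => f z.1)
          (fun y τ => (steps simClient.withTable T (k (r y), (some ⟨n, x, c⟩, τ))).ev
            fun z => f z.1)
          (fun _ _ _ => PMF.ev_le_of_le _ fun _ => hf _) (lazyLoss κ (H.length + 1) T)
          fun y H' hH' hlen => (ih _ ps H' hH').trans ?_).trans ?_
        · gcongr; exact lazyLoss_mono κ hlen le_rfl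
        · gcongr; exact lazyLoss_succ_le _ _ _
      have hother : ((ρ.fill ps).ev fun ρ' =>
            (steps (realClient lazyFun).withTable T
              (k Val.nil, ((some ⟨n, x⟩, ρ'), H.realize ρ'))).ev fun z => f z.1) ≤
          (steps simClient.withTable T (k Val.nil, (some ⟨n, x, c⟩, H.visible))).ev
            (fun z => f z.1) + lazyLoss κ H.length (T + 1) :=
        (ih _ ps H hH).trans (by gcongr)
      cases hq : q.parse with
      | cipher q' =>
        simp only [realReply, simReply, PMF.ev_pure, Reply.withTable, PMF.ev_map]
        exact hask _ _
      | challenge t =>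
        simpa only [realReply, simReply, PMF.ev_pure, Reply.withTable] using hother
      | other =>
        simpa only [realReply, simReply, PMF.ev_pure, Reply.withTable] using hother
      | trapdoor v' m' =>
        simp only [realReply, simReply]
        set v := predVecOfVal n v'
        set m := Block.ofVal κ m'
        by_cases hv : Matches v x
        · simp only [if_pos hv, PMF.ev_bind, PMF.ev_map, Reply.withTable]
          set X := Block.xorOver (nonWild v) c
          -- On a match all points of the trapdoor are points of the ciphertext. The mask is thus
          -- the fixed block `X`, and no new function value is drawn.
          have hval : ∀ p ∈ tdPoints v, ∃ l, p = tagged (x l) l ∧ v l = some (x l) := by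
            intro p hp
            obtain ⟨l, a, hl, rfl⟩ := mem_tdPoints.1 hp
            rcases hv l with h | h
            · rw [h] at hl; obtain rfl := Option.some.inj hl; exact ⟨l, rfl, h⟩
            · simp [h] at hl
          have hX : Block.xorList ((tdPoints v).map fun p => (ρ p).getD (Block.zero κ)) = X := by
            rw [xorList_tdPoints]
            unfold X Block.xorOver
            generalize hls : (List.finRange n).filter (fun l => l ∈ nonWild v) = ls
            have : ∀ l ∈ ls, v l ≠ none := by
              intro l hl
              rw [← hls] at hl
              simpa [nonWild] using hl
            clear hls
            induction ls with
            | nil => rfl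
            | cons l ls ih =>
              simp only [List.foldr_cons]
              rw [ih fun l hl => this l (by simp [hl])]
              have h1 := (hv l).resolve_right (this l (by simp))
              simp [h1, hx]
          have hall : ∀ ρ' ∈ (ρ.fill ps).support, lazyFun.all (tdPoints v) ρ' =
              PMF.pure ((tdPoints v).map fun p => (ρ p).getD (Block.zero κ), ρ') := by
            intro ρ' hρ'
            have hρ : ∀ p ∈ tdPoints v, ρ' p = ρ p := by
              intro p hp
              obtain ⟨l, rfl, _⟩ := hval p hp
              rw [hx, (FunTable.mem_support_fill hρ').1 _ _ (hx l)]
            rw [FunTable.all_of_known]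
            · congr 2
              exact List.map_congr_left fun p hp => by rw [hρ p hp]
            · intro p hp
              obtain ⟨l, rfl, _⟩ := hval p hp
              rw [hρ _ hp, hx]; rfl
          rw [PMF.ev_congr_support _ fun ρ' hρ' => by rw [hall ρ' hρ', PMF.ev_pure]]
          simp only [hX]
          -- The substitution `K = X ⊕ d` turns the real first component `X ⊕ K` into the uniform
          -- `d` of the simulated game.
          rw [PMF.ev_comm, ev_uniformBlock_xor X, ← PMF.ev_add_const]
          refine PMF.ev_mono _ fun d => ?_
          have := hask (false, X.xor d, m) fun y => Trapdoor.toVal ⟨d, y, nonWild v⟩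
          simpa using this
        · simp only [if_neg hv, PMF.ev_bind, PMF.ev_map, Reply.withTable, PMF.ev_pure]
          -- At a position where the attributes differ, injectivity of the encoding makes the point
          -- different from all points of the ciphertext.
          have hpt : ∃ p ∈ tdPoints v, ρ p = none := by
            simp only [Matches, not_forall, not_or] at hv
            obtain ⟨l, h1, h2⟩ := hv
            obtain ⟨a, ha⟩ := Option.ne_none_iff_exists'.1 h2
            refine ⟨tagged a l, mem_tdPoints.2 ⟨l, a, ha, rfl⟩, hnone _ fun l' h => ?_⟩
            obtain ⟨rfl, rfl⟩ := tagged_injective h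
            exact h1 ha
          set Φ : Block κ → FunTable κ → Block κ → Table κ → ℝ≥0∞ := fun d ρ' y τ =>
            (steps (realClient lazyFun).withTable T
              (k (Trapdoor.toVal ⟨d, y, nonWild v⟩), ((some ⟨n, x⟩, ρ'), τ))).ev fun z => f z.1
          have hΦ : ∀ d ρ' y τ, Φ d ρ' y τ ≤ 1 := fun _ _ _ _ => PMF.ev_le_of_le _ fun _ => hf _
          -- The real game records this trapdoor as a hidden entry. The simulated game records
          -- nothing, so the visible part of the history stays the same.
          set H' : Block κ → Block κ → History κ := fun d y =>
            Sum.inr ⟨d, tdPoints v, m, y⟩ :: H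
          have hH' : ∀ d y, (H' d y).Valid ρ (ps ++ tdPoints v) := by
            intro d y e he
            rcases List.mem_cons.1 he with h | h
            · obtain rfl := Sum.inr.inj h
              exact ⟨nodup_tdPoints v, hpt, fun p hp => by simp only at hp; simp [hp]⟩
            · obtain ⟨h1, h2, h3⟩ := hH e h
              exact ⟨h1, h2, fun p hp => by simp [h3 p hp]⟩
          calc _ ≤ (ρ.fill ps).ev fun ρ' => (lazyFun.all (tdPoints v) ρ').ev fun r =>
                ((uniformBlock κ).ev fun d => (uniformBlock κ).ev fun y =>
                  Φ d r.2 y ((H' d y).realize r.2)) + H.length / blockCount κ := by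
                refine PMF.ev_mono_support _ fun ρ' hρ' => PMF.ev_mono_support _ fun r hr => ?_
                -- Earlier hidden keys depend only on values at the points `ps`, which are already
                -- filled and are not changed by the new draws.
                have hreal : H.realize r.2 = H.realize ρ' := by
                  refine List.map_congr_left fun e he => ?_
                  cases e with
                  | inl e => rfl
                  | inr e =>
                    simp only [Sum.elim_inr, HiddenEntry.key]
                    rw [FunTable.xorAt_congr fun p hp => ?_]
                    have h1 := (FunTable.mem_support_fill hρ').2 p ((hH e he).2.2 p hp)
                    obtain ⟨y, hy⟩ := Option.isSome_iff_exists.1 h1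
                    rw [hy, (FunTable.mem_support_all hr).1 _ _ hy]
                rw [ev_uniformBlock_xor (Block.xorList r.1)
                  (fun d => (uniformBlock κ).ev fun y => Φ d r.2 y ((H' d y).realize r.2))]
                have hmem := ev_uniformBlock_mem_le ((H.realize ρ').map Prod.fst)
                have hlen : ((H.realize ρ').map Prod.fst).length = H.length := by
                  simp [History.realize]
                rw [hlen] at hmem
                refine le_trans ?_ (add_le_add le_rfl hmem)
                rw [← PMF.ev_add]
                refine PMF.ev_mono _ fun K => ?_
                -- If the fresh key occurs in the table, the trivial bound by one is used and
                -- charged to the additional term. Otherwise the lookup fails and `d₁` is an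
                -- independent uniform block.
                by_cases hK : K ∈ (H.realize ρ').map Prod.fst
                · rw [if_pos hK]
                  exact (PMF.ev_le_of_le _ fun y => hΦ _ _ _ _).trans le_add_self
                · refine le_trans (le_of_eq ?_) le_self_add
                  rw [Table.sample, Table.lookup_eq_none (by exact hK)]
                  simp only [PMF.ev_map]
                  congr 1
                  funext y
                  have : (H' ((Block.xorList r.1).xor K) y).realize r.2 =
                      (K, m, y) :: H.realize ρ' := by
                    rw [← hreal]
                    simp [H', History.realize, HiddenEntry.key,
                      FunTable.xorList_of_mem_support hr]
                  simp only [this]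
                  rfl
            _ = ((uniformBlock κ).ev fun d => (uniformBlock κ).ev fun y =>
                  (ρ.fill (ps ++ tdPoints v)).ev fun ρ' => Φ d ρ' y ((H' d y).realize ρ')) +
                  H.length / blockCount κ := by
                simp only [PMF.ev_add_const]
                congr 1
                rw [FunTable.fill_append]
                -- Now `d` and `y` no longer depend on the function table. They can be drawn first,
                -- and the values at the points of the trapdoor join the undetermined values over
                -- which the induction hypothesis averages.
                have hswap : ∀ (P : PMF (FunTable κ)) (F : Block κ → Block κ → FunTable κ → ℝ≥0∞),
                    (P.ev fun ρ' => (uniformBlock κ).ev fun d => (uniformBlock κ).ev fun y =>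
                      F d y ρ') =
                    (uniformBlock κ).ev fun d => (uniformBlock κ).ev fun y => P.ev (F d y) := by
                  intro P F
                  rw [PMF.ev_comm]
                  congr 1
                  funext d
                  rw [PMF.ev_comm]
                rw [← hswap, PMF.ev_bind]
                simp only [FunTable.fill, PMF.ev_map]
            _ ≤ ((uniformBlock κ).ev fun d => (uniformBlock κ).ev fun y =>
                  (steps simClient.withTable T (k (Trapdoor.toVal ⟨d, y, nonWild v⟩),
                    (some ⟨n, x, c⟩, H.visible))).ev (fun z => f z.1) +
                      lazyLoss κ (H.length + 1) T) + H.length / blockCount κ := by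
                gcongr
                refine PMF.ev_mono _ fun d => PMF.ev_mono _ fun y => ?_
                exact ih _ _ _ (hH' d y)
            _ ≤ _ := by
                simp only [PMF.ev_add_const]
                rw [add_assoc, add_comm (lazyLoss _ _ _)]
                gcongr
                exact lazyLoss_succ_le _ _ _

/-- The real game over a lazily sampled random function and the simulated game. -/
theorem ev_real_lazy_le_sim (f : Config → ℝ≥0∞) (hf : ∀ z, f z ≤ 1) (T : ℕ) (z : Config)
    (τ : Table κ) :
    (steps (realClient lazyFun).withTable T (z, ((none, fun _ => none), τ))).ev (fun z => f z.1) ≤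
      (steps simClient.withTable T (z, (none, τ))).ev (fun z => f z.1) +
        lazyLoss κ τ.length T := by
  induction T generalizing z τ with
  | zero => simp [ev_steps_zero]
  | succ T ih =>
    have hmono : lazyLoss κ τ.length T ≤ lazyLoss κ τ.length (T + 1) :=
      lazyLoss_mono κ le_rfl (Nat.le_succ T)
    simp only [ev_steps_succ]
    cases act z with
    | internal p =>
      simp only [Act.step, PMF.ev_map]
      rw [← PMF.ev_add_const]
      exact p.ev_mono fun a => (ih a τ).trans (by gcongr)
    | query q k =>
      simp only [Act.step, PMF.ev_map, Client.withTable, PMF.ev_bind, realClient, simClient]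
      cases hq : q.parse with
      | cipher q' =>
        simp only [realReply, simReply, PMF.ev_pure, Reply.withTable, PMF.ev_map]
        rw [← PMF.ev_add_const]
        -- Before the challenge there are no hidden entries, and both games sample the same answer.
        -- Only the growth of the table has to be accounted for.
        refine PMF.ev_mono_support _ fun r hr => (ih _ _).trans ?_
        gcongr
        have : r.2.length ≤ τ.length + 1 := by
          unfold Table.sample at hr
          split at hr
          · simp only [PMF.support_pure, Set.mem_singleton_iff] at hr
            subst hr; simp
          · simp only [PMF.mem_support_map_iff] at hr
            obtain ⟨y, _, rfl⟩ := hr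
            simp
        exact (lazyLoss_mono κ this le_rfl).trans
          (le_add_self.trans (lazyLoss_succ_le κ τ.length T))
      | other =>
        simp only [realReply, simReply, PMF.ev_pure, Reply.withTable]
        exact (ih _ _).trans (by gcongr)
      | trapdoor v m =>
        simp only [realReply, simReply, PMF.ev_pure, Reply.withTable]
        exact (ih _ _).trans (by gcongr)
      | challenge t =>
        simp only [realReply, simReply, PMF.ev_map, Reply.withTable, PMF.ev_pure]
        obtain ⟨ρ, h1, h2, h3⟩ := FunTable.ev_all_ofFn (κ := κ) (fun _ => none)
          (fun l => tagged (attrVecOfVal t l) l) (fun l l' h => (tagged_injective h).2)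
          (fun _ => rfl)
        -- The points of the ciphertext are distinct and the function table is empty, so the
        -- ciphertext is uniform as in the simulated game. All entries recorded up to now are
        -- visible ones.
        rw [ctPoints, h3, ← PMF.ev_add_const]
        refine PMF.ev_mono _ fun c => ?_
        have h4 := ev_real_steps_le_sim (attrVecOfVal t) c (ρ c) (h1 c) (h2 c) f hf T
          (k (ciphertextToVal c)) [] (τ.map Sum.inl) (fun e he => by simp at he)
        have h5 : ∀ ρ' : FunTable κ, History.realize ρ' (τ.map Sum.inl) = τ := fun ρ' => by
          simp [History.realize, Function.comp_def]
        have h6 : History.visible (τ.map Sum.inl) = τ := by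
          simp [History.visible, List.filterMap_map, Function.comp_def]
        simp only [FunTable.fill_nil, PMF.ev_pure, h5, h6, List.length_map] at h4
        refine le_trans (le_of_eq ?_) (h4.trans (by gcongr))
        simp [ciphertextToVal, List.map_ofFn, Function.comp_def]

end

noncomputable section

open scoped ENNReal

/-! ## A program logic with running times -/

/-- The expectation of `g` over the runs that halt within `T` steps. -/
def haltEv {σ : Type} (O : Oracle σ) (T : ℕ) (c : Config) (o : σ) (g : Store → σ → ℝ≥0∞) : ℝ≥0∞ :=
  (steps O T (c, o)).ev fun z => if z.1.1 = [] then g z.1.2 z.2 else 0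

/-- A halted machine stays where it is, while a run that has not halted contributes zero. More time
can only add runs, which allows all running times below to be replaced by convenient upper bounds.
-/
theorem haltEv_mono {σ : Type} (O : Oracle σ) {T T' : ℕ} (h : T ≤ T') (c : Config) (o : σ)
    (g : Store → σ → ℝ≥0∞) : haltEv O T c o g ≤ haltEv O T' c o g := by
  have key : ∀ T c o, haltEv O T c o g ≤ haltEv O (T + 1) c o g := by
    intro T
    induction T with
    | zero =>
      intro c o
      unfold haltEv
      rw [ev_steps_succ, ev_steps_zero]
      rcases c with ⟨_ | ⟨c, k⟩, s⟩
      · simp [act, Act.step, ev_steps_zero]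
      · simp
    | succ T ih =>
      intro c o
      unfold haltEv at ih ⊢
      rw [ev_steps_succ, ev_steps_succ O (T + 1)]
      exact PMF.ev_mono _ fun z => ih z.1 z.2
  induction h with
  | refl => exact le_rfl
  | step _ ih => exact ih.trans (key _ _ _)

/-- Starting from the store `s` and the oracle state `o`, the commands `cs` halt within `t` steps,
and the final stores and oracle states can be coupled by `R` to a variable with distribution
`D`. -/
def Runs {σ α : Type} (O : Oracle σ) (cs : List Prog) (s : Store) (o : σ) (t : ℕ) (D : PMF α)
    (R : α → Store → σ → Prop) : Prop :=
  ∀ (k : List Prog) (T : ℕ) (g : Store → σ → ℝ≥0∞) (h : α → ℝ≥0∞),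
    (∀ a s' o', R a s' o' → h a ≤ haltEv O T (k, s') o' g) →
      D.ev h ≤ haltEv O (T + t) (cs ++ k, s) o g

namespace Runs

variable {σ α β : Type} {O : Oracle σ} {cs ds ks : List Prog} {s : Store} {o : σ} {t t₁ t₂ : ℕ}
  {D : PMF α} {R : α → Store → σ → Prop}

theorem nil {a : α} (h : R a s o) : Runs O [] s o 0 (PMF.pure a) R := by
  intro k T g f hf
  rw [PMF.ev_pure]
  exact hf _ _ _ h

theorem mono (h : Runs O cs s o t₁ D R) (ht : t₁ ≤ t₂) : Runs O cs s o t₂ D R :=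
  fun k T g f hf => (h k T g f hf).trans (haltEv_mono O (by omega) _ _ _)

theorem of_pure_step (c : Prog) {z : Config}
    (hact : ∀ k, act (c :: cs ++ k, s) = .internal (PMF.pure (z.1 ++ k, z.2)))
    (h : Runs O z.1 z.2 o t D R) : Runs O (c :: cs) s o (t + 1) D R := by
  intro k T g f hf
  unfold haltEv
  rw [← add_assoc, ev_steps_succ, hact]
  simp only [Act.step, PMF.pure_map, PMF.ev_pure]
  exact h k T g f hf

theorem assign {i : ℕ} {e : Expr} (h : Runs O cs (Function.update s i (e.eval s)) o t D R) :
    Runs O (.assign i e :: cs) s o (t + 1) D R :=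
  of_pure_step _ (z := (cs, _)) (fun _ => rfl) h

theorem flip {i : ℕ} {D : Bool → PMF α}
    (h : ∀ b, Runs O cs (Function.update s i (Val.ofBool b)) o t (D b) R) :
    Runs O (.flip i :: cs) s o (t + 1) ((PMF.uniformOfFintype Bool).bind D) R := by
  intro k T g f hf
  rw [PMF.ev_bind]
  unfold haltEv
  rw [← add_assoc, ev_steps_succ]
  simp only [List.cons_append, act, Act.step, PMF.ev_map]
  exact PMF.ev_mono _ fun b => h b k T g f hf

theorem call {i : ℕ} {e : Expr} {D' : PMF β} {φ : β → Val × σ} {D : β → PMF α}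
    (hO : O o (e.eval s) = D'.map φ)
    (h : ∀ b, Runs O cs (Function.update s i (φ b).1) (φ b).2 t (D b) R) :
    Runs O (.call i e :: cs) s o (t + 1) (D'.bind D) R := by
  intro k T g f hf
  rw [PMF.ev_bind]
  unfold haltEv
  rw [← add_assoc, ev_steps_succ]
  simp only [List.cons_append, act, Act.step, PMF.ev_map, hO]
  exact PMF.ev_mono _ fun b => h b k T g f hf

theorem call_pure {i : ℕ} {e : Expr} {r : Val × σ} (hO : O o (e.eval s) = PMF.pure r)
    (h : Runs O cs (Function.update s i r.1) r.2 t D R) :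
    Runs O (.call i e :: cs) s o (t + 1) D R := by
  intro k T g f hf
  unfold haltEv
  rw [← add_assoc, ev_steps_succ]
  simp only [List.cons_append, act, Act.step, PMF.ev_map, hO, PMF.ev_pure]
  exact h k T g f hf

theorem seq {c d : Prog} (h : Runs O (c :: d :: cs) s o t D R) :
    Runs O (.seq c d :: cs) s o (t + 1) D R :=
  of_pure_step _ (z := (c :: d :: cs, s)) (fun _ => rfl) h

theorem cond_true {e : Expr} {c d : Prog} (he : e.eval s ≠ Val.nil)
    (h : Runs O (c :: cs) s o t D R) : Runs O (.cond e c d :: cs) s o (t + 1) D R :=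
  of_pure_step _ (z := (c :: cs, s)) (fun _ => by simp [act, he]) h

theorem cond_false {e : Expr} {c d : Prog} (he : e.eval s = Val.nil)
    (h : Runs O (d :: cs) s o t D R) : Runs O (.cond e c d :: cs) s o (t + 1) D R :=
  of_pure_step _ (z := (d :: cs, s)) (fun _ => by simp [act, he]) h

theorem loop_true {e : Expr} {c : Prog} (he : e.eval s ≠ Val.nil)
    (h : Runs O (c :: .loop e c :: cs) s o t D R) : Runs O (.loop e c :: cs) s o (t + 1) D R :=
  of_pure_step _ (z := (c :: .loop e c :: cs, s)) (fun _ => by simp [act, he]) h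

theorem loop_false {e : Expr} {c : Prog} (he : e.eval s = Val.nil)
    (h : Runs O cs s o t D R) : Runs O (.loop e c :: cs) s o (t + 1) D R :=
  of_pure_step _ (z := (cs, s)) (fun _ => by simp [act, he]) h

end Runs

namespace Prog

/-- A command without effect. -/
def skip : Prog := .assign 0 (.var 0)

/-- A sequence of commands. -/
def block (cs : List Prog) : Prog := cs.foldl .seq skip

def ite (e : Expr) (cs ds : List Prog) : Prog := .cond e (block cs) (block ds)

def whileDo (e : Expr) (cs : List Prog) : Prog := .loop e (block cs)

end Prog

namespace Runs

variable {σ α β : Type} {O : Oracle σ} {cs ds ks : List Prog} {s : Store} {o : σ} {t t₁ t₂ : ℕ}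
  {D : PMF α} {R : α → Store → σ → Prop}

theorem skip (h : Runs O cs s o t D R) : Runs O (.skip :: cs) s o (t + 1) D R :=
  assign (by simpa [Expr.eval] using h)

/-- Unfolding a block costs one step for each sequencing and one for the initial `skip`. -/
theorem block (h : Runs O (cs ++ ks) s o t D R) :
    Runs O (.block cs :: ks) s o (t + (cs.length + 1)) D R := by
  have key : ∀ (cs : List Prog) (c : Prog) (t : ℕ), Runs O (c :: cs ++ ks) s o t D R →
      Runs O (cs.foldl .seq c :: ks) s o (t + cs.length) D R := by
    intro cs
    induction cs with
    | nil => intro c t h; exact h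
    | cons c' cs ih =>
      intro c t h
      refine (ih (.seq c c') (t + 1) (seq h)).mono ?_
      simp only [List.length_cons]; omega
  refine (key cs .skip (t + 1) (skip h)).mono ?_
  omega

theorem ite {e : Expr} (h₁ : e.eval s ≠ Val.nil → Runs O (cs ++ ks) s o t₁ D R)
    (h₂ : e.eval s = Val.nil → Runs O (ds ++ ks) s o t₂ D R) :
    Runs O (.ite e cs ds :: ks) s o (max t₁ t₂ + (cs.length + ds.length + 2)) D R := by
  by_cases he : e.eval s = Val.nil
  · exact (cond_false he (block (h₂ he))).mono (by omega)
  · exact (cond_true he (block (h₁ he))).mono (by omega)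

theorem ite_true {e : Expr} (he : e.eval s ≠ Val.nil) (h : Runs O (cs ++ ks) s o t D R) :
    Runs O (.ite e cs ds :: ks) s o (t + (cs.length + 2)) D R :=
  cond_true he (block h)

theorem ite_false {e : Expr} (he : e.eval s = Val.nil) (h : Runs O (ds ++ ks) s o t D R) :
    Runs O (.ite e cs ds :: ks) s o (t + (ds.length + 2)) D R :=
  cond_false he (block h)

theorem while_true {e : Expr} (he : e.eval s ≠ Val.nil)
    (h : Runs O (cs ++ .whileDo e cs :: ks) s o t D R) :
    Runs O (.whileDo e cs :: ks) s o (t + (cs.length + 2)) D R :=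
  loop_true he (block h)

theorem while_false {e : Expr} (he : e.eval s = Val.nil) (h : Runs O ks s o t D R) :
    Runs O (.whileDo e cs :: ks) s o (t + 1) D R :=
  loop_false he h

end Runs

/-- A program that halts in time outputs what its specification says. -/
theorem Prog.output_eq_map {σ α : Type} {P : Prog} {O : Oracle σ} {o : σ} {t T : ℕ} {input : Val}
    {D : PMF α} {φ : α → Val}
    (h : Runs O [P] (Function.update (fun _ => Val.nil) 0 input) o t D fun a s' _ => s' 0 = φ a)
    (ht : t ≤ T) : P.output O o T input = D.map φ := by
  symm
  -- `Runs` bounds expectations only from below, which is enough for two probability distributions.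
  -- The rule is used with no further commands and no remaining time.
  refine PMF.eq_of_ev_le fun f => ?_
  rw [PMF.ev_map, Prog.output, PMF.ev_map]
  refine (h [] 0 (fun s' _ => f (s' 0)) _ fun a s' o' ha => ?_).trans ?_
  · simp [haltEv, ev_steps_zero, ha]
  · refine (haltEv_mono O (by omega : 0 + t ≤ T) _ _ _).trans ?_
    unfold haltEv
    refine PMF.ev_mono _ fun z => ?_
    split_ifs <;> simp

/-! ## Subroutines -/

namespace Val

/-- The list `t`, reversed and put before the list `u`. -/
def revAppend : Val → Val → Val
  | nil, u => u
  | cons a t, u => revAppend t (cons a u)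

theorem revAppend_ofList (l : List Val) (u : Val) :
    revAppend (ofList l) u = (l.reverse.foldr cons u) := by
  induction l generalizing u with
  | nil => rfl
  | cons a l ih => simp [ofList, revAppend, ih]

theorem ofList_append (l l' : List Val) : ofList (l ++ l') = l.foldr cons (ofList l') := by
  induction l with
  | nil => rfl
  | cons a l ih => simp [ofList, ih]

theorem revAppend_ofList_ofList (l l' : List Val) :
    revAppend (ofList l) (ofList l') = ofList (l.reverse ++ l') := by
  rw [revAppend_ofList, ofList_append]

theorem toList_revAppend (t u : Val) : (revAppend t u).toList = t.toList.reverse ++ u.toList := by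
  induction t generalizing u with
  | nil => rfl
  | cons a t _ ih => simp [revAppend, ih, toList]

@[simp] theorem toList_ofList (l : List Val) : (ofList l).toList = l := by
  induction l with
  | nil => rfl
  | cons a l ih => simp [ofList, toList, ih]

theorem ofList_toList (t : Val) : ofList t.toList = t := by
  induction t with
  | nil => rfl
  | cons a t _ ih => simp [ofList, toList, ih]

@[simp] theorem toBool_ofBool (b : Bool) : (ofBool b).toBool = b := by cases b <;> rfl

@[simp] theorem toBits_ofBits (l : List Bool) : (ofBits l).toBits = l := by
  simp [toBits, ofBits, Function.comp_def]

@[simp] theorem ofBits_nil : ofBits [] = nil := rfl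

@[simp] theorem ofBits_cons (b : Bool) (l : List Bool) :
    ofBits (b :: l) = cons (ofBool b) (ofBits l) := rfl

@[simp] theorem unary_zero : unary 0 = nil := rfl

@[simp] theorem unary_succ (n : ℕ) : unary (n + 1) = cons (cons nil nil) (unary n) := rfl

@[simp] theorem hd_cons (a t : Val) : (cons a t).hd = a := rfl
@[simp] theorem tl_cons (a t : Val) : (cons a t).tl = t := rfl
@[simp] theorem hd_nil : nil.hd = nil := rfl
@[simp] theorem tl_nil : nil.tl = nil := rfl
@[simp] theorem toList_nil : nil.toList = [] := rfl
@[simp] theorem toList_cons (a t : Val) : (cons a t).toList = a :: t.toList := rfl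

theorem ofBool_eq_nil_iff (b : Bool) : ofBool b = nil ↔ b = false := by cases b <;> simp [ofBool]

theorem toBool_eq_false_iff (t : Val) : t.toBool = false ↔ t = nil := by cases t <;> simp [toBool]

end Val

attribute [simp] Expr.eval

/-- The expression for the bit `1`. -/
abbrev Expr.one : Expr := .cons .nil .nil

/-- Moves the entries of the list in variable `x` to the front of the list in variable `y`. -/
def revProg (x y : ℕ) : List Prog :=
  [.whileDo (.var x) [.assign y (.cons (.hd (.var x)) (.var y)), .assign x (.tl (.var x))]]

section

variable {σ α : Type} {O : Oracle σ} {ks : List Prog} {s : Store} {o : σ} {t : ℕ}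
  {D : PMF α} {R : α → Store → σ → Prop}

/-- A pass takes six steps: one for the test, three for unfolding the block, two for the
assignments. A bound `L` in place of the exact length keeps the running time independent of the
data. -/
theorem runs_revProg {x y : ℕ} (hxy : x ≠ y) {L : ℕ} (hL : (s x).toList.length ≤ L)
    (h : Runs O ks (Function.update (Function.update s x .nil) y ((s x).revAppend (s y))) o t D R) :
    Runs O (revProg x y ++ ks) s o (t + (6 * L + 1)) D R := by
  unfold revProg
  generalize hv : s x = v at hL h
  induction v generalizing s L with
  | nil =>
    refine Runs.mono (Runs.while_false (by simpa using hv) (t := t) ?_) (by omega)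
    have : Function.update (Function.update s x .nil) y (Val.nil.revAppend (s y)) = s := by
      funext i
      by_cases hi : i = y
      · subst hi; simp [Val.revAppend]
      · by_cases hi' : i = x
        · subst hi'; simp [hxy, hv]
        · simp [hi, hi']
    rwa [this] at h
  | cons a v _ ih =>
    obtain ⟨L, rfl⟩ : ∃ L', L = L' + 1 := ⟨L - 1, by simp at hL; omega⟩
    refine Runs.mono (Runs.while_true (by simp [hv]) (Runs.assign (Runs.assign
      (ih (L := L) ?_ (by simpa using hL) ?_)))) (by simp; omega)
    · simp [hv, hxy]
    · convert h using 1
      funext i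
      by_cases hi : i = y
      · subst hi; simp [Val.revAppend, hv, hxy, Function.update_of_ne hxy.symm]
      · by_cases hi' : i = x
        · subst hi'; simp [hi]
        · simp [hi, hi']

end

end

/-! ### Programs for blocks: truncation, sampling, exclusive or, comparison -/

noncomputable section

open scoped ENNReal

/-- The stores agree outside the variables in `W`. -/
def Frame (W : List ℕ) (s s' : Store) : Prop := ∀ i, i ∉ W → s' i = s i

namespace Frame

variable {W W' : List ℕ} {s s' s'' : Store}

theorem refl (W : List ℕ) (s : Store) : Frame W s s := fun _ _ => rfl

theorem trans (h : Frame W s s') (h' : Frame W s' s'') : Frame W s s'' :=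
  fun i hi => (h' i hi).trans (h i hi)

theorem mono (h : Frame W s s') (hW : W ⊆ W') : Frame W' s s' :=
  fun i hi => h i fun h' => hi (hW h')

theorem update {i : ℕ} {v : Val} (hi : i ∈ W) (h : Frame W s s') :
    Frame W s (Function.update s' i v) := fun j hj => by
  rw [Function.update_of_ne (by rintro rfl; exact hj hi), h j hj]

end Frame

namespace Block

@[simp] theorem ofVal_toVal {κ : ℕ} (a : Block κ) : ofVal κ a.toVal = a := by
  funext i
  simp [ofVal, toVal]

theorem ofFn_ofVal_succ (m : ℕ) (v : Val) :
    List.ofFn (ofVal (m + 1) v) = v.hd.toBool :: List.ofFn (ofVal m v.tl) := by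
  rw [List.ofFn_succ]
  congr 1
  · cases v <;> simp [ofVal, Val.toBits, Val.toBool]
  · congr 1
    funext i
    cases v <;> simp [ofVal, Val.toBits]

theorem zipWith_ofFn_xor {κ : ℕ} (a b : Block κ) :
    List.zipWith Bool.xor (List.ofFn a) (List.ofFn b) = List.ofFn (a.xor b) := by
  apply List.ext_getElem
  · simp
  · intro i h1 h2
    simp [xor]

end Block

/-- Cuts off the list in variable `20` at the length in variable `1`; the result is in variable
`21`. -/
def truncProg : List Prog :=
  [.assign 22 (.var 1), .assign 23 .nil,
    .whileDo (.var 22) [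
      .ite (.hd (.var 20)) [.assign 23 (.cons .one (.var 23))] [.assign 23 (.cons .nil (.var 23))],
      .assign 20 (.tl (.var 20)), .assign 22 (.tl (.var 22))],
    .assign 21 .nil] ++ revProg 23 21

/-- A uniformly random block of the length in variable `1` is put into variable `21`. -/
def sampleProg : List Prog :=
  [.assign 22 (.var 1), .assign 23 .nil,
    .whileDo (.var 22) [.flip 9, .assign 23 (.cons (.var 9) (.var 23)), .assign 22 (.tl (.var 22))],
    .assign 21 .nil] ++ revProg 23 21

/-- The exclusive or of the blocks in variables `24` and `25` is put into variable `21`. -/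
def xorProg : List Prog :=
  [.assign 23 .nil,
    .whileDo (.var 24) [
      .ite (.hd (.var 24))
        [.ite (.hd (.var 25)) [.assign 23 (.cons .nil (.var 23))] [.assign 23 (.cons .one (.var 23))]]
        [.ite (.hd (.var 25)) [.assign 23 (.cons .one (.var 23))] [.assign 23 (.cons .nil (.var 23))]],
      .assign 24 (.tl (.var 24)), .assign 25 (.tl (.var 25))],
    .assign 21 .nil] ++ revProg 23 21

/-- Variable `26` is cleared if the blocks in variables `24` and `25` differ. -/
def eqProg : List Prog :=
  [.whileDo (.var 24) [
      .ite (.hd (.var 24))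
        [.ite (.hd (.var 25)) [] [.assign 26 .nil]]
        [.ite (.hd (.var 25)) [.assign 26 .nil] []],
      .assign 24 (.tl (.var 24)), .assign 25 (.tl (.var 25))]]

section

variable {σ α : Type} {O : Oracle σ} {ks : List Prog} {s : Store} {o : σ} {t : ℕ}
  {D : PMF α} {R : α → Store → σ → Prop} {κ : ℕ}

theorem runs_truncLoop {m : ℕ} {l : List Bool} (hm : s 22 = Val.unary m) (hl : s 23 = Val.ofBits l)
    (h : ∀ s', s' 23 = Val.ofBits ((List.ofFn (Block.ofVal m (s 20))).reverse ++ l) →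
      Frame [20, 22, 23] s s' → Runs O ks s' o t D R) :
    Runs O (.whileDo (.var 22) [
      .ite (.hd (.var 20)) [.assign 23 (.cons .one (.var 23))] [.assign 23 (.cons .nil (.var 23))],
      .assign 20 (.tl (.var 20)), .assign 22 (.tl (.var 22))] :: ks) s o (t + (12 * m + 1)) D R := by
  induction m generalizing s l with
  | zero => exact Runs.while_false (by simp [hm]) (h s (by simp [hl]) (Frame.refl _ _))
  | succ m ih =>
    refine Runs.mono (Runs.while_true (by simp [hm]) (Runs.ite
      (fun hb => Runs.assign (Runs.assign (Runs.assign (ih (l := true :: l) ?_ ?_ ?_))))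
      (fun hb => Runs.assign (Runs.assign (Runs.assign (ih (l := false :: l) ?_ ?_ ?_)))))) ?_
    · simp [hm]
    · simp [hl, Val.ofBool]
    · intro s' h1 h2
      refine h s' ?_ ((Frame.refl _ _ |>.update (by simp) |>.update (by simp)
        |>.update (by simp)).trans h2)
      rw [h1, Block.ofFn_ofVal_succ]
      have : (s 20).hd.toBool = true := by
        rw [← Bool.not_eq_false, Val.toBool_eq_false_iff]; exact hb
      simp [this]
    · simp [hm]
    · simp [hl, Val.ofBool]
    · intro s' h1 h2
      refine h s' ?_ ((Frame.refl _ _ |>.update (by simp) |>.update (by simp)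
        |>.update (by simp)).trans h2)
      rw [h1, Block.ofFn_ofVal_succ]
      have : (s 20).hd.toBool = false := by
        rw [Val.toBool_eq_false_iff]; exact hb
      simp [this]
    · simp only [List.length_cons, List.length_nil]; omega

/-- Keys and blocks sent by the adversary are arbitrary trees. They have to be brought into the
normal form `Block.toVal` before they can be compared bit by bit with table entries and stored. -/
theorem runs_truncProg (hκ : s 1 = Val.unary κ)
    (h : ∀ s', s' 21 = (Block.ofVal κ (s 20)).toVal → Frame [20, 21, 22, 23] s s' →
      Runs O ks s' o t D R) :
    Runs O (truncProg ++ ks) s o (t + (18 * κ + 5)) D R := by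
  unfold truncProg
  simp only [List.cons_append, List.nil_append]
  refine Runs.mono (Runs.assign (Runs.assign (runs_truncLoop (m := κ) (l := []) ?_ ?_ fun s' h1 h2 =>
    Runs.assign (runs_revProg (by decide) (L := κ) ?_ (h _ ?_ ?_))))) (by omega)
  · simp [hκ]
  · simp
  · simp [h1, Val.ofBits]
  · simp only [Expr.eval, List.append_nil, ne_eq, Nat.reduceEqDiff,
      not_false_eq_true, Function.update_of_ne, Function.update_self] at h1 ⊢
    rw [h1, Val.ofBits, show Val.nil = Val.ofList [] from rfl, Val.revAppend_ofList_ofList]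
    simp [Block.toVal, Val.ofBits]
  · refine Frame.update (by simp) (Frame.update (by simp) (Frame.update (by simp) ?_))
    exact (Frame.refl _ _ |>.update (by simp) |>.update (by simp)).trans (h2.mono (by simp))

/-- The continuation `D` is indexed by lists, not by functions on `Fin m`, so that after the first
coin `b` the rest of the loop is an instance of the same statement with `D (b :: ·)`. -/
theorem runs_sampleLoop {m : ℕ} {l : List Bool} {D : List Bool → PMF α} (hm : s 22 = Val.unary m)
    (hl : s 23 = Val.ofBits l)
    (h : ∀ (y : Fin m → Bool) s', s' 23 = Val.ofBits ((List.ofFn y).reverse ++ l) →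
      Frame [9, 22, 23] s s' → Runs O ks s' o t (D (List.ofFn y)) R) :
    Runs O (.whileDo (.var 22) [.flip 9, .assign 23 (.cons (.var 9) (.var 23)),
      .assign 22 (.tl (.var 22))] :: ks) s o (t + (8 * m + 1))
      ((PMF.uniformOfFintype (Fin m → Bool)).bind fun y => D (List.ofFn y)) R := by
  induction m generalizing s l D with
  | zero =>
    have : ((PMF.uniformOfFintype (Fin 0 → Bool)).bind fun y => D (List.ofFn y)) = D [] := by
      simp
    rw [this]
    exact Runs.while_false (by simp [hm]) (by simpa using h default s (by simp [hl]) (Frame.refl _ _))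
  | succ m ih =>
    have : ((PMF.uniformOfFintype (Fin (m + 1) → Bool)).bind fun y => D (List.ofFn y)) =
        (PMF.uniformOfFintype Bool).bind fun b =>
          (PMF.uniformOfFintype (Fin m → Bool)).bind fun y => D (b :: List.ofFn y) := by
      refine PMF.ext_ev fun f => ?_
      simp only [PMF.ev_bind]
      rw [PMF.ev_uniform_fin_succ]
      simp [List.ofFn_succ]
    rw [this]
    refine Runs.mono (Runs.while_true (by simp [hm]) (Runs.flip fun b => Runs.assign (Runs.assign
      (ih (l := b :: l) (D := fun l => D (b :: l)) ?_ ?_ ?_)))) ?_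
    · simp [hm]
    · simp [hl]
    · intro y s' h1 h2
      have := h (Fin.cons b y) s' ?_ ((Frame.refl _ _ |>.update (by simp) |>.update (by simp)
        |>.update (by simp)).trans h2)
      · simpa [List.ofFn_succ] using this
      · rw [h1]; simp [List.ofFn_succ]
    · simp only [List.length_cons, List.length_nil]; omega

theorem runs_sampleProg {D : Block κ → PMF α} (hκ : s 1 = Val.unary κ)
    (h : ∀ (y : Block κ) s', s' 21 = y.toVal → Frame [9, 21, 22, 23] s s' →
      Runs O ks s' o t (D y) R) :
    Runs O (sampleProg ++ ks) s o (t + (14 * κ + 5)) ((uniformBlock κ).bind D) R := by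
  unfold sampleProg
  simp only [List.cons_append, List.nil_append]
  -- A continuation indexed by blocks is rewritten as one indexed by lists of bits, as the loop rule
  -- demands.
  have hD : ∀ y : Block κ, D y = D (Block.ofVal κ (Val.ofBits (List.ofFn y))) := fun y => by
    rw [← Block.toVal, Block.ofVal_toVal]
  rw [show D = fun y => D (Block.ofVal κ (Val.ofBits (List.ofFn y))) from funext hD]
  refine Runs.mono (Runs.assign (Runs.assign (runs_sampleLoop (m := κ) (l := [])
    (D := fun l => D (Block.ofVal κ (Val.ofBits l))) ?_ ?_ fun y s' h1 h2 =>
    Runs.assign (runs_revProg (by decide) (L := κ) (t := t) ?_ ?_)))) (by omega)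
  · simp [hκ]
  · simp
  · simp [h1, Val.ofBits]
  · rw [← hD]
    refine h y _ ?_ ?_
    · simp only [Expr.eval, List.append_nil, ne_eq, Nat.reduceEqDiff,
        not_false_eq_true, Function.update_of_ne, Function.update_self] at h1 ⊢
      rw [h1, Val.ofBits, show Val.nil = Val.ofList [] from rfl, Val.revAppend_ofList_ofList]
      simp [Block.toVal, Val.ofBits]
    · refine Frame.update (by simp) (Frame.update (by simp) (Frame.update (by simp) ?_))
      exact (Frame.refl _ _ |>.update (by simp) |>.update (by simp)).trans (h2.mono (by simp))

theorem runs_xorLoop {l l' r : List Bool} (hlen : l.length = l'.length) {m : ℕ}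
    (hm : l.length = m) (hl : s 24 = Val.ofBits l)
    (hl' : s 25 = Val.ofBits l') (hr : s 23 = Val.ofBits r)
    (h : ∀ s', s' 23 = Val.ofBits ((List.zipWith Bool.xor l l').reverse ++ r) →
      Frame [23, 24, 25] s s' → Runs O ks s' o t D R) :
    Runs O (.whileDo (.var 24) [
      .ite (.hd (.var 24))
        [.ite (.hd (.var 25)) [.assign 23 (.cons .nil (.var 23))] [.assign 23 (.cons .one (.var 23))]]
        [.ite (.hd (.var 25)) [.assign 23 (.cons .one (.var 23))] [.assign 23 (.cons .nil (.var 23))]],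
      .assign 24 (.tl (.var 24)), .assign 25 (.tl (.var 25))] :: ks) s o (t + (16 * m + 1)) D R := by
  induction l generalizing s l' r m with
  | nil => exact Runs.while_false (by simp [hl]) ((h s (by simp [hr]) (Frame.refl _ _))) |>.mono (by omega)
  | cons b l ih =>
    obtain _ | ⟨b', l'⟩ := l'
    · simp at hlen
    obtain _ | m := m
    · simp at hm
    simp only [List.length_cons, Nat.add_right_cancel_iff] at hlen hm
    have key : ∀ (s' : Store), s' 24 = s 24 → s' 25 = s 25 →
        s' 23 = Val.ofBits (Bool.xor b b' :: r) → Frame [23, 24, 25] s s' →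
        Runs O (Prog.assign 24 (.tl (.var 24)) :: .assign 25 (.tl (.var 25)) :: .whileDo (.var 24) [
      .ite (.hd (.var 24))
        [.ite (.hd (.var 25)) [.assign 23 (.cons .nil (.var 23))] [.assign 23 (.cons .one (.var 23))]]
        [.ite (.hd (.var 25)) [.assign 23 (.cons .one (.var 23))] [.assign 23 (.cons .nil (.var 23))]],
      .assign 24 (.tl (.var 24)), .assign 25 (.tl (.var 25))] :: ks) s' o (t + (16 * m + 1) + 1 + 1) D R := by
      intro s' h1 h2 h3 h4
      refine Runs.assign (Runs.assign (ih hlen hm (r := Bool.xor b b' :: r) ?_ ?_ ?_ ?_))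
      · simp [h1, hl]
      · simp [h2, hl']
      · simp [h3]
      · intro s'' h5 h6
        refine h s'' ?_ (h4.trans ((Frame.refl _ _ |>.update (by simp) |>.update (by simp)).trans h6))
        rw [h5]; simp
    have hb : (Expr.hd (.var 24)).eval s = Val.ofBool b := by simp [hl]
    have hb' : (Expr.hd (.var 25)).eval s = Val.ofBool b' := by simp [hl']
    have b1 : (Expr.hd (.var 24)).eval s ≠ .nil → b = true := by
      rw [hb, ne_eq, Val.ofBool_eq_nil_iff]; simp
    have b0 : (Expr.hd (.var 24)).eval s = .nil → b = false := by
      rw [hb, Val.ofBool_eq_nil_iff]; simp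
    have b1' : (Expr.hd (.var 25)).eval s ≠ .nil → b' = true := by
      rw [hb', ne_eq, Val.ofBool_eq_nil_iff]; simp
    have b0' : (Expr.hd (.var 25)).eval s = .nil → b' = false := by
      rw [hb', Val.ofBool_eq_nil_iff]; simp
    refine Runs.mono (Runs.while_true (by simp [hl]) (Runs.ite
      (fun h1 => Runs.ite (fun h2 => Runs.assign (key _ (by simp) (by simp)
          (by simp [hr, b1 h1, b1' h2, Val.ofBool]) (Frame.update (by simp) (Frame.refl _ _))))
        (fun h2 => Runs.assign (key _ (by simp) (by simp)
          (by simp [hr, b1 h1, b0' h2, Val.ofBool]) (Frame.update (by simp) (Frame.refl _ _)))))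
      (fun h1 => Runs.ite (fun h2 => Runs.assign (key _ (by simp) (by simp)
          (by simp [hr, b0 h1, b1' h2, Val.ofBool]) (Frame.update (by simp) (Frame.refl _ _))))
        (fun h2 => Runs.assign (key _ (by simp) (by simp)
          (by simp [hr, b0 h1, b0' h2, Val.ofBool]) (Frame.update (by simp) (Frame.refl _ _))))))) (by simp only [List.length_cons, List.length_nil]; omega)

theorem runs_xorProg {a b : Block κ} (ha : s 24 = a.toVal) (hb : s 25 = b.toVal)
    (h : ∀ s', s' 21 = (a.xor b).toVal → Frame [21, 23, 24, 25] s s' → Runs O ks s' o t D R) :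
    Runs O (xorProg ++ ks) s o (t + (22 * κ + 5)) D R := by
  unfold xorProg
  simp only [List.cons_append, List.nil_append]
  refine Runs.mono (Runs.assign (runs_xorLoop (m := κ) (l := List.ofFn a) (l' := List.ofFn b) (r := [])
    (by simp) (by simp) ?_ ?_ ?_ fun s' h1 h2 =>
    Runs.assign (runs_revProg (by decide) (L := κ) ?_ (h _ ?_ ?_)))) (by omega)
  · simp [ha, Block.toVal]
  · simp [hb, Block.toVal]
  · simp
  · simp [h1, Val.ofBits]
  · rw [Block.zipWith_ofFn_xor] at h1
    simp only [Expr.eval, List.append_nil, ne_eq, Nat.reduceEqDiff,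
      not_false_eq_true, Function.update_of_ne, Function.update_self] at h1 ⊢
    rw [h1, Val.ofBits, show Val.nil = Val.ofList [] from rfl, Val.revAppend_ofList_ofList]
    simp [Block.toVal, Val.ofBits]
  · refine Frame.update (by simp) (Frame.update (by simp) (Frame.update (by simp) ?_))
    exact (Frame.refl _ _ |>.update (by simp)).trans (h2.mono (by simp))

/-- A mismatch clears the flag in variable `26` and a match leaves it alone, so consecutive
comparisons form a conjunction. -/
theorem runs_eqLoop {l l' : List Bool} (hlen : l.length = l'.length) {m : ℕ}
    (hm : l.length = m) (hl : s 24 = Val.ofBits l) (hl' : s 25 = Val.ofBits l')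
    (h : ∀ s', s' 26 = (if l = l' then s 26 else .nil) →
      Frame [24, 25, 26] s s' → Runs O ks s' o t D R) :
    Runs O (eqProg ++ ks) s o (t + (16 * m + 1)) D R := by
  induction l generalizing s l' m with
  | nil =>
    obtain rfl : l' = [] := by simpa using hlen.symm
    exact Runs.while_false (by simp [hl]) ((h s (by simp) (Frame.refl _ _))) |>.mono (by omega)
  | cons b l ih =>
    obtain _ | ⟨b', l'⟩ := l'
    · simp at hlen
    obtain _ | m := m
    · simp at hm
    simp only [List.length_cons, Nat.add_right_cancel_iff] at hlen hm
    have key : ∀ (s' : Store), s' 24 = s 24 → s' 25 = s 25 →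
        s' 26 = (if b = b' then s 26 else .nil) → Frame [24, 25, 26] s s' →
        Runs O (Prog.assign 24 (.tl (.var 24)) :: .assign 25 (.tl (.var 25)) :: (eqProg ++ ks))
          s' o (t + (16 * m + 1) + 1 + 1) D R := by
      intro s' h1 h2 h3 h4
      refine Runs.assign (Runs.assign (ih hlen hm (l' := l') ?_ ?_ ?_))
      · simp [h1, hl]
      · simp [h2, hl']
      · intro s'' h5 h6
        refine h s'' ?_ (h4.trans ((Frame.refl _ _ |>.update (by simp) |>.update (by simp)).trans h6))
        rw [h5]
        by_cases hbb : b = b' <;> simp [hbb, h3]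
    have hb : (Expr.hd (.var 24)).eval s = Val.ofBool b := by simp [hl]
    have hb' : (Expr.hd (.var 25)).eval s = Val.ofBool b' := by simp [hl']
    unfold eqProg
    have b1 : (Expr.hd (.var 24)).eval s ≠ .nil → b = true := by
      rw [hb, ne_eq, Val.ofBool_eq_nil_iff]; simp
    have b0 : (Expr.hd (.var 24)).eval s = .nil → b = false := by
      rw [hb, Val.ofBool_eq_nil_iff]; simp
    have b1' : (Expr.hd (.var 25)).eval s ≠ .nil → b' = true := by
      rw [hb', ne_eq, Val.ofBool_eq_nil_iff]; simp
    have b0' : (Expr.hd (.var 25)).eval s = .nil → b' = false := by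
      rw [hb', Val.ofBool_eq_nil_iff]; simp
    refine Runs.mono (Runs.while_true (by simp [hl]) (Runs.ite
      (fun h1 => Runs.ite (fun h2 => key _ rfl rfl
          (by simp [b1 h1, b1' h2]) (Frame.refl _ _))
        (fun h2 => Runs.assign (key _ (by simp) (by simp)
          (by simp [b1 h1, b0' h2]) (Frame.update (by simp) (Frame.refl _ _)))))
      (fun h1 => Runs.ite (fun h2 => Runs.assign (key _ (by simp) (by simp)
          (by simp [b0 h1, b1' h2]) (Frame.update (by simp) (Frame.refl _ _))))
        (fun h2 => key _ rfl rfl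
          (by simp [b0 h1, b0' h2]) (Frame.refl _ _))))) (by simp only [List.length_cons, List.length_nil]; omega)

theorem runs_eqProg {a b : Block κ} (ha : s 24 = a.toVal) (hb : s 25 = b.toVal)
    (h : ∀ s', s' 26 = (if a = b then s 26 else .nil) → Frame [24, 25, 26] s s' →
      Runs O ks s' o t D R) :
    Runs O (eqProg ++ ks) s o (t + (16 * κ + 1)) D R := by
  refine runs_eqLoop (l := List.ofFn a) (l' := List.ofFn b) (by simp) (by simp) ha hb ?_
  simpa only [List.ofFn_injective.eq_iff] using h

end

end

/-! ### Programs for tagging and for the lazily sampled cipher -/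

noncomputable section

open scoped ENNReal

/-- The tagged attribute in variable `27`, with the position in variable `28`, is put into variable
`29`. -/
def tagProg : List Prog :=
  .assign 30 .nil :: (revProg 27 30 ++ .assign 29 (.cons .nil (.var 28)) :: revProg 30 29)

/-- The table of a cipher as a tree. -/
def Table.toVal {κ : ℕ} (τ : Table κ) : Val :=
  Val.ofList (τ.map fun e => .cons e.1.toVal (.cons e.2.1.toVal e.2.2.toVal))

/-- The loop of a table lookup. -/
def lookupLoop : Prog :=
  .whileDo (.var 13) (
    [.assign 26 .one, .assign 24 (.var 11), .assign 25 (.hd (.hd (.var 13)))] ++ (eqProg ++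
    [.assign 24 (.var 12),
      .ite (.var 10) [.assign 25 (.tl (.tl (.hd (.var 13))))]
        [.assign 25 (.hd (.tl (.hd (.var 13))))]] ++ (eqProg ++
    [.ite (.var 26)
      [.ite (.var 10) [.assign 14 (.cons (.hd (.tl (.hd (.var 13)))) .nil)]
        [.assign 14 (.cons (.tl (.tl (.hd (.var 13)))) .nil)],
        .assign 13 .nil]
      [.assign 13 (.tl (.var 13))]])))

/-- A query to a lazily sampled cipher, whose table is in variable `4`: the direction, the key and
the block are in variables `10`, `11` and `12`, the answer is put into variable `8`. -/
def cipherProg : List Prog :=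
  [.assign 13 (.var 4), .assign 14 .nil, lookupLoop,
    .ite (.var 14) [.assign 8 (.hd (.var 14))]
      (sampleProg ++ [.assign 8 (.var 21),
        .ite (.var 10)
          [.assign 4 (.cons (.cons (.var 11) (.cons (.var 8) (.var 12))) (.var 4))]
          [.assign 4 (.cons (.cons (.var 11) (.cons (.var 12) (.var 8))) (.var 4))]])]

section

variable {σ α : Type} {O : Oracle σ} {ks : List Prog} {s : Store} {o : σ} {t : ℕ}
  {D : PMF α} {R : α → Store → σ → Prop} {κ : ℕ}

/-- Two reversals put the attribute before the separator and the unary position. Its entries are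
copied without normalisation, so the result is known only through `toBits`, which is all that the
function oracle looks at. -/
theorem runs_tagProg {i L : ℕ} (hL : (s 27).toList.length ≤ L) (hi : s 28 = Val.unary (i + 1))
    (h : ∀ s', (s' 29).toBits = tag (s 27).toBits i → Frame [27, 29, 30] s s' →
      Runs O ks s' o t D R) :
    Runs O (tagProg ++ ks) s o (t + (12 * L + 4)) D R := by
  unfold tagProg
  simp only [List.cons_append, List.append_assoc]
  refine Runs.mono (Runs.assign (runs_revProg (by decide) (L := L) ?_ (Runs.assign
    (runs_revProg (by decide) (L := L) (t := t) ?_ (h _ ?_ ?_))))) (by omega)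
  · simpa using hL
  · simp [Val.toList_revAppend]; exact hL
  · simp [Val.toBits, Val.toList_revAppend, hi, tag, Val.unary, Val.ofBits, List.replicate_succ]
    simp [Val.toBool]
  · exact Frame.refl _ _ |>.update (by simp) |>.update (by simp) |>.update (by simp)
      |>.update (by simp) |>.update (by simp) |>.update (by simp)

/-- Each entry costs two comparisons, of the key and of the block, which share the flag. A match
empties the remaining list, so the first matching entry decides, as in `Table.lookup`. The answer is
wrapped in a pair because an empty block would otherwise look like a failed lookup. -/
theorem runs_lookupLoop {τ : Table κ} {d : Bool} {K x : Block κ} {N : ℕ} (hN : τ.length ≤ N)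
    (hτ : s 13 = τ.toVal) (hd : s 10 = Val.ofBool d) (hK : s 11 = K.toVal) (hx : s 12 = x.toVal)
    (hn : s 14 = .nil)
    (h : ∀ s', s' 14 = ((τ.lookup (d, K, x)).elim .nil fun y => .cons y.toVal .nil) →
      Frame [13, 14, 24, 25, 26] s s' → Runs O ks s' o t D R) :
    Runs O (lookupLoop :: ks) s o (t + (N * (32 * κ + 40) + 1)) D R := by
  induction τ generalizing s N with
  | nil =>
    exact Runs.mono (Runs.while_false (by simp [hτ, Table.toVal, Val.ofList])
      (h s (by simp [hn, Table.lookup]) (Frame.refl _ _))) (by omega)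
  | cons e τ ih =>
    obtain ⟨K', a, b⟩ := e
    obtain _ | N := N
    · simp at hN
    have hτ' : s 13 = .cons (.cons K'.toVal (.cons a.toVal b.toVal)) (Table.toVal τ) := hτ
    have hlook : Table.lookup ((K', a, b) :: τ) (d, K, x) =
        if K = K' ∧ x = (if d then b else a) then some (if d then a else b)
        else Table.lookup τ (d, K, x) := by
      rw [Table.lookup]
      simp only [eq_comm]
    have hb : ∀ (s' : Store), s' 14 = .nil → s' 13 = s 13 →
        s' 26 = (if K = K' ∧ x = (if d then b else a) then .cons .nil .nil else .nil) →
        Frame [13, 14, 24, 25, 26] s s' →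
        Runs O (Prog.ite (.var 26)
      [.ite (.var 10) [.assign 14 (.cons (.hd (.tl (.hd (.var 13)))) .nil)]
        [.assign 14 (.cons (.tl (.tl (.hd (.var 13)))) .nil)],
        .assign 13 .nil]
      [.assign 13 (.tl (.var 13))] :: lookupLoop :: ks) s' o
          (t + (N * (32 * κ + 40) + 1) + 14) D R := by
      intro s' h14 h13 h26 hf
      have h10 : s' 10 = Val.ofBool d := by rw [hf 10 (by simp), hd]
      by_cases hc : K = K' ∧ x = (if d then b else a)
      · rw [if_pos hc] at h26
        rw [if_pos hc] at hlook
        have hfin : ∀ s'' : Store, s'' 14 = .cons (if d then a else b).toVal .nil →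
            Frame [13, 14, 24, 25, 26] s' s'' →
            Runs O (Prog.assign 13 .nil :: lookupLoop :: ks) s'' o (t + 2) D R := by
          intro s'' h1 h2
          refine Runs.assign (Runs.while_false (by simp) (h _ ?_ ?_))
          · rw [hlook]; simp [h1]
          · exact (hf.trans h2).update (by simp)
        refine Runs.mono (Runs.ite_true (by simp [h26]) (t := t + 2 + 1 + 3)
          (Runs.mono (t₁ := t + 2 + 1 + (1 + 2)) ?_ le_rfl)) (by simp; omega)
        cases d with
        | true =>
          refine Runs.ite_true (by simp [h10, Val.ofBool]) (Runs.assign (hfin _ ?_ ?_))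
          · simp [h13, hτ']
          · exact (Frame.refl _ _).update (by simp)
        | false =>
          refine Runs.ite_false (by simp [h10, Val.ofBool]) (Runs.assign (hfin _ ?_ ?_))
          · simp [h13, hτ']
          · exact (Frame.refl _ _).update (by simp)
      · rw [if_neg hc] at h26
        rw [if_neg hc] at hlook
        have hf' : Frame [13, 14, 24, 25, 26] s (Function.update s' 13 (Table.toVal τ)) :=
          hf.update (by simp)
        have he : (Expr.tl (.var 13)).eval s' = Table.toVal τ := by simp [h13, hτ']
        refine Runs.mono (Runs.ite_false (by simp [h26]) (Runs.assign ?_)) (t₁ := t + (N * (32 * κ + 40) + 1) + 1 + (1 + 2)) (by omega)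
        rw [he]
        refine ih (by simpa using hN) ?_ ?_ ?_ ?_ ?_ fun s'' h1 h2 => ?_
        · simp
        · rw [hf' 10 (by simp), hd]
        · rw [hf' 11 (by simp), hK]
        · rw [hf' 12 (by simp), hx]
        · simpa using h14
        · exact h s'' (by rw [h1, hlook]) (hf'.trans h2)
    have hmid : ∀ (s' : Store), s' 14 = .nil → s' 13 = s 13 → s' 24 = x.toVal →
        s' 25 = (if d then b else a).toVal →
        s' 26 = (if K = K' then .cons .nil .nil else .nil) →
        Frame [13, 14, 24, 25, 26] s s' →
        Runs O (eqProg ++ (Prog.ite (.var 26)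
      [.ite (.var 10) [.assign 14 (.cons (.hd (.tl (.hd (.var 13)))) .nil)]
        [.assign 14 (.cons (.tl (.tl (.hd (.var 13)))) .nil)],
        .assign 13 .nil]
      [.assign 13 (.tl (.var 13))] :: lookupLoop :: ks)) s' o
          (t + (N * (32 * κ + 40) + 1) + 14 + (16 * κ + 1)) D R := by
      intro s' h14 h13 h24 h25 h26 hf
      refine runs_eqProg h24 h25 fun s'' h1 h2 => hb s'' ?_ ?_ ?_ ?_
      · rw [h2 14 (by simp), h14]
      · rw [h2 13 (by simp), h13]
      · rw [h1, h26]
        by_cases hk : K = K' <;> simp [hk]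
      · exact hf.trans (h2.mono (by simp))
    unfold lookupLoop
    refine Runs.mono (Runs.while_true (by simp [hτ'])
      (Runs.mono (t₁ := t + (N * (32 * κ + 40) + 1) + 14 + (16 * κ + 1) + 1 + 3 + 1 + (16 * κ + 1) +
        1 + 1 + 1) ?_ le_rfl)) ?_
    · simp only [List.cons_append, List.nil_append, List.append_assoc]
      refine Runs.assign (Runs.assign (Runs.assign (runs_eqProg (a := K) (b := K') ?_ ?_
        fun s' h1 h2 => Runs.assign ?_)))
      · simp [hK]
      · simp [hτ']
      have h2' : Frame [13, 14, 24, 25, 26] s (Function.update s' 24 ((Expr.var 12).eval s')) :=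
        (Frame.trans (Frame.refl _ _ |>.update (by simp) |>.update (by simp) |>.update (by simp))
          (h2.mono (by simp))).update (by simp)
      have h13 : Function.update s' 24 ((Expr.var 12).eval s') 13 = s 13 := by
        rw [Function.update_of_ne (by simp), h2 13 (by simp)]; simp
      have h14 : Function.update s' 24 ((Expr.var 12).eval s') 14 = .nil := by
        rw [Function.update_of_ne (by simp), h2 14 (by simp)]; simpa using hn
      have h26 : Function.update s' 24 ((Expr.var 12).eval s') 26 =
          if K = K' then .cons .nil .nil else .nil := by
        rw [Function.update_of_ne (by simp), h1]; simp
      have h24 : Function.update s' 24 ((Expr.var 12).eval s') 24 = x.toVal := by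
        rw [Function.update_self, Expr.eval, h2 12 (by simp)]; simp [hx]
      have h10 : Function.update s' 24 ((Expr.var 12).eval s') 10 = Val.ofBool d := by
        rw [h2' 10 (by simp), hd]
      generalize Function.update s' 24 ((Expr.var 12).eval s') = u at *
      cases d with
      | true =>
        refine Runs.ite_true (by simp [h10, Val.ofBool]) (Runs.assign (hmid _ ?_ ?_ ?_ ?_ ?_ ?_))
        · simp [h14]
        · simp [h13]
        · simp [h24]
        · simp [h13, hτ']
        · simp [h26]
        · exact h2'.update (by simp)
      | false =>
        refine Runs.ite_false (by simp [h10, Val.ofBool]) (Runs.assign (hmid _ ?_ ?_ ?_ ?_ ?_ ?_))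
        · simp [h14]
        · simp [h13]
        · simp [h24]
        · simp [h13, hτ']
        · simp [h26]
        · exact h2'.update (by simp)
    · rw [Nat.add_mul, one_mul]
      simp only [eqProg, List.length_append, List.length_cons, List.length_nil]
      omega

theorem runs_cipherProg {τ : Table κ} {d : Bool} {K x : Block κ} {N : ℕ}
    {D : Block κ × Table κ → PMF α} (hN : τ.length ≤ N)
    (hκ : s 1 = Val.unary κ) (hτ : s 4 = τ.toVal) (hd : s 10 = Val.ofBool d) (hK : s 11 = K.toVal)
    (hx : s 12 = x.toVal)
    (h : ∀ r s', s' 8 = r.1.toVal → s' 4 = r.2.toVal → r.2.length ≤ τ.length + 1 →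
      Frame [4, 8, 9, 13, 14, 21, 22, 23, 24, 25, 26] s s' → Runs O ks s' o t (D r) R) :
    Runs O (cipherProg ++ ks) s o (t + (N * (32 * κ + 40) + 14 * κ + 40))
      ((τ.sample (d, K, x)).bind D) R := by
  unfold cipherProg
  simp only [List.cons_append, List.nil_append]
  refine Runs.mono (Runs.assign (Runs.assign (runs_lookupLoop (τ := τ) (d := d) (K := K) (x := x) hN ?_ ?_ ?_
    ?_ ?_ (t := t + (14 * κ + 30)) fun s' h1 h2 => ?_))) (by omega)
  · simp [hτ]
  · simp [hd]
  · simp [hK]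
  · simp [hx]
  · simp
  have hf : Frame [4, 8, 9, 13, 14, 21, 22, 23, 24, 25, 26] s s' :=
    (Frame.refl _ _ |>.update (by simp) |>.update (by simp)).trans (h2.mono (by simp))
  have h4 : s' 4 = τ.toVal := by rw [h2 4 (by simp)]; simp [hτ]
  unfold Table.sample
  cases hl : τ.lookup (d, K, x) with
  | some y =>
    rw [hl] at h1
    simp only [PMF.pure_bind]
    refine Runs.mono (Runs.ite_true (by simp [h1]) (Runs.assign (h _ _ ?_ ?_ ?_ ?_))) ?_
    · simp [h1]
    · simp [h4]
    · simp
    · exact hf.update (by simp)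
    · simp; omega
  | none =>
    rw [hl] at h1
    simp only [PMF.bind_map]
    refine Runs.mono (Runs.ite_false (by simp [h1]) ?_) (t₁ := t + 1 + (1 + 2) + 1 + (14 * κ + 5) + ((sampleProg ++ _).length + 2))
      (by simp only [sampleProg, revProg, List.length_append, List.length_cons, List.length_nil]; omega)
    simp only [List.append_assoc]
    refine runs_sampleProg (κ := κ) ?_ fun y s'' h5 h6 => ?_
    · rw [h2 1 (by simp)]; simp [hκ]
    have hf' := hf.trans (h6.mono (W' := [4, 8, 9, 13, 14, 21, 22, 23, 24, 25, 26]) (by simp))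
    have h4' : s'' 4 = τ.toVal := by rw [h6 4 (by simp), h4]
    have h10 := hf' 10 (by simp)
    have h11 := hf' 11 (by simp)
    have h12 := hf' 12 (by simp)
    simp only [List.cons_append, List.nil_append]
    cases d with
    | true =>
      refine Runs.assign (Runs.ite_true (by simp [h10, hd, Val.ofBool]) (t := t + 1)
        (Runs.assign (h _ _ ?_ ?_ ?_ ?_)))
      · simp [h5]
      · simp [h5, h11, h12, h4', hK, hx, Table.toVal, Table.entry, Val.ofList]
      · simp
      · exact (hf'.update (by simp)).update (by simp)
    | false =>
      refine Runs.assign (Runs.ite_false (by simp [h10, hd, Val.ofBool]) (t := t + 1)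
        (Runs.assign (h _ _ ?_ ?_ ?_ ?_)))
      · simp [h5]
      · simp [h5, h11, h12, h4', hK, hx, Table.toVal, Table.entry, Val.ofList]
      · simp
      · exact (hf'.update (by simp)).update (by simp)

end

end

noncomputable section

open scoped ENNReal

/-! ## The simulator -/

/-- The simulator for the ciphertext. -/
def simCtProg : List Prog :=
  [.assign 1 (.hd (.var 0)), .assign 2 (.tl (.var 0)), .assign 3 .nil,
    .whileDo (.var 2) (sampleProg ++ [.assign 3 (.cons (.var 21) (.var 3)), .assign 2 (.tl (.var 2))]),
    .assign 4 .nil] ++ (revProg 3 4 ++ [.assign 0 (.cons (.var 4) (.var 4))])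

/-- The loop of the simulator for trapdoors: the exclusive or of the blocks at the positions that
are not wildcards is accumulated in variable `18`, and these positions in variable `19`. -/
def simTdLoop : Prog :=
  .whileDo (.var 16) [
    .ite (.hd (.var 17)) [.assign 19 (.cons .nil (.var 19))]
      ([.assign 24 (.var 18), .assign 25 (.hd (.var 16))] ++ (xorProg ++
        [.assign 18 (.var 21), .assign 19 (.cons .one (.var 19))])),
    .assign 16 (.tl (.var 16)), .assign 17 (.tl (.var 17))]

/-- The simulator for trapdoors. -/
def simTdProg : List Prog :=
  [.assign 1 (.hd (.var 0)), .assign 15 (.hd (.tl (.tl (.var 0)))), .assign 16 (.var 15),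
    .assign 17 (.hd (.tl (.tl (.tl (.var 0))))), .assign 12 (.tl (.tl (.tl (.tl (.var 0))))),
    .assign 19 .nil] ++ (sampleProg ++ ([.assign 31 (.var 21), .assign 18 (.var 21), simTdLoop,
    .assign 32 .nil] ++ (revProg 19 32 ++ [.call 8 (.cons .nil (.cons (.var 18) (.var 12))),
    .assign 0 (.cons (.cons (.var 31) (.cons (.var 8) (.var 32))) (.var 15))])))

/-- The blocks at the positions that are not marked. -/
def unmarked {κ : ℕ} (cs : List (Block κ)) (ws : List Bool) : List (Block κ) :=
  ((cs.zip ws).filter fun p => !p.2).map Prod.fst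

/-- The exclusive or of the selected ciphertext blocks depends on the predicate vector only through
its wildcard positions, which are leaked. -/
theorem xorOver_nonWild_eq {κ n : ℕ} (v : PredVec n) (c : Fin n → Block κ) :
    Block.xorOver (nonWild v) c =
      Block.xorList (unmarked (List.ofFn c) (List.ofFn fun l => decide (l ∈ leakWild v))) := by
  unfold Block.xorOver Block.xorList unmarked
  rw [List.ofFn_eq_map, List.ofFn_eq_map]
  generalize List.finRange n = ls
  induction ls with
  | nil => rfl
  | cons l ls ih =>
    cases hv : v l with
    | none => simpa [List.filter_cons, nonWild, leakWild, hv] using ih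
    | some a => simpa [List.filter_cons, nonWild, leakWild, hv] using congrArg _ ih

/-! ### Output and running time of the simulator -/

section

variable {σ α : Type} {O : Oracle σ} {ks : List Prog} {s : Store} {o : σ} {t : ℕ}
  {D : PMF α} {R : α → Store → σ → Prop} {κ : ℕ}

theorem runs_simCtLoop {m : ℕ} {l : List (Block κ)} {D : List (Block κ) → PMF α}
    (hκ : s 1 = Val.unary κ) (hm : s 2 = Val.unary m)
    (hl : s 3 = Val.ofList (l.map Block.toVal))
    (h : ∀ (y : Fin m → Block κ) s',
      s' 3 = Val.ofList (((List.ofFn y).reverse ++ l).map Block.toVal) →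
      Runs O ks s' o t (D (List.ofFn y)) R) :
    Runs O (.whileDo (.var 2) (sampleProg ++ [.assign 3 (.cons (.var 21) (.var 3)),
      .assign 2 (.tl (.var 2))]) :: ks) s o (t + (m * (14 * κ + 30) + 1))
      ((PMF.uniformOfFintype (Fin m → Block κ)).bind fun y => D (List.ofFn y)) R := by
  induction m generalizing s l D with
  | zero =>
    have : ((PMF.uniformOfFintype (Fin 0 → Block κ)).bind fun y => D (List.ofFn y)) = D [] := by
      simp
    rw [this]
    exact Runs.mono (Runs.while_false (by simp [hm]) (by simpa using h default s (by simp [hl])))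
      (by omega)
  | succ m ih =>
    have : ((PMF.uniformOfFintype (Fin (m + 1) → Block κ)).bind fun y => D (List.ofFn y)) =
        (uniformBlock κ).bind fun b =>
          (PMF.uniformOfFintype (Fin m → Block κ)).bind fun y => D (b :: List.ofFn y) := by
      refine PMF.ext_ev fun f => ?_
      simp only [PMF.ev_bind]
      rw [PMF.ev_uniform_fin_succ]
      simp [List.ofFn_succ, uniformBlock]
    rw [this]
    refine Runs.mono (Runs.while_true (by simp [hm])
      (t := t + (m * (14 * κ + 30) + 1) + 1 + 1 + (14 * κ + 5)) ?_) ?_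
    · simp only [List.append_assoc]
      refine runs_sampleProg hκ fun b s' h1 h2 => Runs.assign (Runs.assign
        (ih (l := b :: l) (D := fun l => D (b :: l)) ?_ ?_ ?_ ?_))
      · simp [h2 1 (by simp), hκ]
      · simp [h2 2 (by simp), hm]
      · simp [h2 3 (by simp), hl, h1, Val.ofList]
      · intro y s'' h3
        have := h (Fin.cons b y) s'' ?_
        · simpa [List.ofFn_succ] using this
        · rw [h3]; simp [List.ofFn_succ]
    · simp only [sampleProg, revProg, List.length_append, List.length_cons, List.length_nil]
      rw [Nat.add_mul, one_mul]
      omega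

/-- The second copy of the ciphertext is the state of the simulator, from which later trapdoors
compute their keys. -/
theorem simCt_output (κ n : ℕ) (T : ℕ) (hT : 100 * (κ + n + 1) ^ 2 ≤ T) (O : Oracle σ) :
    (Prog.block simCtProg).output O o T (.cons (Val.unary κ) (Val.unary n)) =
      (PMF.uniformOfFintype (Fin n → Block κ)).map fun c =>
        .cons (ciphertextToVal c) (ciphertextToVal c) := by
  have hc : ∀ c : Fin n → Block κ, ciphertextToVal c = Val.ofList ((List.ofFn c).map Block.toVal) :=
    fun c => by simp [ciphertextToVal, List.map_ofFn, Function.comp_def]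
  have key : ∀ s : Store, s 0 = .cons (Val.unary κ) (Val.unary n) →
      Runs O (simCtProg ++ []) s o (n * (14 * κ + 30) + 6 * n + 20)
        ((PMF.uniformOfFintype (Fin n → Block κ)).map List.ofFn) fun c s' _ =>
          s' 0 = .cons (Val.ofList (c.map Block.toVal)) (Val.ofList (c.map Block.toVal)) := by
    intro s hs
    rw [← PMF.bind_pure_comp]
    unfold simCtProg
    simp only [List.cons_append, List.nil_append, List.append_assoc]
    refine Runs.mono (Runs.assign (Runs.assign (Runs.assign (runs_simCtLoop (κ := κ) (m := n) (l := [])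
      (D := PMF.pure) ?_ ?_ ?_ fun y s' h1 => Runs.assign (runs_revProg (by decide) (L := n) ?_
        (Runs.assign (Runs.nil ?_))))))) ?_
    · simp [hs]
    · simp [hs]
    · simp [Val.ofList]
    · simp [h1]
    · simp only [Expr.eval, List.append_nil, ne_eq, Nat.reduceEqDiff,
        not_false_eq_true, Function.update_of_ne, Function.update_self] at h1 ⊢
      rw [h1, show Val.nil = Val.ofList [] from rfl, Val.revAppend_ofList_ofList]
      simp
    · omega
  rw [Prog.output_eq_map (φ := fun c : List (Block κ) =>
    .cons (Val.ofList (c.map Block.toVal)) (Val.ofList (c.map Block.toVal)))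
    (Runs.block (key _ (by simp))), PMF.map_comp]
  · simp only [hc]; rfl
  · refine le_trans ?_ hT
    simp only [simCtProg, sampleProg, revProg, List.length_append, List.length_cons,
      List.length_nil]
    nlinarith

theorem runs_simTdLoop {cs : List (Block κ)} {ws r : List Bool} {a : Block κ}
    (hlen : cs.length = ws.length) {m : ℕ} (hm : cs.length = m)
    (h16 : s 16 = Val.ofList (cs.map Block.toVal)) (h17 : s 17 = Val.ofBits ws)
    (h18 : s 18 = a.toVal) (h19 : s 19 = Val.ofBits r)
    (h : ∀ s', s' 18 = ((Block.xorList (unmarked cs ws)).xor a).toVal →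
      s' 19 = Val.ofBits ((ws.map not).reverse ++ r) →
      Frame [16, 17, 18, 19, 21, 23, 24, 25] s s' → Runs O ks s' o t D R) :
    Runs O (simTdLoop :: ks) s o (t + (m * (22 * κ + 40) + 1)) D R := by
  induction cs generalizing s ws r a m with
  | nil =>
    obtain rfl : ws = [] := by simpa using hlen.symm
    exact Runs.mono (Runs.while_false (by simp [h16, Val.ofList])
      ((h s (by simp [h18, unmarked]) (by simp [h19]) (Frame.refl _ _)))) (by omega)
  | cons b cs ih =>
    obtain _ | ⟨w, ws⟩ := ws
    · simp at hlen
    obtain _ | m := m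
    · simp at hm
    simp only [List.length_cons, Nat.add_right_cancel_iff] at hlen hm
    have h16' : s 16 = .cons b.toVal (Val.ofList (cs.map Block.toVal)) := by
      rw [h16]; simp [Val.ofList]
    have key : ∀ s' : Store, s' 16 = s 16 → s' 17 = s 17 →
        s' 18 = (if w then a else b.xor a).toVal → s' 19 = Val.ofBits ((!w) :: r) →
        Frame [16, 17, 18, 19, 21, 23, 24, 25] s s' →
        Runs O (Prog.assign 16 (.tl (.var 16)) :: .assign 17 (.tl (.var 17)) :: simTdLoop :: ks)
          s' o (t + (m * (22 * κ + 40) + 1) + 1 + 1) D R := by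
      intro s' h1 h2 h3 h4 h5
      refine Runs.assign (Runs.assign (ih (ws := ws) (r := (!w) :: r)
        (a := if w then a else b.xor a) hlen hm ?_ ?_ ?_ ?_ ?_))
      · simp [h1, h16']
      · simp [h2, h17]
      · simp [h3]
      · simp [h4]
      · intro s'' h6 h7 h8
        refine h s'' ?_ ?_ (h5.trans ((Frame.refl _ _ |>.update (by simp) |>.update (by simp)).trans
          h8))
        · rw [h6]
          cases w
          · simp [unmarked, Block.xor_assoc, Block.xor_left_comm]
          · simp [unmarked]
        · rw [h7]; simp
    unfold simTdLoop
    refine Runs.mono (Runs.while_true (by simp [h16'])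
      (t := t + (m * (22 * κ + 40) + 1) + 1 + 1 + 1 + 1 + (22 * κ + 5) + 1 + 1 + 18) ?_) ?_
    · cases w with
      | true =>
        refine Runs.mono (Runs.ite_true (by simp [h17, Val.ofBool]) (Runs.assign (key _ ?_ ?_ ?_ ?_ ?_)))
          ?_
        · simp
        · simp
        · simp [h18]
        · simp [h19, Val.ofBool]
        · exact (Frame.refl _ _).update (by simp)
        · simp; omega
      | false =>
        refine Runs.mono (Runs.ite_false (by simp [h17, Val.ofBool])
          (t := t + (m * (22 * κ + 40) + 1) + 1 + 1 + 1 + 1 + (22 * κ + 5) + 1 + 1) ?_) ?_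
        · simp only [List.cons_append, List.nil_append, List.append_assoc]
          refine Runs.assign (Runs.assign (runs_xorProg (a := a) (b := b) ?_ ?_ fun s' h1 h2 =>
            Runs.assign (Runs.assign (key _ ?_ ?_ ?_ ?_ ?_))))
          · simp [h18]
          · simp [h16']
          · simp [h2 16 (by simp)]
          · simp [h2 17 (by simp)]
          · simp [h1, Block.xor_comm]
          · simp [h2 19 (by simp), h19, Val.ofBool]
          · exact ((Frame.refl _ _ |>.update (by simp) |>.update (by simp)).trans
              (h2.mono (by simp))).update (by simp) |>.update (by simp)
        · simp [xorProg, revProg]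
    · simp only [List.length_cons, List.length_nil]
      rw [Nat.add_mul, one_mul]
      omega

/-- The simulator need not know whether the predicate matches: it encrypts the leaked block in both
cases. The accumulator of the loop starts with `d`, so it ends with the cipher key itself. -/
theorem simTd_output {n : ℕ} (E : Cipher κ) (c : Fin n → Block κ) (v : PredVec n) (b : Block κ)
    (T : ℕ) (hT : 100 * (κ + n + 1) ^ 2 ≤ T) :
    (Prog.block simTdProg).output (cipherOracle E) () T
      (.cons (Val.unary κ) (.cons (Val.unary n)
        (.cons (ciphertextToVal c) (.cons (positionsToVal (leakWild v)) b.toVal)))) =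
      (uniformBlock κ).map fun d =>
        .cons (Trapdoor.toVal ⟨d, E ((Block.xorOver (nonWild v) c).xor d) b, nonWild v⟩)
          (ciphertextToVal c) := by
  have hc : ciphertextToVal c = Val.ofList ((List.ofFn c).map Block.toVal) := by
    simp [ciphertextToVal, List.map_ofFn, Function.comp_def]
  have key : ∀ s : Store, s 0 = (.cons (Val.unary κ) (.cons (Val.unary n)
        (.cons (ciphertextToVal c) (.cons (positionsToVal (leakWild v)) b.toVal)))) →
      Runs (cipherOracle E) (simTdProg ++ []) s ()
        (n * (22 * κ + 40) + 6 * n + 14 * κ + 40)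
        (uniformBlock κ) fun d s' _ =>
          s' 0 = .cons (Trapdoor.toVal ⟨d, E ((Block.xorOver (nonWild v) c).xor d) b, nonWild v⟩)
          (ciphertextToVal c) := by
    intro s hs
    rw [← PMF.bind_pure (uniformBlock κ)]
    unfold simTdProg
    simp only [List.cons_append, List.nil_append, List.append_assoc]
    refine Runs.mono (Runs.assign (Runs.assign (Runs.assign (Runs.assign (Runs.assign (Runs.assign
      (runs_sampleProg (κ := κ) ?_ fun d s' h1 h2 => Runs.assign (Runs.assign
      (runs_simTdLoop (κ := κ) (cs := List.ofFn c) (ws := List.ofFn fun l => decide (l ∈ leakWild v))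
        (r := []) (a := d) (m := n) (by simp) (by simp) ?_ ?_ ?_ ?_ fun s'' h3 h4 h5 =>
      Runs.assign (runs_revProg (by decide) (L := n) ?_
        (Runs.call_pure (r := ((E ((Block.xorOver (nonWild v) c).xor d) b).toVal, ())) ?_
          (Runs.assign (Runs.nil ?_))))))))))))) ?_
    · simp [hs]
    · simp [h2 16 (by simp), hs, hc]
    · simp [h2 17 (by simp), hs, positionsToVal]
    · simp [h1]
    · simp [h2 19 (by simp)]
    · simp [h4, Val.ofBits]
    · rw [← xorOver_nonWild_eq] at h3
      simp [cipherOracle, cipherAnswer, h3, h5 12 (by simp), h2 12 (by simp), hs]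
    · have h31 := h5 31 (by simp)
      have h15 := h5 15 (by simp)
      simp only [Expr.eval, List.append_nil, ne_eq, Nat.reduceEqDiff, 
        not_false_eq_true, Function.update_of_ne, Function.update_self, h2 15 (by simp)] at h1 h4 h15 h31 ⊢
      rw [h4, Val.ofBits, show Val.nil = Val.ofList [] from rfl, Val.revAppend_ofList_ofList]
      simp [h31, h15, h1, hs, Trapdoor.toVal, positionsToVal, Val.ofBits, nonWild, leakWild,
        Function.comp_def, List.map_ofFn]
    · omega
  rw [Prog.output_eq_map (Runs.block (key _ (by simp)))]
  refine le_trans ?_ hT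
  simp only [simTdProg, sampleProg, revProg, List.length_append, List.length_cons,
    List.length_nil]
  nlinarith

end

end

noncomputable section

open scoped ENNReal

/-! ## The experiments as games with a cipher -/

variable {κ : ℕ}

/-- The oracle of the adversary, by the kind of the query. -/
def gameReply (E : Cipher κ) (C : Challenger κ) : GameState → GameQuery → PMF (Val × GameState)
  | st, .cipher q => PMF.pure (cipherAnswer E q, st)
  | none, .challenge x =>
      (C.ciphertext (attrVecOfVal x)).map fun r => (r.1, some ⟨_, attrVecOfVal x, r.2⟩)
  | some ⟨n, x, z⟩, .trapdoor v m =>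
      (C.trapdoor x z (predVecOfVal n v) (Block.ofVal κ m)).map fun r => (r.1, some ⟨n, x, r.2⟩)
  | st, _ => PMF.pure (Val.nil, st)

theorem gameOracle_eq (E : Cipher κ) (C : Challenger κ) (st : GameState) (q : Val) :
    gameOracle E C st q = gameReply E C st q.parse := by
  rcases q with _ | ⟨_ | ⟨_ | ⟨_, _⟩, _⟩, _ | ⟨_, _⟩⟩ <;> rcases st with _ | ⟨n, x, z⟩ <;> rfl

/-- Access to a fixed function. -/
def constFun (f : List Bool → Block κ) : PointOracle κ Unit := fun _ p => PMF.pure (f p, ())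

theorem constFun_all (f : List Bool → Block κ) (ps : List (List Bool)) :
    (constFun f).all ps () = PMF.pure (ps.map f, ()) := by
  induction ps with
  | nil => rfl
  | cons p ps ih => simp [PointOracle.all, constFun] at ih ⊢; simp [ih, PMF.pure_map]

/-- The state of the real experiment that belongs to a state of the real game. -/
def realGameState (st : RealState Unit) : GameState := st.1.map fun a => ⟨a.1, a.2, Val.nil⟩

theorem gameOracle_real (F : KeyedFamily) (E : Cipher κ) (msk : Block κ) (st : RealState Unit)
    (q : Val) :
    gameOracle E (realChallenger F E msk) (realGameState st) q =
      ((realClient (constFun (F κ msk))).withCipher E st q).map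
        fun r => (r.1, realGameState r.2) := by
  rw [gameOracle_eq, Client.withCipher, realClient]
  obtain ⟨_ | ⟨n, x⟩, ⟨⟩⟩ := st <;> cases q.parse
  case none.challenge x =>
    simp [gameReply, realReply, realGameState, constFun_all, PMF.pure_map, realChallenger,
      Reply.withCipher, ctPoints, ciphertextToVal, List.map_ofFn, Function.comp_def,
      SHVEPlus.enc]
  case some.trapdoor v m =>
    simp [gameReply, realReply, realGameState, constFun_all, PMF.map_comp, realChallenger,
      Reply.withCipher, Function.comp_def, SHVEPlus.keyGen, xorList_tdPoints, Cipher.answer]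
  all_goals simp [gameReply, realReply, realGameState, PMF.pure_map, Reply.withCipher,
    cipherAnswer_eq]

/-- The master key is drawn before the cipher here, so that for each fixed key the ideal cipher can
be replaced by a lazily sampled one. -/
theorem realExp_eq (F : KeyedFamily) (A : PPT) (κ : ℕ) :
    realExp F A κ = ((uniformBlock κ).ev fun msk => (idealCipher κ).ev fun E =>
      (steps ((realClient (constFun (F κ msk))).withCipher E) (A.time.eval κ)
        (([A.prog], Function.update (fun _ => Val.nil) 0 (Val.unary κ)), (none, ()))).ev
        fun z => if (z.1.2 0).toBool then 1 else 0).toReal := by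
  rw [realExp, prOne_eq, PMF.ev_bind, PMF.ev_comm (uniformBlock κ)]
  simp only [PMF.ev_bind, SHVEPlus.setup]
  congr 3
  funext E
  congr 1
  funext msk
  rw [PPT.output, Prog.output, PMF.ev_map, show (none : GameState) = realGameState (none, ())
    from rfl, steps_map_state _ _ _ (gameOracle_real F E msk), PMF.ev_map]

/-- The simulator. -/
def simulator : Simulator where
  ciphertext := ⟨.block simCtProg, 100 * (Polynomial.X + 1) ^ 2⟩
  trapdoor := ⟨.block simTdProg, 100 * (Polynomial.X + 1) ^ 2⟩

/-- The state of the ideal experiment that belongs to a state of the simulated game. -/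
def simGameState (st : SimState κ) : GameState :=
  st.map fun a => ⟨a.1, a.2.1, ciphertextToVal a.2.2⟩

/-- Needed for trapdoors that do not match: the encryption of a fresh uniform block is uniform under
every key, and the cipher query can be dropped from the simulated game. -/
theorem cipher_uniform (p : Equiv.Perm (Block κ)) :
    (uniformBlock κ).map p = uniformBlock κ :=
  PMF.ext_ev fun f => by rw [PMF.ev_map, uniformBlock, PMF.ev_uniform_equiv p f]

/-- The equality is exact and holds for each fixed cipher. On a match both sides encrypt the message
under `X ⊕ d`. Otherwise the leaked block is independent of `d`, and `cipher_uniform` is applied for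
each value of `d`. -/
theorem gameOracle_sim (E : Cipher κ) (st : SimState κ) (q : Val) :
    gameOracle E (idealChallenger simulator E) (simGameState st) q =
      (simClient.withCipher E st q).map fun r => (r.1, simGameState r.2) := by
  rw [gameOracle_eq, Client.withCipher, simClient]
  have htime : ∀ n, 100 * (κ + n + 1) ^ 2 ≤
      (100 * (Polynomial.X + 1) ^ 2 : Polynomial ℕ).eval (κ + n) := fun n => by simp
  obtain _ | ⟨n, x, c⟩ := st <;> cases q.parse
  case none.challenge x =>
    simp only [gameReply, simReply, simGameState, Option.map_none, idealChallenger, PPT.output,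
      simulator]
    rw [simCt_output κ _ _ (htime _)]
    simp [PMF.map_comp, Function.comp_def, Reply.withCipher]
  case some.trapdoor v m =>
    simp only [gameReply, simReply, simGameState, Option.map_some, idealChallenger, PPT.output,
      simulator, leakQuery]
    simp only [simTd_output E c (predVecOfVal n v) _ _ (htime n)]
    by_cases hv : Matches (predVecOfVal n v) x
    · simp [hv, PMF.map_comp, Function.comp_def, Reply.withCipher, Cipher.answer]
    · simp only [hv, if_false]
      refine PMF.ext_ev fun f => ?_
      simp only [PMF.ev_map, PMF.ev_bind, Reply.withCipher]
      rw [PMF.ev_comm]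
      congr 1
      funext d
      conv_rhs => rw [← cipher_uniform (E ((Block.xorOver (nonWild (predVecOfVal n v)) c).xor d))]
      rw [PMF.ev_map]
      rfl
  all_goals simp [gameReply, simReply, simGameState, PMF.pure_map, Reply.withCipher,
    cipherAnswer_eq]

theorem idealExp_eq (A : PPT) (κ : ℕ) :
    idealExp simulator A κ = ((idealCipher κ).ev fun E =>
      (steps (simClient.withCipher E) (A.time.eval κ)
        (([A.prog], Function.update (fun _ => Val.nil) 0 (Val.unary κ)), none)).ev
        fun z => if (z.1.2 0).toBool then 1 else 0).toReal := by
  rw [idealExp, prOne_eq, PMF.ev_bind]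
  congr 3
  funext E
  rw [PPT.output, Prog.output, PMF.ev_map, show (none : GameState) = simGameState (κ := κ) none
    from rfl, steps_map_state _ _ _ (gameOracle_sim E), PMF.ev_map]

end

noncomputable section

open scoped ENNReal

/-! ## The real game as a program -/

namespace Val

/-- The height of a tree. -/
def depth : Val → ℕ
  | nil => 0
  | cons a b => max a.depth b.depth + 1

/-- Heights are what controls the running time. Repeated pairing of a tree with itself can make its
size exponential, but one assignment raises the height only by a constant that depends on the
expression, and the height bounds the length of every list to be traversed. -/
theorem length_toList_le (t : Val) : t.toList.length ≤ t.depth := by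
  induction t with
  | nil => simp
  | cons a t _ ih => simp only [toList_cons, List.length_cons, depth]; omega

theorem depth_le_of_mem {t a : Val} (h : a ∈ t.toList) : a.depth ≤ t.depth := by
  induction t with
  | nil => simp at h
  | cons b t _ ih =>
    rcases List.mem_cons.1 h with rfl | h
    · simp only [depth]; omega
    · have := ih h; simp only [depth]; omega

theorem depth_hd_le (t : Val) : t.hd.depth ≤ t.depth := by
  cases t <;> simp [hd, depth]; omega

theorem depth_tl_le (t : Val) : t.tl.depth ≤ t.depth := by
  cases t <;> simp [tl, depth]; omega

theorem depth_ofList_le {l : List Val} {B : ℕ} (h : ∀ a ∈ l, a.depth ≤ B) :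
    (ofList l).depth ≤ B + l.length := by
  induction l with
  | nil => simp [ofList, depth]
  | cons a l ih =>
    have := ih fun a ha => h a (by simp [ha])
    have := h a (by simp)
    simp only [ofList, depth, List.length_cons]; omega

theorem depth_ofBits_le (l : List Bool) : (ofBits l).depth ≤ 1 + l.length := by
  have := depth_ofList_le (l := l.map ofBool) (B := 1) (by
    intro a ha
    obtain ⟨b, _, rfl⟩ := List.mem_map.1 ha
    cases b <;> simp [ofBool, depth])
  rwa [List.length_map] at this

end Val

theorem Block.depth_toVal_le {κ : ℕ} (a : Block κ) : a.toVal.depth ≤ 1 + κ := by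
  refine (Val.depth_ofBits_le (List.ofFn a)).trans ?_
  rw [List.length_ofFn]

/-- The tagged attributes of a list, from position `i` on. -/
def ctPointsFrom (i : ℕ) : List Val → List (List Bool)
  | [] => []
  | a :: l => tag a.toBits i :: ctPointsFrom (i + 1) l

theorem length_ctPointsFrom (i : ℕ) (l : List Val) : (ctPointsFrom i l).length = l.length := by
  induction l generalizing i with
  | nil => rfl
  | cons a l ih => simp [ctPointsFrom, ih]

theorem getElem_ctPointsFrom (i : ℕ) (l : List Val) (j : ℕ) (h : j < (ctPointsFrom i l).length)
    (h' : j < l.length) : (ctPointsFrom i l)[j] = tag l[j].toBits (i + j) := by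
  induction l generalizing i j with
  | nil => simp at h'
  | cons a l ih =>
    cases j with
    | zero => rfl
    | succ j =>
      simp only [ctPointsFrom, List.getElem_cons_succ]
      rw [ih _ _ _ (by simpa using h')]
      congr 1; omega

theorem ctPoints_attrVecOfVal (x : Val) :
    ctPoints (attrVecOfVal x) = ctPointsFrom 0 x.toList := by
  apply List.ext_getElem
  · simp [ctPoints, length_ctPointsFrom, vecLength]
  · intro j h h'
    rw [getElem_ctPointsFrom _ _ _ _ (by simpa [length_ctPointsFrom] using h')]
    simp only [ctPoints, attrVecOfVal, tagged_eq_tag, List.getElem_ofFn, zero_add]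
    rfl

/-- The tagged attributes of the first `n` entries of a predicate vector, from position `i` on. -/
def tdPointsFrom (i : ℕ) : ℕ → Val → List (List Bool)
  | 0, _ => []
  | n + 1, v => match v.hd with
    | .nil => tdPointsFrom (i + 1) n v.tl
    | .cons _ a => tag a.toBits i :: tdPointsFrom (i + 1) n v.tl

/-- The indicator of the first `n` entries of a predicate vector that are not wildcards. -/
def tdMask : ℕ → Val → List Bool
  | 0, _ => []
  | n + 1, v => v.hd.toBool :: tdMask n v.tl

theorem length_tdMask (n : ℕ) (v : Val) : (tdMask n v).length = n := by
  induction n generalizing v with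
  | zero => rfl
  | succ n ih => simp [tdMask, ih]

theorem toList_getD_zero (v : Val) : v.toList.getD 0 .nil = v.hd := by cases v <;> simp

theorem toList_getD_succ (v : Val) (i : ℕ) :
    v.toList.getD (i + 1) .nil = v.tl.toList.getD i .nil := by cases v <;> simp

/-- Missing entries count as wildcards, and the head of `nil` is `nil`; the recursion can thus run
past the end of the list without a test. -/
theorem tdPoints_predVecOfVal (n : ℕ) (v : Val) :
    tdPoints (predVecOfVal n v) = tdPointsFrom 0 n v := by
  have key : ∀ i, ((List.finRange n).filterMap fun l : Fin n =>
      (predEntryOfVal (v.toList.getD l .nil)).map fun a => tag a (i + l)) = tdPointsFrom i n v := by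
    induction n generalizing v with
    | zero => intro i; simp [tdPointsFrom]
    | succ n ih =>
      intro i
      rw [List.finRange_succ, List.filterMap_cons, List.filterMap_map]
      have h1 : ((List.finRange n).filterMap ((fun l : Fin (n + 1) =>
          (predEntryOfVal (v.toList.getD l .nil)).map fun a => tag a (i + l)) ∘ Fin.succ)) =
          tdPointsFrom (i + 1) n v.tl := by
        rw [← ih]
        congr 1
        funext l
        simp only [Function.comp, Fin.val_succ, toList_getD_succ]
        congr 1
        funext a
        congr 1; omega
      rw [h1, tdPointsFrom, Fin.val_zero, toList_getD_zero]
      cases v.hd <;> simp [predEntryOfVal]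
  rw [← key 0]
  simp [tdPoints, predVecOfVal, tagged_eq_tag]

theorem ofFn_mem_nonWild (n : ℕ) (v : Val) :
    (List.ofFn fun l => decide (l ∈ nonWild (predVecOfVal n v))) = tdMask n v := by
  have key : (List.ofFn fun l : Fin n => decide (predEntryOfVal (v.toList.getD l .nil) ≠ none)) =
      tdMask n v := by
    induction n generalizing v with
    | zero => simp [tdMask]
    | succ n ih =>
      rw [List.ofFn_succ, tdMask, ← ih, Fin.val_zero, toList_getD_zero]
      simp only [Fin.val_succ, toList_getD_succ]
      congr 1
      cases v.hd <;> simp [predEntryOfVal, Val.toBool]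
  rw [← key]
  simp [nonWild, predVecOfVal]

/-- The loop that computes a ciphertext. -/
def ctLoop : Prog :=
  .whileDo (.var 33) (.assign 27 (.hd (.var 33)) :: (tagProg ++
    [.call 21 (.var 29), .assign 34 (.cons (.var 21) (.var 34)), .assign 33 (.tl (.var 33)),
      .assign 28 (.cons .one (.var 28))]))

/-- The answer to a challenge. -/
def challengeProg : List Prog :=
  [.assign 5 .one, .assign 6 (.tl (.var 7)), .assign 33 (.var 6), .assign 28 (.cons .one .nil),
    .assign 34 .nil, ctLoop, .assign 8 .nil] ++ revProg 34 8

/-- The loop that computes the mask of a trapdoor and the positions without wildcards. -/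
def tdLoop : Prog :=
  .whileDo (.var 33) [
    .ite (.hd (.var 35))
      (.assign 27 (.tl (.hd (.var 35))) :: (tagProg ++ .call 25 (.var 29) :: .assign 24 (.var 18) ::
        (xorProg ++ [.assign 18 (.var 21), .assign 19 (.cons .one (.var 19))])))
      [.assign 19 (.cons .nil (.var 19))],
    .assign 33 (.tl (.var 33)), .assign 35 (.tl (.var 35)), .assign 28 (.cons .one (.var 28))]

/-- The answer to a trapdoor query. -/
def trapdoorProg : List Prog :=
  .assign 33 (.var 6) :: .assign 35 (.hd (.tl (.var 7))) :: .assign 28 (.cons .one .nil) ::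
    .assign 19 .nil :: .assign 20 .nil :: (truncProg ++ .assign 18 (.var 21) :: tdLoop ::
    .assign 36 .nil :: (revProg 19 36 ++ .assign 20 (.tl (.tl (.var 7))) :: (truncProg ++
    .assign 12 (.var 21) :: (sampleProg ++ .assign 11 (.var 21) :: .assign 10 .nil ::
    .assign 24 (.var 18) :: .assign 25 (.var 21) :: (xorProg ++ .assign 37 (.var 21) ::
    (cipherProg ++ [.assign 8 (.cons (.var 37) (.cons (.var 8) (.var 36)))]))))))

/-- The answer to a cipher query. -/
def cipherQueryProg : List Prog :=
  .ite (.hd (.tl (.var 7))) [.assign 10 .one] [.assign 10 .nil] ::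
    .assign 20 (.hd (.tl (.tl (.var 7)))) :: (truncProg ++ .assign 11 (.var 21) ::
    .assign 20 (.tl (.tl (.tl (.var 7)))) :: (truncProg ++ .assign 12 (.var 21) :: cipherProg))

/-- The answer to the query in variable `7` is put into variable `8`. -/
def gameProg : List Prog :=
  [.assign 8 .nil,
    .ite (.var 7)
      [.ite (.hd (.var 7))
        [.ite (.hd (.hd (.var 7)))
          [.ite (.var 5) [.ite (.tl (.var 7)) trapdoorProg []] []]
          [.ite (.var 5) [] challengeProg]]
        cipherQueryProg]
      []]

/-! ### Correctness and running time of the program for the real game -/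

section

variable {σ α : Type} {O : Oracle σ} {ks : List Prog} {s : Store} {o : σ} {t : ℕ}
  {R : α → Store → σ → Prop} {κ : ℕ} {g : PointOracle κ σ}

theorem runs_ctLoop (hO : ∀ o q, O o q = (g o q.toBits).map fun r => (r.1.toVal, r.2))
    {xs : List Val} {i L : ℕ} {l : List (Block κ)} {D : List (Block κ) × σ → PMF α}
    (hL : ∀ a ∈ xs, a.depth ≤ L) {m : ℕ} (hm : xs.length = m)
    (h33 : s 33 = Val.ofList xs) (h28 : s 28 = Val.unary (i + 1))
    (h34 : s 34 = Val.ofList (l.map Block.toVal))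
    (h : ∀ bs o' s', bs.length = m → s' 34 = Val.ofList ((bs.reverse ++ l).map Block.toVal) →
      Frame [21, 27, 28, 29, 30, 33, 34] s s' → Runs O ks s' o' t (D (bs, o')) R) :
    Runs O (ctLoop :: ks) s o (t + (m * (12 * L + 20) + 1))
      ((g.all (ctPointsFrom i xs) o).bind D) R := by
  induction xs generalizing s o i l m D with
  | nil =>
    simp only [ctPointsFrom, PointOracle.all, PMF.pure_bind]
    exact Runs.mono (Runs.while_false (by simp [h33, Val.ofList])
      (h [] o s (by simpa using hm) (by simp [h34]) (Frame.refl _ _))) (by omega)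
  | cons a xs ih =>
    obtain _ | m := m
    · simp at hm
    simp only [List.length_cons, Nat.add_right_cancel_iff] at hm
    simp only [ctPointsFrom, PointOracle.all, PMF.bind_bind, PMF.bind_map, Function.comp_def]
    have h33' : s 33 = .cons a (Val.ofList xs) := h33
    unfold ctLoop
    refine Runs.mono (Runs.while_true (by simp [h33'])
      (t := t + (m * (12 * L + 20) + 1) + 1 + 1 + 1 + 1 + (12 * L + 4) + 1) ?_) ?_
    · simp only [List.cons_append, List.append_assoc, List.nil_append]
      refine Runs.assign (runs_tagProg (L := L) (i := i) ?_ ?_ fun s' h1 h2 =>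
        Runs.call (D' := g o (tag a.toBits i)) (φ := fun r => (r.1.toVal, r.2)) ?_ fun r =>
          Runs.assign (Runs.assign (Runs.assign
          (ih (l := r.1 :: l) (i := i + 1) (D := fun r' => D (r.1 :: r'.1, r'.2))
            (fun a ha => hL a (by simp [ha])) hm ?_ ?_ ?_ ?_))))
      · simp only [Expr.eval, Function.update_self, h33', Val.hd_cons]
        exact (Val.length_toList_le a).trans (hL a (by simp))
      · simp [h28]
      · rw [hO, Expr.eval, h1]; simp [h33']
      · simp [h2 33 (by simp), h33']
      · simp [h2 28 (by simp), h28]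
      · simp [h2 34 (by simp), h34, Val.ofList]
      · intro bs o' s'' h3 h4 h5
        refine h (r.1 :: bs) o' s'' (by simp [h3]) (by rw [h4]; simp) (Frame.trans ?_ h5)
        exact (((Frame.refl _ _).update (by simp)).trans (h2.mono (by simp))).update (by simp)
          |>.update (by simp) |>.update (by simp) |>.update (by simp)
    · simp only [tagProg, revProg, List.length_append, List.length_cons, List.length_nil]
      rw [Nat.add_mul, one_mul]
      omega

theorem runs_tdLoop (hO : ∀ o q, O o q = (g o q.toBits).map fun r => (r.1.toVal, r.2))
    {v w : Val} {i L n : ℕ} {a : Block κ} {r : List Bool} {D : List (Block κ) × σ → PMF α}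
    (hL : v.depth ≤ L) (hw : w.toList.length = n)
    (h33 : s 33 = w) (h35 : s 35 = v) (h28 : s 28 = Val.unary (i + 1)) (h18 : s 18 = a.toVal)
    (h19 : s 19 = Val.ofBits r)
    (h : ∀ bs o' s', s' 18 = ((Block.xorList bs).xor a).toVal →
      s' 19 = Val.ofBits ((tdMask n v).reverse ++ r) →
      Frame [18, 19, 21, 23, 24, 25, 27, 28, 29, 30, 33, 35] s s' →
      Runs O ks s' o' t (D (bs, o')) R) :
    Runs O (tdLoop :: ks) s o (t + (n * (12 * L + 22 * κ + 60) + 1))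
      ((g.all (tdPointsFrom i n v) o).bind D) R := by
  induction n generalizing s o i v w a r D with
  | zero =>
    obtain rfl : w = .nil := by cases w <;> simp_all
    simp only [tdPointsFrom, PointOracle.all, PMF.pure_bind]
    exact Runs.mono (Runs.while_false (by simp [h33])
      (h [] o s (by simp [h18]) (by simp [h19, tdMask]) (Frame.refl _ _))) (by omega)
  | succ n ih =>
    obtain _ | ⟨w₀, w⟩ := w
    · simp at hw
    simp only [Val.toList_cons, List.length_cons, Nat.add_right_cancel_iff] at hw
    have hL' : v.tl.depth ≤ L := (Val.depth_tl_le v).trans hL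
    have key : ∀ (s' : Store) (o : σ) (a : Block κ) (D : List (Block κ) × σ → PMF α),
        s' 33 = s 33 → s' 35 = s 35 → s' 28 = s 28 → s' 18 = a.toVal →
        s' 19 = Val.ofBits (v.hd.toBool :: r) →
        (∀ bs o' s', s' 18 = ((Block.xorList bs).xor a).toVal →
          s' 19 = Val.ofBits ((tdMask (n + 1) v).reverse ++ r) →
          Frame [18, 19, 21, 23, 24, 25, 27, 28, 29, 30, 33, 35] s s' →
          Runs O ks s' o' t (D (bs, o')) R) →
        Frame [18, 19, 21, 23, 24, 25, 27, 28, 29, 30, 33, 35] s s' →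
        Runs O (Prog.assign 33 (.tl (.var 33)) :: .assign 35 (.tl (.var 35)) ::
          .assign 28 (.cons .one (.var 28)) :: tdLoop :: ks)
          s' o (t + (n * (12 * L + 22 * κ + 60) + 1) + 1 + 1 + 1)
          ((g.all (tdPointsFrom (i + 1) n v.tl) o).bind D) R := by
      intro s' o a D h1 h2 h3 h4 h5 h6 h7
      refine Runs.assign (Runs.assign (Runs.assign (ih (v := v.tl) (w := w) (a := a)
        (r := v.hd.toBool :: r) hL' hw ?_ ?_ ?_ ?_ ?_ ?_)))
      · simp [h1, h33]
      · simp [h2, h35]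
      · simp [h3, h28]
      · simp [h4]
      · simp [h5]
      · intro bs o' s'' h8 h9 h10
        refine h6 bs o' s'' h8 ?_ (Frame.trans ?_ h10)
        · rw [h9, tdMask]; simp
        · exact h7.update (by simp) |>.update (by simp) |>.update (by simp)
    unfold tdLoop
    refine Runs.mono (Runs.while_true (by simp [h33])
      (t := t + (n * (12 * L + 22 * κ + 60) + 1) + 1 + 1 + 1 + 1 + 1 + (22 * κ + 5) + 1 + 1 +
        (12 * L + 4) + 1 + 20) ?_) ?_
    · cases hv : v.hd with
      | nil =>
        simp only [tdPointsFrom, hv]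
        refine Runs.mono (Runs.ite_false (by simp [h35, hv]) (Runs.assign
          (key _ o a D ?_ ?_ ?_ ?_ ?_ h ?_))) ?_
        · simp
        · simp
        · simp
        · simp [h18]
        · simp [h19, hv, Val.toBool, Val.ofBool]
        · exact (Frame.refl _ _).update (by simp)
        · simp; omega
      | cons e b =>
        simp only [tdPointsFrom, hv, PointOracle.all, PMF.bind_bind, PMF.bind_map,
          Function.comp_def]
        have hb : b.depth ≤ L := by
          have h1 := Val.depth_hd_le v
          have h2 := Val.depth_tl_le v.hd
          rw [hv] at h1 h2
          simp only [Val.tl_cons] at h2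
          omega
        refine Runs.mono (Runs.ite_true (by simp [h35, hv])
          (t := t + (n * (12 * L + 22 * κ + 60) + 1) + 1 + 1 + 1 + 1 + 1 + (22 * κ + 5) + 1 + 1 +
            (12 * L + 4) + 1) ?_) ?_
        · simp only [List.cons_append, List.append_assoc, List.nil_append]
          refine Runs.assign (runs_tagProg (L := L) (i := i) ?_ ?_ fun s' h1 h2 =>
            Runs.call (D' := g o (tag b.toBits i)) (φ := fun r => (r.1.toVal, r.2)) ?_ fun z =>
            Runs.assign (runs_xorProg (a := a) (b := z.1) ?_ ?_ fun s'' h3 h4 =>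
            Runs.assign (Runs.assign (key _ z.2 (z.1.xor a) (fun r' => D (z.1 :: r'.1, r'.2))
              ?_ ?_ ?_ ?_ ?_ ?_ ?_))))
          · simp only [Expr.eval, Function.update_self, h35, hv, Val.tl_cons]
            exact (Val.length_toList_le b).trans hb
          · simp [h28]
          · rw [hO, Expr.eval, h1]; simp [h35, hv]
          · simp [h2 18 (by simp), h18]
          · simp
          · simp [h4 33 (by simp), h2 33 (by simp)]
          · simp [h4 35 (by simp), h2 35 (by simp)]
          · simp [h4 28 (by simp), h2 28 (by simp)]
          · simp [h3, Block.xor_comm]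
          · simp [h4 19 (by simp), h2 19 (by simp), h19, hv, Val.toBool, Val.ofBool]
          · intro bs o' s₃ h5 h6 h7
            refine h (z.1 :: bs) o' s₃ ?_ h6 h7
            rw [h5]; simp [Block.xor_assoc, Block.xor_left_comm]
          · refine Frame.update (by simp) (Frame.update (by simp) (Frame.trans ?_ (h4.mono (by simp))))
            exact (((Frame.refl _ _).update (by simp)).trans (h2.mono (by simp))).update (by simp)
              |>.update (by simp)
        · simp [xorProg, tagProg, revProg]
    · simp only [List.length_cons, List.length_nil]
      rw [Nat.add_mul, one_mul]
      omega

/-- The variables in the store represent a state of the real game and a table of the cipher. -/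
structure GameRep (κ : ℕ) (st : RealState σ) (τ : Table κ) (s : Store) : Prop where
  param : s 1 = Val.unary κ
  table : s 4 = τ.toVal
  none : st.1 = none → s 5 = .nil
  some : ∀ a, st.1 = some a → s 5 ≠ .nil ∧ (s 6).toList.length = a.1

theorem runs_challengeProg (hO : ∀ o q, O o q = (g o q.toBits).map fun r => (r.1.toVal, r.2))
    {L : ℕ} {D : List (Block κ) × σ → PMF α} (hL : (s 7).depth ≤ L)
    (h : ∀ bs o' s', bs.length = vecLength (s 7).tl →
      s' 8 = Val.ofList (bs.map Block.toVal) → s' 5 ≠ .nil → s' 6 = (s 7).tl →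
      Frame [5, 6, 8, 21, 27, 28, 29, 30, 33, 34] s s' → Runs O ks s' o' t (D (bs, o')) R) :
    Runs O (challengeProg ++ ks) s o (t + (L * (12 * L + 20) + 6 * L + 20))
      ((g.all (ctPoints (attrVecOfVal (s 7).tl)) o).bind D) R := by
  have hx : (s 7).tl.depth ≤ L := (Val.depth_tl_le _).trans hL
  have hn : (s 7).tl.toList.length ≤ L := (Val.length_toList_le _).trans hx
  rw [ctPoints_attrVecOfVal]
  unfold challengeProg
  simp only [List.cons_append, List.nil_append]
  refine Runs.mono (Runs.assign (Runs.assign (Runs.assign (Runs.assign (Runs.assign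
    (runs_ctLoop hO (L := L) (i := 0) (xs := (s 7).tl.toList) (l := [])
      (fun a ha => (Val.depth_le_of_mem ha).trans hx) rfl ?_ ?_ ?_ fun bs o' s' h1 h2 h3 =>
    Runs.assign (runs_revProg (by decide) (L := L) ?_ (h bs o' _ h1 ?_ ?_ ?_ ?_)))))))) ?_
  · simp [Val.ofList_toList]
  · simp
  · simp [Val.ofList]
  · simpa [h2, h1] using hn
  · simp only [Expr.eval, List.append_nil, ne_eq, Nat.reduceEqDiff,
      not_false_eq_true, Function.update_of_ne, Function.update_self] at h2 ⊢
    rw [h2, show Val.nil = Val.ofList [] from rfl, Val.revAppend_ofList_ofList]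
    simp
  · simp [h3 5 (by simp)]
  · simp [h3 6 (by simp)]
  · refine Frame.update (by simp) (Frame.update (by simp) (Frame.update (by simp)
      (Frame.trans ?_ (h3.mono (by simp)))))
    exact Frame.refl _ _ |>.update (by simp) |>.update (by simp) |>.update (by simp)
      |>.update (by simp) |>.update (by simp)
  · have := Nat.mul_le_mul_right (12 * L + 20) hn
    omega

theorem runs_cipherQueryProg {τ : Table κ} {N : ℕ} {D : Block κ × Table κ → PMF α}
    (hN : τ.length ≤ N) (hκ : s 1 = Val.unary κ) (hτ : s 4 = τ.toVal)
    (h : ∀ r s', s' 8 = r.1.toVal → s' 4 = r.2.toVal → r.2.length ≤ τ.length + 1 →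
      Frame [4, 8, 9, 10, 11, 12, 13, 14, 20, 21, 22, 23, 24, 25, 26] s s' →
      Runs O ks s' o t (D r) R) :
    Runs O (cipherQueryProg ++ ks) s o (t + (N * (32 * κ + 40) + 50 * κ + 70))
      ((τ.sample (cipherQueryOfVal κ (s 7).tl)).bind D) R := by
  have key : ∀ s' : Store, s' 10 = Val.ofBool (decide ((s 7).tl.hd ≠ Val.nil)) → Frame [10] s s' →
      Runs O (Prog.assign 20 (.hd (.tl (.tl (.var 7)))) :: (truncProg ++ .assign 11 (.var 21) ::
        .assign 20 (.tl (.tl (.tl (.var 7)))) :: (truncProg ++ .assign 12 (.var 21) ::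
        (cipherProg ++ ks)))) s' o (t + (N * (32 * κ + 40) + 14 * κ + 40) + 1 + (18 * κ + 5) + 1 + 1 +
        (18 * κ + 5) + 1) ((τ.sample (cipherQueryOfVal κ (s 7).tl)).bind D) R := by
    intro s' h10 hf
    have hs7 : s' 7 = s 7 := hf 7 (by simp)
    refine Runs.assign (runs_truncProg (κ := κ) ?_ fun s₁ h1 h2 => Runs.assign (Runs.assign
      (runs_truncProg (κ := κ) ?_ fun s₂ h3 h4 => Runs.assign
      (runs_cipherProg hN ?_ ?_ ?_ ?_ ?_ fun r s₃ h5 h6 h7 h8 => h r s₃ h5 h6 h7 ?_))))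
    · simp [hf 1 (by simp), hκ]
    · simp [h2 1 (by simp), hf 1 (by simp), hκ]
    · simp [h4 1 (by simp), h2 1 (by simp), hf 1 (by simp), hκ]
    · simp [h4 4 (by simp), h2 4 (by simp), hf 4 (by simp), hτ]
    · simp [h4 10 (by simp), h2 10 (by simp), h10]
    · simp [h4 11 (by simp), h1, hs7]
    · simp [h3, h2 7 (by simp), hs7]
    · refine Frame.trans (Frame.update (by simp) (Frame.trans (Frame.update (by simp)
        (Frame.update (by simp) (Frame.trans (Frame.update (by simp) (hf.mono (by simp)))
          (h2.mono (by simp))))) (h4.mono (by simp)))) (h8.mono (by simp))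
  unfold cipherQueryProg
  simp only [List.cons_append, List.append_assoc]
  refine Runs.mono (Runs.ite (fun hd => Runs.assign (key _ ?_ ?_))
    (fun hd => Runs.assign (key _ ?_ ?_))) ?_
  · simp only [Expr.eval] at hd
    simp [hd, Val.ofBool]
  · exact (Frame.refl _ _).update (by simp)
  · simp only [Expr.eval] at hd
    simp [hd, Val.ofBool]
  · exact (Frame.refl _ _).update (by simp)
  · simp only [List.length_cons, List.length_nil]
    omega

theorem runs_trapdoorProg (hO : ∀ o q, O o q = (g o q.toBits).map fun r => (r.1.toVal, r.2))
    {τ : Table κ} {L N n : ℕ} {D : (Block κ × Block κ × Table κ) × σ → PMF α}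
    (hL : (s 7).depth ≤ L) (hn : n ≤ L) (hN : τ.length ≤ N) (hκ : s 1 = Val.unary κ)
    (hτ : s 4 = τ.toVal) (h6 : (s 6).toList.length = n)
    (h : ∀ d y τ' o' s', s' 8 = Trapdoor.toVal ⟨d, y, nonWild (predVecOfVal n (s 7).tl.hd)⟩ →
      s' 4 = Table.toVal τ' → τ'.length ≤ τ.length + 1 →
      Frame [4, 8, 9, 10, 11, 12, 13, 14, 18, 19, 20, 21, 22, 23, 24, 25, 26, 27, 28, 29, 30, 33, 35,
        36, 37] s s' → Runs O ks s' o' t (D ((d, y, τ'), o')) R) :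
    Runs O (trapdoorProg ++ ks) s o
      (t + (L * (12 * L + 22 * κ + 60) + N * (32 * κ + 40) + 6 * L + 100 * κ + 100))
      ((g.all (tdPoints (predVecOfVal n (s 7).tl.hd)) o).bind fun r => (uniformBlock κ).bind fun K =>
        (τ.sample (false, K, Block.ofVal κ (s 7).tl.tl)).bind fun y =>
          D (((Block.xorList r.1).xor K, y), r.2)) R := by
  have hv : (s 7).tl.hd.depth ≤ L := (Val.depth_hd_le _).trans ((Val.depth_tl_le _).trans hL)
  rw [tdPoints_predVecOfVal]
  unfold trapdoorProg
  simp only [List.cons_append, List.append_assoc, List.nil_append]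
  refine Runs.mono (Runs.assign (Runs.assign (Runs.assign (Runs.assign (Runs.assign
    (runs_truncProg (κ := κ) ?_ fun s₁ h1 f1 => Runs.assign
    (runs_tdLoop hO (n := n) (i := 0) (v := (s 7).tl.hd) (w := s 6) (a := Block.zero κ) (r := [])
      (D := fun r => (uniformBlock κ).bind fun K =>
        (τ.sample (false, K, Block.ofVal κ (s 7).tl.tl)).bind fun y =>
          D (((Block.xorList r.1).xor K, y), r.2))
      hv h6 ?_ ?_ ?_ ?_ ?_ fun bs o' s₂ h2 h3 f2 => Runs.assign
    (runs_revProg (by decide) (L := L) ?_ (Runs.assign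
    (runs_truncProg (κ := κ) ?_ fun s₃ h4 f3 => Runs.assign
    (runs_sampleProg (κ := κ) ?_ fun K s₄ h5 f4 => Runs.assign (Runs.assign (Runs.assign (Runs.assign
    (runs_xorProg (a := Block.xorList bs) (b := K) ?_ ?_ fun s₅ h7 f5 => Runs.assign
    (runs_cipherProg hN (d := false) (K := K) (x := Block.ofVal κ (s 7).tl.tl)
      ?_ ?_ ?_ ?_ ?_ fun r s₆ h8 h9 h10 f6 => Runs.assign
      (h _ _ _ _ _ ?_ ?_ h10 ?_))))))))))))))))) ?_
  · simp [hκ]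
  · simp [f1 33 (by simp)]
  · simp [f1 35 (by simp)]
  · simp [f1 28 (by simp)]
  · simp only [Function.update_self, Expr.eval, h1]
    congr 1
  · simp [f1 19 (by simp)]
  · simpa [h3, Val.ofBits, length_tdMask] using hn
  · simp [f2 1 (by simp), f1 1 (by simp), hκ]
  · simp [f3 1 (by simp), f2 1 (by simp), f1 1 (by simp), hκ]
  · simp [f4 18 (by simp), f3 18 (by simp), h2, Block.xor_comm _ (Block.zero κ)]
  · simp [h5]
  · simp [f5 1 (by simp), f4 1 (by simp), f3 1 (by simp), f2 1 (by simp), f1 1 (by simp), hκ]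
  · simp [f5 4 (by simp), f4 4 (by simp), f3 4 (by simp), f2 4 (by simp), f1 4 (by simp), hτ]
  · simp [f5 10 (by simp), Val.ofBool]
  · simp [f5 11 (by simp), h5]
  · simp [f5 12 (by simp), f4 12 (by simp), h4, f2 7 (by simp), f1 7 (by simp)]
  · have h36 : s₃ 36 = positionsToVal (nonWild (predVecOfVal n (s 7).tl.hd)) := by
      rw [f3 36 (by simp)]
      simp only [Expr.eval, List.append_nil, ne_eq, Nat.reduceEqDiff,
        not_false_eq_true, Function.update_of_ne, Function.update_self] at h3 ⊢
      rw [h3, Val.ofBits, show Val.nil = Val.ofList [] from rfl, Val.revAppend_ofList_ofList,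
        positionsToVal, ofFn_mem_nonWild]
      simp [Val.ofBits]
    simp [Trapdoor.toVal, h8, f6 37 (by simp), h7, f6 36 (by simp), f5 36 (by simp),
      f4 36 (by simp), h36]
  · simp [h9]
  · refine Frame.update (by simp) (Frame.trans (Frame.update (by simp) (Frame.trans
      (Frame.update (by simp) (Frame.update (by simp) (Frame.update (by simp)
      (Frame.update (by simp) (Frame.trans (Frame.update (by simp) (Frame.trans
      (Frame.update (by simp) (Frame.update (by simp) (Frame.update (by simp)
      (Frame.update (by simp) (Frame.trans (Frame.update (by simp) (Frame.trans
      (Frame.update (by simp) (Frame.update (by simp) (Frame.update (by simp)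
      (Frame.update (by simp) (Frame.update (by simp) (Frame.refl _ _))))))
      (f1.mono (by simp)))) (f2.mono (by simp))))))) (f3.mono (by simp)))) (f4.mono (by simp)))))))
      (f5.mono (by simp)))) (f6.mono (by simp)))
  · have := Nat.mul_le_mul_right (12 * L + 22 * κ + 60) hn
    omega

/-- A bound for the running time of the answer to a query, for trees of height at most `L` and
tables of length at most `N`. -/
def gameTime (κ L N : ℕ) : ℕ :=
  L * (12 * L + 22 * κ + 60) + N * (32 * κ + 40) + 6 * L + 100 * κ + 400

/-- Besides the correct distribution of answer and state, the continuation receives what the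
simulation of further steps needs: the table has grown by at most one entry, the answer is at most
`κ + 4` higher than the bound `L`, and the clock in variable `2` and the variables of the adversary
are untouched. -/
theorem runs_gameProg (hO : ∀ o q, O o q = (g o q.toBits).map fun r => (r.1.toVal, r.2))
    {st : RealState σ} {τ : Table κ} {L N : ℕ} {D : Val × (RealState σ × Table κ) → PMF α}
    (hL : (s 7).depth ≤ L) (hN : τ.length ≤ N) (hs : GameRep κ st τ s)
    (hn : ∀ a, st.1 = some a → a.1 ≤ L)
    (h : ∀ (r : Val × (RealState σ × Table κ)) s', s' 8 = r.1 → GameRep κ r.2.1 r.2.2 s' →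
      (∀ a, r.2.1.1 = some a → a.1 ≤ L) → r.2.2.length ≤ τ.length + 1 →
      r.1.depth ≤ κ + L + 4 → s' 2 = s 2 → (∀ i, 38 ≤ i → s' i = s i) →
      Runs O ks s' r.2.1.2 t (D r) R) :
    Runs O (gameProg ++ ks) s st.2 (t + gameTime κ L N)
      (((realClient g).withTable (st, τ) (s 7)).bind D) R := by
  -- Entering a branch costs its number of commands; this is absorbed by the additive constant of
  -- `gameTime`.
  have hlen : trapdoorProg.length + challengeProg.length + cipherQueryProg.length ≤ 100 := by
    decide
  obtain ⟨hκ, hτ, hnone, hsome⟩ := hs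
  have h8 : ∀ i, i ≠ 8 → Function.update s 8 .nil i = s i :=
    fun i hi => Function.update_of_ne hi _ _
  -- The common end of all queries that are malformed or come at the wrong time: the answer is the
  -- `nil` put into variable `8` at the beginning.
  have hdef : (realClient g) st (s 7) = PMF.pure (.done (.nil, st)) →
      Runs O ks (Function.update s 8 .nil) st.2 t
        (((realClient g).withTable (st, τ) (s 7)).bind D) R := by
    intro hr
    simp only [Client.withTable, hr, PMF.pure_bind, Reply.withTable]
    refine h (.nil, (st, τ)) _ (by simp) ⟨by simp [hκ], by simp [hτ], fun hst => ?_, fun a ha => ?_⟩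
      hn (by simp) (by simp [Val.depth]) (by simp) fun i hi => h8 i (by omega)
    · simp [hnone hst]
    · simpa using hsome a ha
  unfold gameProg
  simp only [List.cons_append, List.nil_append]
  -- The subtraction is not truncated, since `gameTime` is at least `400`.
  refine Runs.mono (t₁ := t + (gameTime κ L N - 10) + 1) (Runs.assign ?_)
    (by unfold gameTime; omega)
  have hR : (realClient g).withTable (st, τ) (s 7) =
      (realReply g st (s 7).parse).bind (Reply.withTable τ) := rfl
  cases hq : s 7 with
  | nil =>
    rw [← hq]
    refine Runs.mono (Runs.ite_false (by simp [hq]) (hdef ?_)) ?_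
    · simp [realClient, hq, Val.parse, realReply]
    · simp only [gameTime, List.length_nil]; omega
  | cons a b =>
  rw [← hq]
  cases a with
  | nil =>
    rw [hR, hq]
    simp only [Val.parse, realReply, PMF.pure_bind, Reply.withTable, PMF.bind_map, Function.comp_def]
    refine Runs.mono (Runs.ite_true (by simp [hq]) (Runs.ite_false (by simp [hq])
      (t := t + (N * (32 * κ + 40) + 50 * κ + 70)) ?_)) ?_
    · have := runs_cipherQueryProg (O := O) (ks := ks) (s := Function.update s 8 .nil) (o := st.2)
        (t := t) (R := R) (κ := κ) (D := fun y => D (y.1.toVal, st, y.2)) (τ := τ) hN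
        (by simp [hκ]) (by simp [hτ]) fun r s' h1 h2 h3 h4 => ?_
      · simpa [hq] using this
      · refine h (r.1.toVal, st, r.2) s' h1 ⟨?_, h2, fun hst => ?_, fun a ha => ?_⟩ hn h3 ?_ ?_ ?_
        · simp [h4 1 (by simp), hκ]
        · simp [h4 5 (by simp), hnone hst]
        · simpa [h4 5 (by simp), h4 6 (by simp)] using hsome a ha
        · have := r.1.depth_toVal_le
          simp only; omega
        · simp [h4 2 (by simp)]
        · intro i hi
          rw [h4 i (by simp; omega), h8 i (by omega)]
    · unfold gameTime
      simp only [List.length_cons, List.length_nil]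
      omega
  | cons a₁ a₂ =>
  cases a₁ with
  | nil =>
    cases hst : st.1 with
    | some x =>
      have h5 := (hsome x hst).1
      refine Runs.mono (Runs.ite_true (by simp [hq]) (Runs.ite_true (by simp [hq])
        (Runs.ite_false (by simp [hq]) (Runs.ite_true (by simpa using h5) (hdef ?_))))) ?_
      · obtain ⟨_, _⟩ := st
        simp only at hst
        subst hst
        simp [realClient, hq, Val.parse, realReply]
      · simp only [gameTime, List.length_cons, List.length_nil]; omega
    | none =>
      have h5 := hnone hst
      obtain ⟨_, o⟩ := st
      simp only at hst
      subst hst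
      rw [hR, hq]
      simp only [Val.parse, realReply, Reply.withTable, PMF.bind_map, Function.comp_def]
      refine Runs.mono (Runs.ite_true (by simp [hq]) (Runs.ite_true (by simp [hq])
        (Runs.ite_false (by simp [hq]) (Runs.ite_false (by simpa using h5)
        (t := t + (L * (12 * L + 20) + 6 * L + 20)) ?_)))) ?_
      · have := runs_challengeProg (O := O) (ks := ks) (s := Function.update s 8 .nil) (o := o)
          (t := t) (R := R) (κ := κ)
          (D := fun r => D (Val.ofList (r.1.map Block.toVal), (some ⟨_, attrVecOfVal b⟩, r.2), τ))
          hO (L := L) (by simpa using hL) fun bs o' s' h1 h2 h3 h4 h6 => ?_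
        · have h7 : (Function.update s 8 Val.nil 7).tl = b := by simp [hq]
          rw [h7] at this
          simp only [PMF.bind_bind, PMF.pure_bind]
          exact this
        · have hx : b.toList.length ≤ L := by
            have h7 := Val.length_toList_le b
            have h9 := Val.depth_tl_le (s 7)
            rw [hq] at h9 hL
            simp only [Val.tl_cons] at h9
            omega
          refine h (_, (some ⟨_, attrVecOfVal b⟩, o'), τ) s' h2
            ⟨?_, ?_, by simp, fun a ha => ?_⟩ ?_ (by simp) ?_ ?_ ?_
          · simp [h6 1 (by simp), hκ]
          · simp [h6 4 (by simp), hτ]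
          · simp only [Option.some.injEq] at ha
            subst ha
            refine ⟨h3, ?_⟩
            rw [h4]
            simp [hq, vecLength]
          · intro a ha
            simp only [Option.some.injEq] at ha
            subst ha
            exact hx
          · have h7 : bs.length = b.toList.length := by
              rw [h1]; simp [hq, vecLength]
            have := Val.depth_ofList_le (l := bs.map Block.toVal) (B := 1 + κ) (by
              intro a ha
              obtain ⟨c, _, rfl⟩ := List.mem_map.1 ha
              exact c.depth_toVal_le)
            rw [List.length_map] at this
            simp only; omega
          · simp [h6 2 (by simp)]
          · intro i hi
            rw [h6 i (by simp; omega), h8 i (by omega)]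
      · have : L * (12 * L + 20) ≤ L * (12 * L + 22 * κ + 60) := Nat.mul_le_mul_left _ (by omega)
        unfold gameTime
        simp only [List.length_cons, List.length_nil]
        omega
  | cons a₃ a₄ =>
    cases hst : st.1 with
    | none =>
      have h5 := hnone hst
      refine Runs.mono (Runs.ite_true (by simp [hq]) (Runs.ite_true (by simp [hq])
        (Runs.ite_true (by simp [hq]) (Runs.ite_false (by simpa using h5) (hdef ?_))))) ?_
      · obtain ⟨_, _⟩ := st
        simp only at hst
        subst hst
        cases b <;> simp [realClient, hq, Val.parse, realReply]
      · simp only [gameTime, List.length_cons, List.length_nil]; omega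
    | some x =>
      obtain ⟨h5, h6⟩ := hsome x hst
      have hxL := hn x hst
      cases b with
      | nil =>
        refine Runs.mono (Runs.ite_true (by simp [hq]) (Runs.ite_true (by simp [hq])
          (Runs.ite_true (by simp [hq]) (Runs.ite_true (by simpa using h5)
          (Runs.ite_false (by simp [hq]) (hdef ?_)))))) ?_
        · simp [realClient, hq, Val.parse, realReply]
        · simp only [gameTime, List.length_cons, List.length_nil]; omega
      | cons v m =>
        obtain ⟨_, o⟩ := st
        obtain ⟨n, x⟩ := x
        simp only at hst
        subst hst
        rw [hR, hq]
        simp only [Val.parse, realReply, Reply.withTable, PMF.bind_map, Function.comp_def,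
          PMF.bind_bind]
        refine Runs.mono (Runs.ite_true (by simp [hq]) (Runs.ite_true (by simp [hq])
          (Runs.ite_true (by simp [hq]) (Runs.ite_true (by simpa using h5)
          (Runs.ite_true (by simp [hq])
          (t := t + (L * (12 * L + 22 * κ + 60) + N * (32 * κ + 40) + 6 * L + 100 * κ + 100))
          ?_))))) ?_
        · have := runs_trapdoorProg (O := O) (ks := ks) (s := Function.update s 8 .nil) (o := o)
            (t := t) (R := R) (κ := κ)
            (D := fun r => D (Trapdoor.toVal ⟨r.1.1, r.1.2.1, nonWild (predVecOfVal n v)⟩,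
              (some ⟨n, x⟩, r.2), r.1.2.2))
            hO (L := L) (n := n) (by simpa using hL) hxL hN (by simp [hκ]) (by simp [hτ])
            (by simpa using h6) fun d y τ' o' s' h1 h2 h3 h4 => ?_
          · simpa [hq] using this
          · refine h (_, (some ⟨n, x⟩, o'), τ') s' ?_
              ⟨?_, h2, by simp, fun a ha => ?_⟩ hn h3 ?_ ?_ ?_
            · rw [h1]; simp [hq]
            · simp [h4 1 (by simp), hκ]
            · simp only [Option.some.injEq] at ha
              subst ha
              simpa [h4 5 (by simp), h4 6 (by simp)] using ⟨h5, h6⟩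
            · have h7 := d.depth_toVal_le
              have h9 := y.depth_toVal_le
              have h10 := Val.depth_ofBits_le
                (List.ofFn fun l => decide (l ∈ nonWild (predVecOfVal n v)))
              rw [List.length_ofFn] at h10
              simp only [Trapdoor.toVal, positionsToVal, Val.depth]
              simp only at hxL
              omega
            · simp [h4 2 (by simp)]
            · intro i hi
              rw [h4 i (by simp; omega), h8 i (by omega)]
        · unfold gameTime
          simp only [List.length_cons, List.length_nil]
          omega

end

end

noncomputable section

open scoped ENNReal

/-! ## Running an adversary for a bounded time -/

namespace Expr

/-- The expression with all variables renumbered by `40`. -/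
def shift : Expr → Expr
  | .var i => .var (i + 40)
  | .nil => .nil
  | .cons a b => .cons a.shift b.shift
  | .hd a => .hd a.shift
  | .tl a => .tl a.shift

def size : Expr → ℕ
  | .var _ => 0
  | .nil => 0
  | .cons a b => a.size + b.size + 1
  | .hd a => a.size
  | .tl a => a.size

theorem eval_shift (e : Expr) {s sA : Store} (h : ∀ i, s (i + 40) = sA i) :
    e.shift.eval s = e.eval sA := by
  induction e <;> simp_all [shift]

/-- Only pairing raises the height, by at most one each time, so `size` counts nothing else. -/
theorem depth_eval_le (e : Expr) {s : Store} {d : ℕ} (h : ∀ i, (s i).depth ≤ d) :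
    (e.eval s).depth ≤ d + e.size := by
  induction e with
  | var i => exact h i
  | nil => simp [Val.depth]
  | cons a b iha ihb => simp only [eval, Val.depth, size]; omega
  | hd a ih => exact (Val.depth_hd_le _).trans ih
  | tl a ih => exact (Val.depth_tl_le _).trans ih

end Expr

namespace Prog

/-- Runs `cs` if the clock in variable `2` is positive, and decreases the clock. -/
def tick (cs : List Prog) : Prog := .ite (.var 2) (.assign 2 (.tl (.var 2)) :: cs) []

/-- The commands that run a program of an adversary in the real game while the clock in variable
`2` is positive. The adversary's variables are renumbered by `40`. -/
def clocked : Prog → List Prog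
  | .assign i e => [tick [.assign (i + 40) e.shift]]
  | .flip i => [tick [.flip (i + 40)]]
  | .call i e => [tick (.assign 7 e.shift :: (gameProg ++ [.assign (i + 40) (.var 8)]))]
  | .seq c d => tick [] :: (c.clocked ++ d.clocked)
  | .cond e c d => [tick [.ite e.shift c.clocked d.clocked]]
  | .loop e c => [.assign 3 (.var 2),
      .whileDo (.var 3) [.assign 2 (.tl (.var 2)),
        .ite e.shift (c.clocked ++ [.assign 3 (.var 2)]) [.assign 3 .nil]]]

/-- A measure of the size of a program. -/
def weight : Prog → ℕ
  | .assign _ e => e.size + 2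
  | .flip _ => 2
  | .call _ e => e.size + 2
  | .seq c d => c.weight + d.weight + 2
  | .cond e c d => e.size + c.weight + d.weight + 2
  | .loop e c => e.size + c.weight + 2

theorem length_clocked_le (c : Prog) : c.clocked.length ≤ c.weight := by
  induction c <;> (simp [clocked, weight]; try omega)

end Prog

theorem steps_halted {σ : Type} (O : Oracle σ) (T : ℕ) (s : Store) (o : σ) :
    steps O T (([], s), o) = PMF.pure (([], s), o) := by
  induction T with
  | zero => rfl
  | succ T ih => rw [steps, step, PMF.pure_bind, ih]

/-! ### The clocked run simulates the given number of steps exactly -/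

section

variable {σ α : Type} {O : Oracle σ} {ks : List Prog} {s : Store} {o : σ} {t : ℕ}
  {R : α → Store → σ → Prop} {κ : ℕ} {g : PointOracle κ σ}

theorem GameRep.congr {st : RealState σ} {τ : Table κ} {s' : Store} (h : GameRep κ st τ s)
    (h1 : s' 1 = s 1) (h4 : s' 4 = s 4) (h5 : s' 5 = s 5) (h6 : s' 6 = s 6) :
    GameRep κ st τ s' :=
  ⟨h1.trans h.param, h4.trans h.table, fun hs => h5.trans (h.none hs), fun a ha => by
    rw [h5, h6]; exact h.some a ha⟩

theorem Runs.tick_true {cs : List Prog} {D : PMF α} {T : ℕ} (hs : s 2 = Val.unary (T + 1))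
    (h : Runs O (cs ++ ks) (Function.update s 2 (Val.unary T)) o t D R) :
    Runs O (.tick cs :: ks) s o (t + (cs.length + 4)) D R := by
  refine Runs.mono (Runs.ite_true (by simp [hs]) (Runs.assign (t := t) ?_)) ?_
  · simpa [hs] using h
  · simp only [List.length_cons]; omega

theorem Runs.tick_false {cs : List Prog} {D : PMF α} (hs : s 2 = .nil) (h : Runs O ks s o t D R) :
    Runs O (.tick cs :: ks) s o (t + 2) D R :=
  Runs.ite_false (by simp [hs]) h

/-- When the clock has run out, nothing happens any more. -/
theorem runs_clocked_of_nil {c : Prog} {D : PMF α} (hs : s 2 = .nil)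
    (h : ∀ s', s' 2 = .nil → (∀ i, s' (i + 40) = s (i + 40)) → Runs O ks s' o t D R) :
    Runs O (c.clocked ++ ks) s o (t + c.weight) D R := by
  induction c generalizing s t ks with
  | assign i e =>
    exact Runs.mono (Runs.tick_false hs (h s hs fun _ => rfl)) (by simp only [Prog.weight]; omega)
  | flip i =>
    exact Runs.mono (Runs.tick_false hs (h s hs fun _ => rfl)) (by simp only [Prog.weight]; omega)
  | call i e =>
    exact Runs.mono (Runs.tick_false hs (h s hs fun _ => rfl)) (by simp only [Prog.weight]; omega)
  | cond e c d =>
    exact Runs.mono (Runs.tick_false hs (h s hs fun _ => rfl)) (by simp only [Prog.weight]; omega)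
  | loop e c =>
    refine Runs.mono (Runs.assign (Runs.while_false (by simp [hs]) (h _ ?_ fun i => ?_)))
      (by simp only [Prog.weight]; omega)
    · simp [hs]
    · rw [Function.update_of_ne (by omega)]
  | seq c d ihc ihd =>
    simp only [Prog.clocked, List.cons_append, List.append_assoc]
    refine Runs.mono (Runs.tick_false hs (ihc hs fun s' h1 h2 => ihd h1 fun s'' h3 h4 =>
      h s'' h3 fun i => (h4 i).trans (h2 i))) (by simp only [Prog.weight]; omega)

theorem runs_clocked_list_of_nil {k : List Prog} {D : PMF α} (hs : s 2 = .nil)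
    (h : ∀ s', (∀ i, s' (i + 40) = s (i + 40)) → Runs O ks s' o t D R) :
    Runs O (k.flatMap Prog.clocked ++ ks) s o (t + (k.map Prog.weight).sum) D R := by
  induction k generalizing s with
  | nil => exact h s fun _ => rfl
  | cons c k ih =>
    simp only [List.flatMap_cons, List.append_assoc, List.map_cons, List.sum_cons]
    refine Runs.mono (runs_clocked_of_nil hs fun s' h1 h2 => ih h1 fun s'' h3 =>
      h s'' fun i => (h3 i).trans (h2 i)) (by omega)

/-- The store `s` represents a state of the real game with an adversary that has the store `sA`,
with `T` steps left. -/
structure RunRep (κ : ℕ) (sA : Store) (st : RealState σ) (τ : Table κ) (T d N : ℕ)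
    (s : Store) : Prop where
  game : GameRep κ st τ s
  vars : ∀ i, s (i + 40) = sA i
  depth : ∀ i, (sA i).depth ≤ d
  vec : ∀ a, st.1 = some a → a.1 ≤ d
  len : τ.length + T ≤ N
  clock : s 2 = Val.unary T

namespace RunRep

variable {sA : Store} {st : RealState σ} {τ : Table κ} {T d d' N : ℕ}

theorem tick (h : RunRep κ sA st τ (T + 1) d N s) :
    RunRep κ sA st τ T d N (Function.update s 2 (Val.unary T)) where
  game := h.game.congr (by simp) (by simp) (by simp) (by simp)
  vars i := by rw [Function.update_of_ne (by omega), h.vars]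
  depth := h.depth
  vec := h.vec
  len := by have := h.len; omega
  clock := by simp

theorem mono (h : RunRep κ sA st τ T d N s) (hd : d ≤ d') : RunRep κ sA st τ T d' N s :=
  ⟨h.game, h.vars, fun i => (h.depth i).trans hd, fun a ha => (h.vec a ha).trans hd, h.len, h.clock⟩

theorem flag (h : RunRep κ sA st τ T d N s) (v : Val) :
    RunRep κ sA st τ T d N (Function.update s 3 v) where
  game := h.game.congr (by simp) (by simp) (by simp) (by simp)
  vars i := by rw [Function.update_of_ne (by omega), h.vars]
  depth := h.depth
  vec := h.vec
  len := h.len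
  clock := by simp [h.clock]

theorem assign (h : RunRep κ sA st τ T d N s) (i : ℕ) {v : Val} (hd : d ≤ d')
    (hv : v.depth ≤ d') :
    RunRep κ (Function.update sA i v) st τ T d' N (Function.update s (i + 40) v) where
  game := h.game.congr (by simp) (by simp) (by simp) (by simp)
  vars j := by
    by_cases hj : j = i
    · subst hj; simp
    · simp [hj, h.vars]
  depth j := by
    by_cases hj : j = i
    · subst hj; simpa using hv
    · simpa [hj] using (h.depth j).trans hd
  vec a ha := (h.vec a ha).trans hd
  len := h.len
  clock := by simp [h.clock]

end RunRep

theorem gameTime_mono {L L' N N' : ℕ} (hL : L ≤ L') (hN : N ≤ N') :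
    gameTime κ L N ≤ gameTime κ L' N' := by
  unfold gameTime; gcongr

/-- A bound for the running time of one step. -/
def stepTime (κ w d N : ℕ) : ℕ := gameTime κ d N + 3 * w + 40

/-- The machine is stopped after exactly `T` steps, so the clock has to follow its step semantics
command by command. The running time is estimated by a potential: every remaining step pays
`stepTime`, and every pending command pays its weight, the cost of passing over it once the clock
has run out. The sum of the length of the table and the remaining time stays below `N`, and the
heights stay below `dmax`. -/
theorem runs_clocked (hO : ∀ o q, O o q = (g o q.toBits).map fun r => (r.1.toVal, r.2))
    {w N dmax : ℕ} {D : Config × (RealState σ × Table κ) → PMF α}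
    (h : ∀ z s', (∀ i, s' (i + 40) = z.1.2 i) → Runs O ks s' z.2.1.2 t (D z) R)
    {T d : ℕ} {k : List Prog} {sA : Store} {st : RealState σ} {τ : Table κ}
    (hs : RunRep κ sA st τ T d N s) (hk : ∀ c ∈ k, c.weight ≤ w)
    (hd : d + T * (w + κ + 4) ≤ dmax) :
    Runs O (k.flatMap Prog.clocked ++ ks) s st.2
      (t + (T * stepTime κ w dmax N + (k.map Prog.weight).sum))
      ((steps (realClient g).withTable T ((k, sA), (st, τ))).bind D) R := by
  induction T generalizing d k sA st τ s with
  | zero =>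
    simp only [steps, PMF.pure_bind]
    refine Runs.mono (runs_clocked_list_of_nil (by simp [hs.clock]) fun s' h' =>
      h ((k, sA), (st, τ)) s' fun i => (h' i).trans (hs.vars i)) (by omega)
  | succ T ih =>
    rw [Nat.succ_mul] at hd
    rw [Nat.succ_mul]
    rcases k with _ | ⟨c, k⟩
    · rw [steps_halted, PMF.pure_bind]
      exact Runs.mono (h (([], sA), (st, τ)) s hs.vars) (by omega)
    have hc : c.weight ≤ w := hk c (by simp)
    have hk' : ∀ c ∈ k, c.weight ≤ w := fun c hc => hk c (by simp [hc])
    rw [steps, PMF.bind_bind]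
    simp only [List.flatMap_cons, List.append_assoc, List.map_cons, List.sum_cons]
    generalize hB : stepTime κ w dmax N = B at ih ⊢
    -- The term `3 * w` pays for unfolding blocks, whose length is bounded by the weight, and for
    -- the loop body that a step of a loop adds to the pending commands.
    have hBw : 3 * w + 40 ≤ B := by rw [← hB, stepTime]; omega
    -- A step raises heights by at most `w + κ + 4`: an expression contributes at most its size,
    -- which is below `w`, and an oracle answer at most `κ + 4` more.
    have ih' := fun {k : List Prog} {sA st τ s} (hs : RunRep κ sA st τ T (d + (w + κ + 4)) N s)
      (hk : ∀ c ∈ k, c.weight ≤ w) => ih hs hk (by omega)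
    cases c with
    | assign i e =>
      simp only [Prog.weight] at hc ⊢
      simp only [step, PMF.pure_bind, Prog.clocked, List.cons_append, List.nil_append]
      refine Runs.mono (Runs.tick_true hs.clock (Runs.assign (ih' ?_ hk'))) ?_
      · rw [Expr.eval_shift e hs.tick.vars]
        exact hs.tick.assign i (by omega) ((Expr.depth_eval_le e hs.depth).trans (by omega))
      · simp only [List.length_cons, List.length_nil]; omega
    | flip i =>
      simp only [Prog.weight] at hc ⊢
      simp only [step, PMF.bind_map, Function.comp_def, Prog.clocked, List.cons_append,
        List.nil_append]
      refine Runs.mono (Runs.tick_true hs.clock (Runs.flip fun b => ih' ?_ hk')) ?_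
      · exact hs.tick.assign i (by omega) (by cases b <;> simp [Val.ofBool, Val.depth]; omega)
      · simp only [List.length_cons, List.length_nil]; omega
    | call i e =>
      simp only [Prog.weight] at hc ⊢
      simp only [step, PMF.bind_map, Function.comp_def, Prog.clocked, List.cons_append,
        List.nil_append]
      have he := Expr.depth_eval_le e hs.depth
      have hL : d + e.size ≤ dmax := by omega
      have hN : τ.length ≤ N := by have := hs.len; omega
      refine Runs.mono (Runs.tick_true hs.clock (Runs.assign ?_))
        -- The summand `8` is the cost of the tick: its four commands and four steps of its own.
        (t₁ := t + (T * B + (k.map Prog.weight).sum) + 1 + gameTime κ (d + e.size) N + 1 + 8) ?_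
      · rw [Expr.eval_shift e hs.tick.vars]
        have h7 : Function.update (Function.update s 2 (Val.unary T)) 7 (e.eval sA) 7 = e.eval sA :=
          Function.update_self ..
        have := runs_gameProg (O := O) (g := g) (st := st) (τ := τ) (L := d + e.size) (N := N)
          (s := Function.update (Function.update s 2 (Val.unary T)) 7 (e.eval sA))
          (ks := .assign (i + 40) (.var 8) :: (k.flatMap Prog.clocked ++ ks)) (R := R)
          (t := t + (T * B + (k.map Prog.weight).sum) + 1)
          (D := fun r => (steps (realClient g).withTable T
            ((k, Function.update sA i r.1), r.2)).bind D)
          hO (by rwa [h7]) hN (hs.tick.game.congr (by simp) (by simp) (by simp) (by simp))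
          (fun a ha => (hs.vec a ha).trans (by omega)) fun r s' h8 hg hn hlen hr h2 hf => ?_
        · rw [h7] at this
          exact this
        · obtain ⟨v, st', τ'⟩ := r
          refine Runs.assign (ih' ?_ hk')
          simp only [Expr.eval, h8]
          refine RunRep.assign (d := d + e.size) ⟨hg, fun j => ?_, fun j => ?_, hn, ?_, ?_⟩ i
            (by omega) (by simp only at hr; omega)
          · rw [hf _ (by omega), Function.update_of_ne (by omega)]
            exact hs.tick.vars j
          · exact (hs.depth j).trans (by omega)
          · have := hs.len
            have : τ'.length ≤ τ.length + 1 := hlen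
            omega
          · rw [h2]; simp
      · have := gameTime_mono (κ := κ) hL (le_refl N)
        rw [stepTime] at hB
        omega
    | seq c c' =>
      simp only [Prog.weight] at hc ⊢
      simp only [step, PMF.pure_bind, Prog.clocked, List.cons_append, List.append_assoc]
      have := ih' (k := c :: c' :: k) (hs.tick.mono (by omega)) (by
        intro a ha
        rcases List.mem_cons.1 ha with rfl | ha
        · omega
        rcases List.mem_cons.1 ha with rfl | ha
        · omega
        · exact hk' a ha)
      simp only [List.flatMap_cons, List.append_assoc, List.map_cons, List.sum_cons] at this
      refine Runs.mono (Runs.tick_true hs.clock this) ?_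
      simp only [List.length_nil]; omega
    | cond e c c' =>
      simp only [Prog.weight] at hc ⊢
      simp only [step, PMF.pure_bind, Prog.clocked, List.cons_append, List.nil_append]
      have hl := c.length_clocked_le
      have hl' := c'.length_clocked_le
      have key : ∀ a : Prog, a.weight ≤ w → _ := fun a ha => ih' (k := a :: k) (hs.tick.mono
        (by omega : d ≤ d + (w + κ + 4))) (by
        intro b hb
        rcases List.mem_cons.1 hb with rfl | hb
        · exact ha
        · exact hk' b hb)
      simp only [List.flatMap_cons, List.append_assoc, List.map_cons, List.sum_cons] at key
      refine Runs.mono (Runs.tick_true hs.clock (Runs.ite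
        (t₁ := t + (T * B + (c.weight + (k.map Prog.weight).sum)))
        (t₂ := t + (T * B + (c'.weight + (k.map Prog.weight).sum))) (fun he => ?_) fun he => ?_)) ?_
      · rw [Expr.eval_shift e hs.tick.vars] at he
        rw [if_pos he]
        exact key c (by omega)
      · rw [Expr.eval_shift e hs.tick.vars] at he
        rw [if_neg (by simpa using he)]
        exact key c' (by omega)
      · simp only [List.length_cons, List.length_nil]; omega
    | loop e c =>
      have hcl := hc
      simp only [Prog.weight] at hc ⊢
      simp only [step, PMF.pure_bind, Prog.clocked, List.cons_append, List.nil_append]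
      have hl := c.length_clocked_le
      have hs' := (hs.flag (s 2)).tick
      refine Runs.mono (Runs.assign (Runs.while_true (by simp [hs.clock]) (Runs.assign
        (Runs.ite (t₁ := t + (T * B + (c.weight + (e.size + c.weight + 2 +
          (k.map Prog.weight).sum)))) (t₂ := t + (T * B + (k.map Prog.weight).sum) + 1 + 1)
          (fun he => ?_) fun he => ?_)))) ?_
      all_goals try
        have h2 : (Expr.tl (.var 2)).eval (Function.update s 3 ((Expr.var 2).eval s)) =
          Val.unary T := by simp [hs.clock]
        rw [h2, Expr.eval, Expr.eval_shift e hs'.vars] at he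
        rw [h2, Expr.eval]
      · rw [if_pos he]
        -- The assignment to the flag in variable `3` at the end of the loop body, followed by the
        -- loop, is literally the clocked form of `.loop e c`. What is pending therefore has the
        -- shape required by the induction hypothesis.
        have := ih' (k := c :: .loop e c :: k) (hs'.mono (by omega)) (by
          intro a ha
          rcases List.mem_cons.1 ha with rfl | ha
          · omega
          rcases List.mem_cons.1 ha with rfl | ha
          · exact hcl
          · exact hk' a ha)
        simp only [List.flatMap_cons, List.append_assoc, List.map_cons, List.sum_cons,
          Prog.weight] at this
        simpa [Prog.clocked] using this
      · rw [if_neg (by simpa using he)]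
        refine Runs.assign (Runs.while_false (by simp) (ih' ((hs'.flag _).mono (by omega)) hk'))
      · simp only [List.length_cons, List.length_nil, List.length_append]
        omega

end

end

noncomputable section

open scoped ENNReal

/-! ## Polynomials in unary -/

/-- Adds the number in variable `11` to the number in variable `2`. -/
def addLoop : Prog := .whileDo (.var 11) [.assign 2 (.cons .one (.var 2)), .assign 11 (.tl (.var 11))]

/-- Adds the product of the numbers in variables `10` and `1` to the number in variable `2`. -/
def mulLoop : Prog := .whileDo (.var 10) [.assign 11 (.var 1), addLoop, .assign 10 (.tl (.var 10))]

section

variable {σ α : Type} {O : Oracle σ} {ks : List Prog} {s : Store} {o : σ} {t : ℕ}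
  {D : PMF α} {R : α → Store → σ → Prop} {κ : ℕ}

theorem runs_addLoop {m n : ℕ} (h11 : s 11 = Val.unary m) (h2 : s 2 = Val.unary n)
    (h : ∀ s', s' 2 = Val.unary (n + m) → Frame [2, 11] s s' → Runs O ks s' o t D R) :
    Runs O (addLoop :: ks) s o (t + (6 * m + 1)) D R := by
  induction m generalizing s n with
  | zero => exact Runs.while_false (by simp [h11]) (h s h2 (Frame.refl _ _))
  | succ m ih =>
    refine Runs.mono (Runs.while_true (by simp [h11]) (Runs.assign (Runs.assign
      (ih (n := n + 1) ?_ ?_ fun s' h3 h4 => h s' ?_ ?_)))) ?_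
    · simp [h11]
    · simp [h2]
    · rw [h3]; congr 1; omega
    · exact (((Frame.refl _ _).update (by simp)).update (by simp)).trans h4
    · simp only [List.length_cons, List.length_nil]; omega

theorem runs_mulLoop {m n : ℕ} (h1 : s 1 = Val.unary κ) (h10 : s 10 = Val.unary m)
    (h2 : s 2 = Val.unary n)
    (h : ∀ s', s' 2 = Val.unary (n + m * κ) → Frame [2, 10, 11] s s' → Runs O ks s' o t D R) :
    Runs O (mulLoop :: ks) s o (t + (m * (6 * κ + 8) + 1)) D R := by
  induction m generalizing s n with
  | zero => exact Runs.mono (Runs.while_false (by simp [h10]) (h s (by simpa using h2)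
      (Frame.refl _ _))) (by omega)
  | succ m ih =>
    refine Runs.mono (Runs.while_true (by simp [h10]) (Runs.assign
      (runs_addLoop (m := κ) (n := n) ?_ ?_ fun s' h3 h4 => Runs.assign
      (ih (n := n + κ) ?_ ?_ ?_ fun s'' h5 h6 => h s'' ?_ ?_)))) ?_
    · simp [h1]
    · simp [h2]
    · simp [h4 1 (by simp), h1]
    · simp [h4 10 (by simp), h10]
    · simp [h3]
    · rw [h5, Nat.succ_mul]; congr 1; omega
    · exact ((((Frame.refl _ _).update (by simp)).trans (h4.mono (by simp))).update
        (by simp)).trans h6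
    · rw [Nat.succ_mul m]
      simp only [List.length_cons, List.length_nil]; omega

theorem runs_increment {a n : ℕ} (h2 : s 2 = Val.unary n)
    (h : ∀ s', s' 2 = Val.unary (n + a) → Frame [2] s s' → Runs O ks s' o t D R) :
    Runs O (List.replicate a (.assign 2 (.cons .one (.var 2))) ++ ks) s o (t + a) D R := by
  induction a generalizing s n with
  | zero => exact h s h2 (Frame.refl _ _)
  | succ a ih =>
    rw [List.replicate_succ, List.cons_append]
    refine Runs.mono (Runs.assign (ih (n := n + 1) (by simp [h2]) fun s' h3 h4 => h s' ?_ ?_))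
      (by omega)
    · rw [h3]; congr 1; omega
    · exact ((Frame.refl _ _).update (by simp)).trans h4

end

/-- The commands `P` put the value of the polynomial `p` at the number in variable `1` into
variable `2`, in a time that is bounded by the polynomial `q`. -/
def Computes (P : List Prog) (p q : Polynomial ℕ) : Prop :=
  ∀ {σ α : Type} {O : Oracle σ} {ks : List Prog} {s : Store} {o : σ} {t : ℕ}
    {D : PMF α} {R : α → Store → σ → Prop} {κ : ℕ}, s 1 = Val.unary κ →
    (∀ s', s' 2 = Val.unary (p.eval κ) → Frame [2, 10, 11] s s' → Runs O ks s' o t D R) →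
    Runs O (P ++ ks) s o (t + q.eval κ) D R

/-- Horner's scheme: a constant is added by that many increments, and a multiplication by the
variable is a nested loop over the value obtained so far and `κ`. The recursion for `q` adds up the
costs of these loops. The result initialises the clock of the distinguisher. -/
theorem exists_computes (p : Polynomial ℕ) : ∃ P q, Computes P p q := by
  refine p.recOnHorner ?_ (fun p a _ _ ⟨P, q, ih⟩ => ?_) fun p _ ⟨P, q, ih⟩ => ?_
  · refine ⟨[.assign 2 .nil], 1, fun {_ _ _ _ s _ _ _ _ κ} _ h => ?_⟩
    simp only [Polynomial.eval_one]
    exact Runs.assign (h _ (by simp) ((Frame.refl _ _).update (by simp)))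
  · refine ⟨P ++ List.replicate a (.assign 2 (.cons .one (.var 2))), q + Polynomial.C a,
      fun {_ _ _ _ s _ _ _ _ κ} h1 h => ?_⟩
    rw [List.append_assoc]
    refine Runs.mono (ih h1 fun s' h3 h4 => runs_increment h3 fun s'' h5 h6 => h s'' ?_ ?_) ?_
    · rw [h5]; simp
    · exact h4.trans (h6.mono (by simp))
    · simp only [Polynomial.eval_add, Polynomial.eval_C]; omega
  · refine ⟨P ++ [.assign 10 (.var 2), .assign 2 .nil, mulLoop],
      q + p * (6 * Polynomial.X + 8) + 3, fun {_ _ _ _ s _ _ _ _ κ} h1 h => ?_⟩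
    rw [List.append_assoc]
    refine Runs.mono (ih h1 fun s' h3 h4 => Runs.assign (Runs.assign
      (runs_mulLoop (m := p.eval κ) (n := 0) (κ := κ) ?_ ?_ ?_ fun s'' h5 h6 => h s'' ?_ ?_))) ?_
    · simp [h4 1 (by simp), h1]
    · simp [h3]
    · simp
    · rw [h5]; simp
    · exact ((h4.update (by simp)).update (by simp)).trans (h6.mono (by simp))
    · simp only [Polynomial.eval_add, Polynomial.eval_mul, Polynomial.eval_X,
        Polynomial.eval_ofNat]
      omega

end

noncomputable section

open scoped ENNReal

/-! ## The distinguisher -/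

/-- The polynomial `gameTime`. -/
def gameTimePoly (L N : Polynomial ℕ) : Polynomial ℕ :=
  L * (12 * L + 22 * Polynomial.X + 60) + N * (32 * Polynomial.X + 40) + 6 * L +
    100 * Polynomial.X + 400

theorem eval_gameTimePoly (L N : Polynomial ℕ) (κ : ℕ) :
    (gameTimePoly L N).eval κ = gameTime κ (L.eval κ) (N.eval κ) := by
  simp [gameTimePoly, gameTime]

/-- For each adversary there is a machine that runs it in the real game, with a function in place of
the pseudorandom function and a lazily sampled cipher. -/
theorem exists_distinguisher (A : PPT) : ∃ B : PPT, ∀ {σ : Type} (κ : ℕ) (g : PointOracle κ σ)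
    (O : Oracle σ), (∀ o q, O o q = (g o q.toBits).map fun r => (r.1.toVal, r.2)) → ∀ o : σ,
    B.output O o κ (Val.unary κ) =
      (steps (realClient g).withTable (A.time.eval κ)
        (([A.prog], Function.update (fun _ => Val.nil) 0 (Val.unary κ)), ((none, o), []))).map
        fun z => z.1.2 0 := by
  obtain ⟨P, q, hP⟩ := exists_computes A.time
  let w := A.prog.weight
  -- The input has height at most `κ + 1`, and each of the `A.time` steps adds at most `w + κ + 4`.
  -- The table starts empty, so `A.time` also bounds its length.
  let dmax : Polynomial ℕ :=
    Polynomial.X + 1 + A.time * (Polynomial.C w + Polynomial.X + 4)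
  -- Variable `40` is the variable `0` of the adversary, which receives its input and finally holds
  -- its output. Variable `1` keeps the security parameter, and `P` sets the clock to the time bound
  -- of the adversary.
  let cs : List Prog := .assign 40 (.var 0) :: .assign 1 (.var 0) :: (P ++ (A.prog.clocked ++
    [.assign 0 (.var 40)]))
  refine ⟨⟨.block cs, A.time * (gameTimePoly dmax A.time + Polynomial.C (3 * w + 40)) + q +
    Polynomial.C (w + cs.length + 4)⟩, fun {σ} κ g O hO o => ?_⟩
  have hdmax : dmax.eval κ = κ + 1 + A.time.eval κ * (w + κ + 4) := by simp [dmax]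
  have hrun := Prog.output_eq_map (P := .block cs) (O := O) (o := o) (input := Val.unary κ)
    (D := (steps (realClient g).withTable (A.time.eval κ)
        (([A.prog], Function.update (fun _ => Val.nil) 0 (Val.unary κ)), ((none, o), []))).bind
        fun z => PMF.pure (z.1.2 0)) (φ := id)
    (t := A.time.eval κ * stepTime κ w (dmax.eval κ) (A.time.eval κ) + q.eval κ +
      (w + cs.length + 4)) (Runs.mono (Runs.block (ks := []) (Runs.assign (Runs.assign (t := 0 + 1 +
      (A.time.eval κ * stepTime κ w (dmax.eval κ) (A.time.eval κ) + w) + q.eval κ) ?_))) (by omega))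
    (T := (A.time * (gameTimePoly dmax A.time + Polynomial.C (3 * w + 40)) + q +
      Polynomial.C (w + cs.length + 4)).eval κ) (le_of_eq ?_)
  · rw [PPT.output, hrun, PMF.map_id]
    rfl
  · change Runs O ((P ++ _) ++ []) _ _ _ _ _
    rw [List.append_nil]
    refine hP (by simp) fun s' h1 h2 => ?_
    have := runs_clocked (O := O) (ks := [.assign 0 (.var 40)]) (t := 0 + 1) (g := g)
      (R := fun a s' _ => s' 0 = id a) (w := w) (N := A.time.eval κ) (dmax := dmax.eval κ)
      (D := fun z => PMF.pure (z.1.2 0)) hO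
      (fun z s' hz => Runs.assign (Runs.nil (by simp [hz 0])))
      (T := A.time.eval κ) (d := κ + 1) (k := [A.prog]) (st := (none, o)) (τ := [])
      (sA := Function.update (fun _ => Val.nil) 0 (Val.unary κ)) (s := s')
      ⟨⟨?_, ?_, fun _ => ?_, by simp⟩, fun i => ?_, fun i => ?_, by simp, by simp, h1⟩
      (by simp [w]) hdmax.ge
    · simpa [w] using this
    · simp [h2 1 (by simp)]
    · simp [h2 4 (by simp), Table.toVal, Val.ofList]
    · simp [h2 5 (by simp)]
    · rw [h2 _ (by simp)]
      by_cases hi : i = 0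
      · simp [hi]
      · simp [hi]
    · by_cases hi : i = 0
      · have := Val.depth_ofBits_le (List.replicate κ true)
        rw [List.length_replicate] at this
        simp only [hi, Function.update_self, Val.unary]; omega
      · simp [hi, Val.depth]
  · simp only [Polynomial.eval_add, Polynomial.eval_mul, Polynomial.eval_C, eval_gameTimePoly,
      stepTime]
    ring

end

noncomputable section

open scoped ENNReal

/-! ## Security -/

theorem funOracle_eq {κ : ℕ} (f : List Bool → Block κ) (o : Unit) (q : Val) :
    funOracle f o q = (constFun f o q.toBits).map fun r => (r.1.toVal, r.2) := by
  simp [funOracle, constFun, PMF.pure_map]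

theorem randomFunOracle_eq {κ : ℕ} (ρ : FunTable κ) (q : Val) :
    randomFunOracle κ ρ q = (lazyFun ρ q.toBits).map fun r => (r.1.toVal, r.2) := by
  unfold randomFunOracle lazyFun
  cases ρ q.toBits <;> simp [PMF.pure_map, PMF.map_comp, Function.comp_def]

theorem lazyLoss_ne_top (κ t T : ℕ) : lazyLoss κ t T ≠ ⊤ := by
  unfold lazyLoss blockCount
  exact ENNReal.div_ne_top (ENNReal.natCast_ne_top _) (by positivity)

theorem toReal_lazyLoss (κ T : ℕ) : (lazyLoss κ 0 T).toReal = (T : ℝ) ^ 2 / 2 ^ κ := by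
  simp [lazyLoss, blockCount, sq]

theorem negligible_polynomial_div_two_pow (p : Polynomial ℕ) :
    Negligible fun κ => ((p.eval κ : ℕ) : ℝ) / 2 ^ κ := by
  have h2 : Negligible fun κ : ℕ => ((2 : ℝ) ^ κ)⁻¹ := by
    intro k
    have := tendsto_pow_const_mul_const_pow_of_abs_lt_one k (r := (1 / 2 : ℝ))
      (by rw [abs_of_pos] <;> norm_num)
    simpa using this
  have := h2.polynomial_mul (p.map (Nat.castRingHom ℝ))
  refine this.congr fun κ => ?_
  simp [div_eq_mul_inv, Polynomial.eval_natCast_map]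

/-- Whether the output of a halted machine is `1`. -/
def accepts (c : Config) : ℝ≥0∞ := if (c.2 0).toBool then 1 else 0

theorem accepts_le_one (c : Config) : accepts c ≤ 1 := by
  unfold accepts; split_ifs <;> simp

/-- The distance of the experiments, for a distinguisher of `F` that runs the adversary. -/
theorem exists_abs_realExp_sub_idealExp_le (F : KeyedFamily) (A : PPT) : ∃ B : PPT, ∀ κ,
    |realExp F A κ - idealExp simulator A κ| ≤
      |prfReal F B κ - prfRandom B κ| + 3 * (((A.time.eval κ : ℕ) : ℝ) ^ 2 / 2 ^ κ) := by
  obtain ⟨B, hB⟩ := exists_distinguisher A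
  refine ⟨B, fun κ => ?_⟩
  have hle : ∀ {σ : Type} (z : Config × σ), accepts z.1 ≤ 1 := fun z => accepts_le_one z.1
  let T := A.time.eval κ
  let c : Config := ([A.prog], Function.update (fun _ => Val.nil) 0 (Val.unary κ))
  let δ := lazyLoss κ 0 T
  have hδ : δ ≠ ⊤ := lazyLoss_ne_top κ 0 T
  -- The five games of the chain. `pRealTable` and `pLazy` are the two experiments of the
  -- distinguisher `B`, so their distance is its advantage; each of the other three passages costs
  -- `δ`.
  let pReal := (uniformBlock κ).bind fun msk => (idealCipher κ).bind fun E =>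
    steps ((realClient (constFun (F κ msk))).withCipher E) T (c, (none, ()))
  let pRealTable := (uniformBlock κ).bind fun msk =>
    steps (realClient (constFun (F κ msk))).withTable T (c, ((none, ()), []))
  let pLazy := steps (realClient lazyFun).withTable T (c, ((none, fun _ => none), ([] : Table κ)))
  let pSimTable := steps simClient.withTable T (c, ((none : SimState κ), []))
  let pSim := (idealCipher κ).bind fun E => steps (simClient.withCipher E) T (c, none)
  have hReal : realExp F A κ = (pReal.ev fun z => accepts z.1).toReal := by
    rw [realExp_eq]
    simp only [pReal, PMF.ev_bind]
    rfl
  have hSim : idealExp simulator A κ = (pSim.ev fun z => accepts z.1).toReal := by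
    rw [idealExp_eq]
    simp only [pSim, PMF.ev_bind]
    rfl
  have hRealTable : prfReal F B κ = (pRealTable.ev fun z => accepts z.1).toReal := by
    rw [prfReal, prOne_eq]
    simp only [pRealTable, PMF.ev_bind]
    congr 3
    funext msk
    rw [hB κ (constFun (F κ msk)) _ (funOracle_eq _), PMF.ev_map]
    rfl
  have hLazy : prfRandom B κ = (pLazy.ev fun z => accepts z.1).toReal := by
    rw [prfRandom, prOne_eq, hB κ lazyFun _ randomFunOracle_eq, PMF.ev_map]
    rfl
  have h1 : ∀ f : Config → ℝ≥0∞, (∀ z, f z ≤ 1) →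
      (pReal.ev fun z => f z.1) ≤ (pRealTable.ev fun z => f z.1) + δ := fun f hf => by
    simp only [pReal, pRealTable, PMF.ev_bind]
    rw [← PMF.ev_add_const]
    exact PMF.ev_mono _ fun msk => ev_idealCipher_steps_le _ (fun z => f z.1) (fun z => hf z.1) _ _ _
  have h2 : ∀ f : Config → ℝ≥0∞, (∀ z, f z ≤ 1) →
      (pSim.ev fun z => f z.1) ≤ (pSimTable.ev fun z => f z.1) + δ := fun f hf => by
    simp only [pSim, pSimTable, PMF.ev_bind]
    exact ev_idealCipher_steps_le _ (fun z => f z.1) (fun z => hf z.1) _ _ _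
  have h3 : ∀ f : Config → ℝ≥0∞, (∀ z, f z ≤ 1) →
      (pLazy.ev fun z => f z.1) ≤ (pSimTable.ev fun z => f z.1) + δ :=
    fun f hf => ev_real_lazy_le_sim f hf T c []
  -- The one-sided bounds hold for every test, in particular for acceptance and for its complement.
  have d1 := PMF.abs_sub_ev_toReal_le hle hle hδ (h1 _ accepts_le_one)
    (h1 (fun z => 1 - accepts z) fun _ => tsub_le_self)
  have d2 := PMF.abs_sub_ev_toReal_le hle hle hδ (h2 _ accepts_le_one)
    (h2 (fun z => 1 - accepts z) fun _ => tsub_le_self)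
  have d3 := PMF.abs_sub_ev_toReal_le hle hle hδ (h3 _ accepts_le_one)
    (h3 (fun z => 1 - accepts z) fun _ => tsub_le_self)
  rw [← hReal, ← hRealTable] at d1
  rw [← hSim, abs_sub_comm] at d2
  rw [← hLazy] at d3
  simp only [δ, toReal_lazyLoss, T] at d1 d2 d3
  have e1 := abs_sub_le (realExp F A κ) (prfReal F B κ) (idealExp simulator A κ)
  have e2 := abs_sub_le (prfReal F B κ) (prfRandom B κ) (idealExp simulator A κ)
  have e3 := abs_sub_le (prfRandom B κ) (pSimTable.ev fun z => accepts z.1).toReal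
    (idealExp simulator A κ)
  linarith

end

/-- If `F` is a pseudorandom function, then SHVE+ built from `F` and the ideal cipher is
attribute-hiding in the ideal cipher model. -/
theorem theorem2 (F : KeyedFamily) (hF : IsPRF F) : AttributeHiding F := by
  refine ⟨simulator, fun A => ?_⟩
  obtain ⟨B, hB⟩ := exists_abs_realExp_sub_idealExp_le F A
  have hneg : Negligible fun κ =>
      |prfReal F B κ - prfRandom B κ| + (((3 * A.time ^ 2 : Polynomial ℕ).eval κ : ℕ) : ℝ) / 2 ^ κ :=
    (hF.pseudorandom B).add (negligible_polynomial_div_two_pow _)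
  refine hneg.trans_abs_le fun κ => ?_
  refine (le_of_eq (abs_abs _)).trans ((hB κ).trans (le_trans (le_of_eq ?_) (le_abs_self _)))
  simp [mul_div_assoc]
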